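/- Let $\mathbb{k}$ be an algebraically closed field of characteristic zero, $G$ a finite group, $\chi: G\to\mathbb{k}^\times$ a linear character, $g$ a central element of $G$, $\mu\in\mathbb{k}$, and let $n$ be the order of $\chi(g)$. Assume that $n\ge 2$, $\chi^n=1$ and $\mu(g^n-1)\neq 0$ in $\mathbb{k}G$ (that is, $(G,\chi,g,\mu)$ is a group datum of non-nilpotent type). Let $H$ be the associated pointed Hopf algebra of rank one: the $\mathbb{k}$-algebra generated by $y$ and the elements of $G$, subject to the relations of $G$ and $$y^n=\mu(g^n-1),\qquad yh=\chi(h)hy\quad(h\in G),$$ with $\Delta(y)=y\otimes g+1\otimes y$, $\varepsilon(y)=0$, $S(y)=-yg^{-1}$, and $\Delta(h)=h\otimes h$, $\varepsilon(h)=1$, $S(h)=h^{-1}$ for $h\in G$. All modules are finite dimensional left modules. Let $F(H)$ be the free abelian group on the isomorphism classes $[M]$ of $H$-modules, with the product $[M][N]=[M\otimes N]$. The Green ring $r(H)$ is the quotient of $F(H)$ by the relations $[M\oplus N]=[M]+[N]$, and the Grothendieck ring $G_0(H)$ is the quotient of $F(H)$ by the relations $[Y]=[X]+[Z]$ for all short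 exact sequences $0\to X\to Y\to Z\to 0$. Let $\phi:r(H)\to G_0(H)$, $[M]\mapsto[M]$, be the natural ring epimorphism, let $\mathcal{P}\subseteq r(H)$ be the subgroup generated by the classes of the indecomposable projective modules, and let $\phi|_{\mathcal{P}}:\mathcal{P}\to G_0(H)$ be the Cartan map. Let $(-,-)$ be the $\mathbb{Z}$-bilinear form on $r(H)$ with $([X],[Y])=\dim_{\mathbb{k}}\operatorname{Hom}_H(X,Y^*)$, where $Y^*=\operatorname{Hom}_{\mathbb{k}}(Y,\mathbb{k})$ carries the action $(af)(v)=f(S(a)v)$, and put $\mathcal{P}^\perp=\{x\in r(H)\mid (x,z)=0\text{ for all }z\in\mathcal{P}\}$. Then the Jacobson radical of $r(H)$ is $$J(r(H))=\mathcal{P}\cap\mathcal{P}^\perp=\ker(\phi|_{\mathcal{P}}).$$ -/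

import Mathlib

open scoped TensorProduct

universe u v w

noncomputable section

/-! ## Finite dimensional modules over a Hopf algebra -/

/-- A finite dimensional left module over a `k`-algebra `A`. -/
structure FDMod (k : Type u) (A : Type v) [Field k] [Ring A] [Algebra k A] where
  carrier : Type u
  [addCommGroup : AddCommGroup carrier]
  [moduleBase : Module k carrier]
  [module : Module A carrier]
  [isScalarTower : IsScalarTower k A carrier]
  [finite : Module.Finite k carrier]

namespace FDMod

attribute [instance] addCommGroup moduleBase module isScalarTower finite

section Algebra

variable {k : Type u} {A : Type v} [Field k] [Ring A] [Algebra k A]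

instance : CoeSort (FDMod k A) (Type u) := ⟨carrier⟩

/-- The module attached to a representation of `A` on a finite dimensional vector space. -/
def ofRep (V : Type u) [AddCommGroup V] [Module k V] [Module.Finite k V]
    (ρ : A →ₐ[k] Module.End k V) : FDMod k A :=
  letI : Module A V := Module.compHom V ρ.toRingHom
  haveI : IsScalarTower k A V := ⟨fun c a x => by
    change ρ (c • a) x = c • ρ a x
    rw [map_smul, LinearMap.smul_apply]⟩
  { carrier := V }

/-- The representation of `A` on a module. -/
def rep (M : FDMod k A) : A →ₐ[k] Module.End k M := Algebra.lsmul k k M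

@[simp] theorem rep_apply (M : FDMod k A) (a : A) (x : M) : M.rep a x = a • x := rfl

/-- An equivalence of modules from an intertwining linear equivalence. -/
def equivOfLinear {M N : FDMod k A} (f : M ≃ₗ[k] N) (h : ∀ (a : A) (x : M), f (a • x) = a • f x) :
    M ≃ₗ[A] N :=
  { f with map_smul' := h }

/-- A module homomorphism from an intertwining linear map. -/
def homOfLinear {M N : FDMod k A} (f : M →ₗ[k] N) (h : ∀ (a : A) (x : M), f (a • x) = a • f x) :
    M →ₗ[A] N :=
  { f with map_smul' := h }

/-- The direct sum of two modules. -/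
def directSum (M N : FDMod k A) : FDMod k A where
  carrier := M × N

/-- `M` is nonzero, and is not the direct sum of two nonzero submodules. -/
def IsIndecomposable (M : FDMod k A) : Prop :=
  Nontrivial M ∧ ∀ p q : Submodule A M, IsCompl p q → p = ⊥ ∨ q = ⊥

/-- A short exact sequence `0 → X → Y → Z → 0` exists. -/
def IsExtension (X Y Z : FDMod k A) : Prop :=
  ∃ (f : X →ₗ[A] Y) (g : Y →ₗ[A] Z),
    Function.Injective f ∧ Function.Exact f g ∧ Function.Surjective g

variable (k A) in
/-- Isomorphism of modules. -/
instance isoSetoid : Setoid (FDMod k A) where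
  r M N := Nonempty (M ≃ₗ[A] N)
  iseqv := ⟨fun _ => ⟨.refl _ _⟩, fun ⟨e⟩ => ⟨e.symm⟩, fun ⟨e⟩ ⟨f⟩ => ⟨e.trans f⟩⟩

end Algebra

section Hopf

variable {k : Type u} {A : Type v} [Field k] [Ring A] [HopfAlgebra k A]

variable (k A) in
/-- The trivial module `k`, on which `A` acts through the counit. -/
def trivial : FDMod k A :=
  ofRep k ((Algebra.ofId k (Module.End k k)).comp (Bialgebra.counitAlgHom k A))

/-- The action of `A ⊗ A` on `M ⊗ N`. -/
def tensorAct (M N : FDMod k A) : A ⊗[k] A →ₐ[k] Module.End k (M ⊗[k] N) :=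
  (Module.endTensorEndAlgHom (R := k) (S := k) (A := k) (M := M) (N := N)).comp
    (Algebra.TensorProduct.map M.rep N.rep)

@[simp] theorem tensorAct_tmul (M N : FDMod k A) (a b : A) (x : M) (y : N) :
    tensorAct M N (a ⊗ₜ b) (x ⊗ₜ y) = (a • x) ⊗ₜ[k] (b • y) := rfl

/-- The tensor product `M ⊗ N` over `k`, on which `A` acts through the comultiplication. -/
def tensor (M N : FDMod k A) : FDMod k A :=
  ofRep (M ⊗[k] N) ((tensorAct M N).comp (Bialgebra.comulAlgHom k A))

/-- The dual `Hom_k(M, k)`, with `(a f)(x) = f (S(a) x)`. -/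
def dual (M : FDMod k A) : FDMod k A :=
  ofRep (Module.Dual k M)
    (AlgHom.ofLinearMap
      { toFun := fun a => Module.Dual.transpose (R := k) (M.rep (HopfAlgebra.antipode k a))
        map_add' := fun a b => by simp
        map_smul' := fun c a => by simp }
      (by
        ext f x
        simp [HopfAlgebra.antipode_one, Module.Dual.transpose_apply])
      (fun a b => by
        ext f x
        simp [HopfAlgebra.antipode_mul_antidistrib, Module.Dual.transpose_apply]))

theorem dual_smul_apply (M : FDMod k A) (a : A) (f : Module.Dual k M) (x : M) :
    (show Module.Dual k M from a • (show M.dual from f)) x =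
      f (HopfAlgebra.antipode k a • x) := rfl

theorem tensor_smul (M N : FDMod k A) (a : A) (t : M ⊗[k] N) :
    (a • (show M.tensor N from t) : M.tensor N) = tensorAct M N (Coalgebra.comul a) t := rfl

theorem trivial_smul (a : A) (c : k) :
    (a • (show trivial k A from c) : trivial k A) = Coalgebra.counit (R := k) a * c := by
  change (algebraMap k (Module.End k k) (Coalgebra.counit (R := k) a)) c = _
  simp [Module.algebraMap_end_apply]

theorem map_tensorAct {M M' N N' : FDMod k A} (f : M →ₗ[A] M') (g : N →ₗ[A] N') (s : A ⊗[k] A)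
    (t : M ⊗[k] N) :
    TensorProduct.map (f.restrictScalars k) (g.restrictScalars k) (tensorAct M N s t) =
      tensorAct M' N' s (TensorProduct.map (f.restrictScalars k) (g.restrictScalars k) t) := by
  induction s with
  | zero => simp
  | add s s' hs hs' => simp only [map_add, LinearMap.add_apply, hs, hs']
  | tmul a b =>
    induction t with
    | zero => simp
    | add t t' ht ht' => simp only [map_add, ht, ht']
    | tmul x y => simp

/-- Functoriality of the tensor product. -/
def tensorMap {M M' N N' : FDMod k A} (f : M →ₗ[A] M') (g : N →ₗ[A] N') :
    M.tensor N →ₗ[A] M'.tensor N' :=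
  homOfLinear (M := M.tensor N) (N := M'.tensor N')
    (TensorProduct.map (f.restrictScalars k) (g.restrictScalars k))
    (fun a t => map_tensorAct f g (Coalgebra.comul a) t)

/-- Tensor products of isomorphic modules are isomorphic. -/
def tensorCongr {M M' N N' : FDMod k A} (e : M ≃ₗ[A] M') (f : N ≃ₗ[A] N') :
    M.tensor N ≃ₗ[A] M'.tensor N' :=
  equivOfLinear (M := M.tensor N) (N := M'.tensor N')
    (TensorProduct.congr (e.restrictScalars k) (f.restrictScalars k))
    (fun a t => map_tensorAct e.toLinearMap f.toLinearMap (Coalgebra.comul a) t)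

/-- The orbit map `a ↦ a x`. -/
def orbit (M : FDMod k A) (x : M) : A →ₗ[k] M := (LinearMap.applyₗ x).comp M.rep.toLinearMap

@[simp] theorem orbit_apply (M : FDMod k A) (x : M) (a : A) : M.orbit x a = a • x := rfl

theorem tensorAct_eq_map (M N : FDMod k A) (s : A ⊗[k] A) (x : M) (y : N) :
    tensorAct M N s (x ⊗ₜ y) = TensorProduct.map (M.orbit x) (N.orbit y) s := by
  induction s with
  | zero => simp
  | add s s' hs hs' => simp only [map_add, LinearMap.add_apply, hs, hs']
  | tmul a b => simp

theorem orbit_tensor (M N : FDMod k A) (x : M) (y : N) :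
    (M.tensor N).orbit (x ⊗ₜ[k] y : M ⊗[k] N) =
      (TensorProduct.map (M.orbit x) (N.orbit y)).comp Coalgebra.comul := by
  ext a
  exact tensorAct_eq_map M N _ x y

/-- Associativity of the tensor product. -/
def tensorAssoc (L M N : FDMod k A) :
    (L.tensor M).tensor N ≃ₗ[A] L.tensor (M.tensor N) :=
  equivOfLinear (M := (L.tensor M).tensor N) (N := L.tensor (M.tensor N))
    (TensorProduct.assoc k L M N) (fun a t => by
      change TensorProduct.assoc k L M N (tensorAct (L.tensor M) N (Coalgebra.comul a) t) =
        tensorAct L (M.tensor N) (Coalgebra.comul a) (TensorProduct.assoc k L M N t)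
      suffices h : (TensorProduct.assoc k L M N).toLinearMap.comp
          (tensorAct (L.tensor M) N (Coalgebra.comul a)) =
          (tensorAct L (M.tensor N) (Coalgebra.comul a)).comp
            (TensorProduct.assoc k L M N).toLinearMap from LinearMap.congr_fun h t
      apply TensorProduct.ext_threefold
      intro x y z
      change TensorProduct.assoc k L M N (tensorAct (L.tensor M) N (Coalgebra.comul a)
          ((show L.tensor M from x ⊗ₜ[k] y) ⊗ₜ[k] z)) =
        tensorAct L (M.tensor N) (Coalgebra.comul a) (x ⊗ₜ[k] (show M.tensor N from y ⊗ₜ[k] z))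
      rw [tensorAct_eq_map, tensorAct_eq_map]
      have h1 := orbit_tensor L M x y
      have h2 := orbit_tensor M N y z
      have key := congrArg (TensorProduct.map (L.orbit x)
        (TensorProduct.map (M.orbit y) (N.orbit z))) (Coalgebra.coassoc_apply (R := k) a)
      have e1 : ∀ s : (A ⊗[k] A) ⊗[k] A,
          TensorProduct.map (L.orbit x) (TensorProduct.map (M.orbit y) (N.orbit z))
            (TensorProduct.assoc k A A A s) =
          TensorProduct.assoc k L M N
            (TensorProduct.map (TensorProduct.map (L.orbit x) (M.orbit y)) (N.orbit z) s) := by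
        intro s
        have := LinearMap.congr_fun (TensorProduct.map_map_comp_assoc_eq
          (L.orbit x) (M.orbit y) (N.orbit z)) s
        simpa using this
      rw [e1] at key
      refine Eq.trans ?_ (key.trans ?_)
      · congr 1
        generalize Coalgebra.comul (R := k) a = s
        induction s with
        | zero => rfl
        | add s s' hs hs' =>
          simp only [map_add] at hs hs' ⊢
          rw [← hs, ← hs']
          rfl
        | tmul b c =>
          simp only [LinearMap.rTensor_tmul, TensorProduct.map_tmul]
          exact congrArg (fun w : L ⊗[k] M => w ⊗ₜ[k] N.orbit z c) (LinearMap.congr_fun h1 b)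
      · generalize Coalgebra.comul (R := k) a = s
        induction s with
        | zero => rfl
        | add s s' hs hs' =>
          simp only [map_add] at hs hs' ⊢
          rw [hs, hs']
          rfl
        | tmul b c =>
          simp only [LinearMap.lTensor_tmul, TensorProduct.map_tmul]
          exact congrArg (L.orbit x b ⊗ₜ[k] ·) (LinearMap.congr_fun h2 c).symm)

/-- The trivial module is a left unit for the tensor product. -/
def trivialTensor (M : FDMod k A) : (trivial k A).tensor M ≃ₗ[A] M :=
  equivOfLinear (M := (trivial k A).tensor M) (TensorProduct.lid k M) (fun a t => by
    change TensorProduct.lid k M (tensorAct (trivial k A) M (Coalgebra.comul a) t) =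
      a • TensorProduct.lid k M t
    suffices h : (TensorProduct.lid k M).toLinearMap.comp
        (tensorAct (trivial k A) M (Coalgebra.comul a)) =
        (M.rep a).comp (TensorProduct.lid k M).toLinearMap from LinearMap.congr_fun h t
    apply TensorProduct.ext'
    intro (c : k) x
    change TensorProduct.lid k M (tensorAct (trivial k A) M (Coalgebra.comul a)
      ((show trivial k A from c) ⊗ₜ[k] x)) = a • TensorProduct.lid k M (c ⊗ₜ[k] x)
    refine (congrArg (TensorProduct.lid k M) (tensorAct_eq_map (trivial k A) M _ (show trivial k A from c) x)).trans ?_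
    rw [TensorProduct.lid_tmul]
    have key := congrArg (fun s => TensorProduct.lid k M
      (TensorProduct.map LinearMap.id (M.orbit (c • x)) s))
      (Coalgebra.rTensor_counit_comul (R := k) a)
    simp only [TensorProduct.map_tmul, TensorProduct.lid_tmul, orbit_apply, LinearMap.id_apply,
      one_smul] at key
    refine Eq.trans ?_ key
    generalize Coalgebra.comul (R := k) a = s
    induction s with
    | zero =>
      simp only [map_zero]
      exact map_zero (TensorProduct.lid k M)
    | add s s' hs hs' =>
      simp only [map_add] at hs hs' ⊢
      rw [← hs, ← hs']
      exact map_add (TensorProduct.lid k M) _ _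
    | tmul b d =>
      simp only [LinearMap.rTensor_tmul, TensorProduct.map_tmul, orbit_apply,
        LinearMap.id_apply, TensorProduct.lid_tmul]
      refine (congrArg (fun r : k => r • (d • x)) (trivial_smul b c)).trans ?_
      rw [mul_smul, smul_comm d c x])

/-- The trivial module is a right unit for the tensor product. -/
def tensorTrivial (M : FDMod k A) : M.tensor (trivial k A) ≃ₗ[A] M :=
  equivOfLinear (M := M.tensor (trivial k A)) (TensorProduct.rid k M) (fun a t => by
    change TensorProduct.rid k M (tensorAct M (trivial k A) (Coalgebra.comul a) t) =
      a • TensorProduct.rid k M t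
    suffices h : (TensorProduct.rid k M).toLinearMap.comp
        (tensorAct M (trivial k A) (Coalgebra.comul a)) =
        (M.rep a).comp (TensorProduct.rid k M).toLinearMap from LinearMap.congr_fun h t
    apply TensorProduct.ext'
    intro x (c : k)
    change TensorProduct.rid k M (tensorAct M (trivial k A) (Coalgebra.comul a)
      (x ⊗ₜ[k] (show trivial k A from c))) = a • TensorProduct.rid k M (x ⊗ₜ[k] c)
    refine (congrArg (TensorProduct.rid k M) (tensorAct_eq_map M (trivial k A) _ x (show trivial k A from c))).trans ?_
    rw [TensorProduct.rid_tmul]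
    have key := congrArg (fun s => TensorProduct.rid k M
      (TensorProduct.map (M.orbit (c • x)) LinearMap.id s))
      (Coalgebra.lTensor_counit_comul (R := k) a)
    simp only [TensorProduct.map_tmul, TensorProduct.rid_tmul, orbit_apply, LinearMap.id_apply,
      one_smul] at key
    refine Eq.trans ?_ key
    generalize Coalgebra.comul (R := k) a = s
    induction s with
    | zero =>
      simp only [map_zero]
      exact map_zero (TensorProduct.rid k M)
    | add s s' hs hs' =>
      simp only [map_add] at hs hs' ⊢
      rw [← hs, ← hs']
      exact map_add (TensorProduct.rid k M) _ _
    | tmul b d =>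
      simp only [LinearMap.lTensor_tmul, TensorProduct.map_tmul, orbit_apply,
        LinearMap.id_apply, TensorProduct.rid_tmul]
      refine (congrArg (fun r : k => r • (b • x)) (trivial_smul d c)).trans ?_
      rw [mul_smul, smul_comm b c x])

theorem IsExtension.tensor_right {X Y Z : FDMod k A} (h : IsExtension X Y Z) (M : FDMod k A) :
    IsExtension (X.tensor M) (Y.tensor M) (Z.tensor M) := by
  obtain ⟨f, g, hf, hfg, hg⟩ := h
  refine ⟨tensorMap f LinearMap.id, tensorMap g LinearMap.id, ?_, ?_, ?_⟩
  · exact Module.Flat.rTensor_preserves_injective_linearMap (M := M) (f.restrictScalars k) hf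
  · exact rTensor_exact (f := f.restrictScalars k) (g := g.restrictScalars k) M hfg hg
  · exact LinearMap.rTensor_surjective (g := g.restrictScalars k) M hg

theorem IsExtension.tensor_left {X Y Z : FDMod k A} (h : IsExtension X Y Z) (M : FDMod k A) :
    IsExtension (M.tensor X) (M.tensor Y) (M.tensor Z) := by
  obtain ⟨f, g, hf, hfg, hg⟩ := h
  refine ⟨tensorMap LinearMap.id f, tensorMap LinearMap.id g, ?_, ?_, ?_⟩
  · exact Module.Flat.lTensor_preserves_injective_linearMap (M := M) (f.restrictScalars k) hf
  · exact lTensor_exact (f := f.restrictScalars k) (g := g.restrictScalars k) M hfg hg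
  · exact LinearMap.lTensor_surjective (g := g.restrictScalars k) M hg

/-- The tensor product distributes over direct sums. -/
def directSumTensor (M N L : FDMod k A) :
    (M.directSum N).tensor L ≃ₗ[A] (M.tensor L).directSum (N.tensor L) :=
  LinearEquiv.ofBijective
    (LinearMap.prod (tensorMap (M := M.directSum N) (LinearMap.fst A M N) LinearMap.id)
      (tensorMap (M := M.directSum N) (LinearMap.snd A M N) LinearMap.id) :
      (M.directSum N).tensor L →ₗ[A] M.tensor L × N.tensor L)
    (by
      have h : ∀ t : (M × N) ⊗[k] L,
          ((LinearMap.fst k M N).rTensor L t, (LinearMap.snd k M N).rTensor L t) =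
            TensorProduct.prodLeft k k M N L t := by
        intro t
        induction t with
        | zero => simp
        | add t t' ht ht' => rw [map_add, map_add, map_add, ← ht, ← ht']; rfl
        | tmul x y => rfl
      have h' := (TensorProduct.prodLeft k k M N L).bijective
      rwa [show (TensorProduct.prodLeft k k M N L : (M × N) ⊗[k] L → _) = _ from
        (funext fun t => (h t).symm)] at h')

/-- The tensor product distributes over direct sums. -/
def tensorDirectSum (L M N : FDMod k A) :
    L.tensor (M.directSum N) ≃ₗ[A] (L.tensor M).directSum (L.tensor N) :=
  LinearEquiv.ofBijective
    (LinearMap.prod (tensorMap (N := M.directSum N) LinearMap.id (LinearMap.fst A M N))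
      (tensorMap (N := M.directSum N) LinearMap.id (LinearMap.snd A M N)) :
      L.tensor (M.directSum N) →ₗ[A] L.tensor M × L.tensor N)
    (by
      have h : ∀ t : L ⊗[k] (M × N),
          ((LinearMap.fst k M N).lTensor L t, (LinearMap.snd k M N).lTensor L t) =
            TensorProduct.prodRight k k L M N t := by
        intro t
        induction t with
        | zero => simp
        | add t t' ht ht' => rw [map_add, map_add, map_add, ← ht, ← ht']; rfl
        | tmul x y => rfl
      have h' := (TensorProduct.prodRight k k L M N).bijective
      rwa [show (TensorProduct.prodRight k k L M N : L ⊗[k] (M × N) → _) = _ from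
        (funext fun t => (h t).symm)] at h')

/-- The dual of an isomorphism. -/
def dualCongr {M N : FDMod k A} (e : M ≃ₗ[A] N) : M.dual ≃ₗ[A] N.dual :=
  equivOfLinear (M := M.dual) (N := N.dual)
    (LinearEquiv.dualMap (e.symm.restrictScalars k)) (fun a f => by
      refine LinearMap.ext fun (x : N) => ?_
      exact congrArg (show Module.Dual k M from f)
        (map_smul e.symm (HopfAlgebra.antipode k a) x).symm)

/-- Duality is additive. -/
def dualDirectSum (M N : FDMod k A) :
    (M.directSum N).dual ≃ₗ[A] M.dual.directSum N.dual :=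
  (equivOfLinear (M := M.dual.directSum N.dual) (N := (M.directSum N).dual)
    (LinearMap.coprodEquiv (R := k) (M := M) (M₂ := N) (M₃ := k) k) (fun a f => by
      refine LinearMap.ext fun (x : M × N) => ?_
      rfl)).symm

end Hopf
end FDMod

/-! ## Green rings and Grothendieck rings -/

/-- Isomorphism classes of finite dimensional `A`-modules. -/
def IsoClass (k : Type u) (A : Type v) [Field k] [Ring A] [Algebra k A] : Type _ :=
  Quotient (FDMod.isoSetoid k A)

section Rings

variable {k : Type u} {A : Type v} [Field k] [Ring A]

/-- The isomorphism class of a module. -/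
def FDMod.cls [Algebra k A] (M : FDMod k A) : IsoClass k A := Quotient.mk _ M

theorem FDMod.cls_eq [Algebra k A] {M N : FDMod k A} (e : M ≃ₗ[A] N) : M.cls = N.cls :=
  Quotient.sound ⟨e⟩

variable [HopfAlgebra k A]

/-- Isomorphism classes form a monoid under the tensor product, with unit `[k]`. -/
instance IsoClass.instMonoid : Monoid (IsoClass k A) where
  mul := Quotient.map₂ FDMod.tensor
    (fun _ _ ⟨e⟩ _ _ ⟨f⟩ => ⟨FDMod.tensorCongr e f⟩)
  one := (FDMod.trivial k A).cls
  mul_assoc := by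
    rintro ⟨L⟩ ⟨M⟩ ⟨N⟩
    exact FDMod.cls_eq (FDMod.tensorAssoc L M N)
  one_mul := by
    rintro ⟨M⟩
    exact FDMod.cls_eq (FDMod.trivialTensor M)
  mul_one := by
    rintro ⟨M⟩
    exact FDMod.cls_eq (FDMod.tensorTrivial M)

theorem FDMod.cls_tensor (M N : FDMod k A) : (M.tensor N).cls = M.cls * N.cls := rfl

variable (k A) in
/-- The free abelian group `F(A)` on the isomorphism classes, with the product
`[M][N] = [M ⊗ N]`. -/
abbrev FreeModRing : Type _ := FreeAbelianGroup (IsoClass k A)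

/-- The class of a module in `F(A)`. -/
def FDMod.free (M : FDMod k A) : FreeModRing k A := FreeAbelianGroup.of M.cls

theorem FDMod.free_mul (M N : FDMod k A) : M.free * N.free = (M.tensor N).free := by
  simp only [FDMod.free, FDMod.cls_tensor, FreeAbelianGroup.of_mul_of]

/-- The additive span of a set of elements stable under products with classes of modules, as an
ideal. -/
def spanIdeal (R : Set (FreeModRing k A))
    (hl : ∀ (M : FDMod k A), ∀ r ∈ R, M.free * r ∈ AddSubgroup.closure R) :
    Ideal (FreeModRing k A) where
  __ := AddSubgroup.closure R
  smul_mem' := by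
    intro c x hx
    change c * x ∈ AddSubgroup.closure R
    induction hx using AddSubgroup.closure_induction with
    | zero => simp
    | add x y _ _ hx hy => rw [mul_add]; exact add_mem hx hy
    | neg x _ hx => rw [mul_neg]; exact neg_mem hx
    | mem x hx =>
      induction c using FreeAbelianGroup.induction_on with
      | zero => simp
      | of a =>
        obtain ⟨M⟩ := a
        exact hl M x hx
      | neg a ha => rw [neg_mul]; exact neg_mem ha
      | add a b ha hb => rw [add_mul]; exact add_mem ha hb

theorem spanIdeal_isTwoSided (R : Set (FreeModRing k A))
    (hl : ∀ (M : FDMod k A), ∀ r ∈ R, M.free * r ∈ AddSubgroup.closure R)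
    (hr : ∀ (M : FDMod k A), ∀ r ∈ R, r * M.free ∈ AddSubgroup.closure R) :
    (spanIdeal R hl).IsTwoSided := by
  refine ⟨?_⟩
  intro x c hx
  change x * c ∈ AddSubgroup.closure R
  change x ∈ AddSubgroup.closure R at hx
  induction hx using AddSubgroup.closure_induction with
  | zero => simp
  | add x y _ _ hx hy => rw [add_mul]; exact add_mem hx hy
  | neg x _ hx => rw [neg_mul]; exact neg_mem hx
  | mem x hx =>
    induction c using FreeAbelianGroup.induction_on with
    | zero => simp
    | of a =>
      obtain ⟨M⟩ := a
      exact hr M x hx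
    | neg a ha => rw [mul_neg]; exact neg_mem ha
    | add a b ha hb => rw [mul_add]; exact add_mem ha hb

variable (k A) in
/-- The elements `[M ⊕ N] - [M] - [N]`. -/
def splitRelations : Set (FreeModRing k A) :=
  {r | ∃ M N : FDMod k A, r = (M.directSum N).free - M.free - N.free}

variable (k A) in
/-- The elements `[Y] - [X] - [Z]` for short exact sequences `0 → X → Y → Z → 0`. -/
def exactRelations : Set (FreeModRing k A) :=
  {r | ∃ X Y Z : FDMod k A, FDMod.IsExtension X Y Z ∧ r = Y.free - X.free - Z.free}

theorem splitRelations_left (L : FDMod k A) : ∀ r ∈ splitRelations k A,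
    L.free * r ∈ AddSubgroup.closure (splitRelations k A) := by
  rintro _ ⟨M, N, rfl⟩
  refine AddSubgroup.subset_closure ⟨L.tensor M, L.tensor N, ?_⟩
  simp only [mul_sub, FDMod.free_mul]
  simp only [FDMod.free, FDMod.cls_eq (FDMod.tensorDirectSum L M N)]

theorem splitRelations_right (L : FDMod k A) : ∀ r ∈ splitRelations k A,
    r * L.free ∈ AddSubgroup.closure (splitRelations k A) := by
  rintro _ ⟨M, N, rfl⟩
  refine AddSubgroup.subset_closure ⟨M.tensor L, N.tensor L, ?_⟩
  simp only [sub_mul, FDMod.free_mul]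
  simp only [FDMod.free, FDMod.cls_eq (FDMod.directSumTensor M N L)]

theorem exactRelations_left (L : FDMod k A) : ∀ r ∈ exactRelations k A,
    L.free * r ∈ AddSubgroup.closure (exactRelations k A) := by
  rintro _ ⟨X, Y, Z, h, rfl⟩
  refine AddSubgroup.subset_closure ⟨_, _, _, h.tensor_left L, ?_⟩
  simp only [mul_sub, FDMod.free_mul]

theorem exactRelations_right (L : FDMod k A) : ∀ r ∈ exactRelations k A,
    r * L.free ∈ AddSubgroup.closure (exactRelations k A) := by
  rintro _ ⟨X, Y, Z, h, rfl⟩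
  refine AddSubgroup.subset_closure ⟨_, _, _, h.tensor_right L, ?_⟩
  simp only [sub_mul, FDMod.free_mul]

variable (k A) in
/-- The ideal of `F(A)` of relations `[M ⊕ N] = [M] + [N]`. -/
def greenIdeal : Ideal (FreeModRing k A) := spanIdeal (splitRelations k A) splitRelations_left

variable (k A) in
/-- The ideal of `F(A)` of relations `[Y] = [X] + [Z]` for short exact sequences
`0 → X → Y → Z → 0`. -/
def grothendieckIdeal : Ideal (FreeModRing k A) :=
  spanIdeal (exactRelations k A) exactRelations_left

instance : (greenIdeal k A).IsTwoSided :=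
  spanIdeal_isTwoSided _ splitRelations_left splitRelations_right

instance : (grothendieckIdeal k A).IsTwoSided :=
  spanIdeal_isTwoSided _ exactRelations_left exactRelations_right

variable (k A) in
/-- The Green ring `r(A)`. -/
abbrev GreenRing : Type _ := FreeModRing k A ⧸ greenIdeal k A

variable (k A) in
/-- The Grothendieck ring `G₀(A)`. -/
abbrev GrothendieckRing : Type _ := FreeModRing k A ⧸ grothendieckIdeal k A

/-- The class of a module in the Green ring. -/
def FDMod.green (M : FDMod k A) : GreenRing k A := Ideal.Quotient.mk _ M.free

theorem greenIdeal_le : greenIdeal k A ≤ grothendieckIdeal k A := by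
  refine (AddSubgroup.closure_le _).2 ?_
  rintro _ ⟨M, N, rfl⟩
  refine AddSubgroup.subset_closure ⟨M, M.directSum N, N, ⟨LinearMap.inl A M N,
    LinearMap.snd A M N, LinearMap.inl_injective, Function.Exact.inl_snd,
    LinearMap.snd_surjective⟩, rfl⟩

variable (k A) in
/-- The natural ring epimorphism `φ : r(A) → G₀(A)`, `[M] ↦ [M]`. -/
def greenToGrothendieck : GreenRing k A →+* GrothendieckRing k A :=
  Ideal.Quotient.factor greenIdeal_le

variable (k A) in
/-- The subgroup of `r(A)` generated by the classes of the indecomposable projective modules. -/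
def projectiveSpan : AddSubgroup (GreenRing k A) :=
  AddSubgroup.closure
    {x | ∃ M : FDMod k A, M.IsIndecomposable ∧ Module.Projective A M ∧ x = M.green}

variable (k A) in
/-- The Cartan map: the restriction of `φ` to `projectiveSpan`. -/
def cartanMap : projectiveSpan k A →+ GrothendieckRing k A :=
  (greenToGrothendieck k A).toAddMonoidHom.comp (projectiveSpan k A).subtype

/-- A map on isomorphism classes that is additive on direct sums extends to the Green ring. -/
def GreenRing.liftAdd {B : Type w} [AddCommGroup B] (f : IsoClass k A → B)
    (hf : ∀ M N : FDMod k A, f (M.directSum N).cls = f M.cls + f N.cls) : GreenRing k A →+ B :=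
  QuotientAddGroup.lift (greenIdeal k A).toAddSubgroup (FreeAbelianGroup.lift f) (by
    change AddSubgroup.closure _ ≤ _
    refine (AddSubgroup.closure_le _).2 ?_
    rintro _ ⟨M, N, rfl⟩
    simp [FDMod.free, hf])

@[simp] theorem GreenRing.liftAdd_green {B : Type w} [AddCommGroup B] (f : IsoClass k A → B)
    (hf : ∀ M N : FDMod k A, f (M.directSum N).cls = f M.cls + f N.cls) (M : FDMod k A) :
    GreenRing.liftAdd f hf M.green = f M.cls :=
  FreeAbelianGroup.lift_apply_of f M.cls

theorem FDMod.finite_hom (M N : FDMod k A) : Module.Finite k (M →ₗ[A] N) :=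
  Module.Finite.of_injective (LinearMap.restrictScalarsₗ k A M N k)
    (LinearMap.restrictScalars_injective k)

/-- `dim Hom_A(M, N*)`. -/
def dimHomDual (M N : FDMod k A) : ℤ := Module.finrank k (M →ₗ[A] N.dual)

theorem dimHomDual_congr {M M' N N' : FDMod k A} (e : M ≃ₗ[A] M') (f : N ≃ₗ[A] N') :
    dimHomDual M N = dimHomDual M' N' := by
  refine congrArg Nat.cast (LinearEquiv.finrank_eq (LinearEquiv.ofLinearMap
    { toFun := fun h => ((FDMod.dualCongr f).toLinearMap.comp h).comp e.symm.toLinearMap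
      map_add' := fun g h => by ext x; simp
      map_smul' := fun c h => by
        ext x
        exact ((FDMod.dualCongr f).restrictScalars k).map_smul c (h (e.symm x)) }
    { toFun := fun h => ((FDMod.dualCongr f).symm.toLinearMap.comp h).comp e.toLinearMap
      map_add' := fun g h => by ext x; simp
      map_smul' := fun c h => by
        ext x
        exact ((FDMod.dualCongr f).symm.restrictScalars k).map_smul c (h (e x)) }
    (by ext h x; simp) (by ext h x; simp)))

theorem dimHomDual_directSum_left (M M' N : FDMod k A) :
    dimHomDual (M.directSum M') N = dimHomDual M N + dimHomDual M' N := by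
  have := FDMod.finite_hom M N.dual
  have := FDMod.finite_hom M' N.dual
  have h := (LinearMap.coprodEquiv (R := A) (M := M) (M₂ := M') (M₃ := N.dual) k).finrank_eq
  rw [Module.finrank_prod] at h
  unfold dimHomDual
  exact_mod_cast h.symm

theorem dimHomDual_directSum_right (M N N' : FDMod k A) :
    dimHomDual M (N.directSum N') = dimHomDual M N + dimHomDual M N' := by
  have := FDMod.finite_hom M N.dual
  have := FDMod.finite_hom M N'.dual
  have h := (LinearMap.prodEquiv (R := A) (M := M) (M₂ := N.dual) (M₃ := N'.dual) k).finrank_eq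
  rw [Module.finrank_prod] at h
  have h' : Module.finrank k (M →ₗ[A] (N.directSum N').dual) =
      Module.finrank k (M →ₗ[A] N.dual × N'.dual) :=
    LinearEquiv.finrank_eq (LinearEquiv.ofLinearMap
      { toFun := fun h => (FDMod.dualDirectSum N N').toLinearMap.comp h
        map_add' := fun g h => by
          refine LinearMap.ext fun x => ?_
          exact map_add (FDMod.dualDirectSum N N') (g x) (h x)
        map_smul' := fun c h => by
          refine LinearMap.ext fun x => ?_
          exact ((FDMod.dualDirectSum N N').restrictScalars k).map_smul c (h x) }
      { toFun := fun h => (FDMod.dualDirectSum N N').symm.toLinearMap.comp h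
        map_add' := fun g h => by
          refine LinearMap.ext fun x => ?_
          exact map_add (FDMod.dualDirectSum N N').symm (g x) (h x)
        map_smul' := fun c h => by
          refine LinearMap.ext fun x => ?_
          exact ((FDMod.dualDirectSum N N').symm.restrictScalars k).map_smul c (h x) }
      (by
        refine LinearMap.ext fun h => LinearMap.ext fun x => ?_
        exact (FDMod.dualDirectSum N N').apply_symm_apply (h x))
      (by
        refine LinearMap.ext fun h => LinearMap.ext fun x => ?_
        exact (FDMod.dualDirectSum N N').symm_apply_apply (h x)))
  unfold dimHomDual
  exact_mod_cast h'.trans h.symm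

/-- `dim Hom_A(M, N*)` as a function of isomorphism classes. -/
def clsForm : IsoClass k A → IsoClass k A → ℤ :=
  Quotient.lift₂ dimHomDual (fun _ _ _ _ ⟨e⟩ ⟨f⟩ => dimHomDual_congr e f)

/-- The additive extension of `clsForm c` to the Green ring. -/
def clsFormLift (c : IsoClass k A) : GreenRing k A →+ ℤ :=
  GreenRing.liftAdd (clsForm c) (by
    obtain ⟨M⟩ := c
    exact dimHomDual_directSum_right M)

theorem GreenRing.addHom_ext {B : Type w} [AddCommGroup B] {f g : GreenRing k A →+ B}
    (h : ∀ M : FDMod k A, f M.green = g M.green) : f = g := by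
  have h' : f.comp (Ideal.Quotient.mk (greenIdeal k A)).toAddMonoidHom =
      g.comp (Ideal.Quotient.mk (greenIdeal k A)).toAddMonoidHom := by
    refine FreeAbelianGroup.lift_ext _ _ ?_
    rintro ⟨M⟩
    exact h M
  ext x
  obtain ⟨y, rfl⟩ := Ideal.Quotient.mk_surjective x
  exact DFunLike.congr_fun h' y

variable (k A) in
/-- The bilinear form on `r(A)` with `([M], [N]) = dim Hom_A(M, N*)`. -/
def greenForm : GreenRing k A →+ GreenRing k A →+ ℤ :=
  GreenRing.liftAdd clsFormLift (fun M M' => GreenRing.addHom_ext fun N => by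
    simp only [AddMonoidHom.add_apply, clsFormLift, GreenRing.liftAdd_green]
    exact dimHomDual_directSum_left M M' N)

theorem greenForm_green (M N : FDMod k A) :
    greenForm k A M.green N.green = Module.finrank k (M →ₗ[A] N.dual) := by
  simp only [greenForm, clsFormLift, GreenRing.liftAdd_green]
  rfl

/-- The orthogonal complement of a subgroup of `r(A)` for the form `greenForm`. -/
def greenOrthogonal (P : AddSubgroup (GreenRing k A)) : AddSubgroup (GreenRing k A) where
  carrier := {x | ∀ y ∈ P, greenForm k A x y = 0}
  zero_mem' := by simp
  add_mem' := by
    intro x x' hx hx' y hy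
    simp [hx y hy, hx' y hy]
  neg_mem' := by
    intro x hx y hy
    simp [hx y hy]

end Rings

end

noncomputable section

/-! ## The quantum binomial formula at a root of unity -/

section QBinomial

variable {k : Type u} [Field k]

/-- Gaussian binomial coefficients. -/
def gaussBinom (q : k) : ℕ → ℕ → k
  | _, 0 => 1
  | 0, _ + 1 => 0
  | m + 1, i + 1 => gaussBinom q m i + q ^ (i + 1) * gaussBinom q m (i + 1)

theorem gaussBinom_zero_right (q : k) (m : ℕ) : gaussBinom q m 0 = 1 := by
  cases m <;> rfl

theorem gaussBinom_of_lt (q : k) : ∀ m i : ℕ, m < i → gaussBinom q m i = 0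
  | 0, i + 1, _ => rfl
  | m + 1, i + 1, h => by
    rw [gaussBinom, gaussBinom_of_lt q m i (by omega), gaussBinom_of_lt q m (i + 1) (by omega)]
    simp

theorem gaussBinom_self (q : k) (m : ℕ) : gaussBinom q m m = 1 := by
  induction m with
  | zero => rfl
  | succ m ih => rw [gaussBinom, ih, gaussBinom_of_lt q m (m + 1) (by omega)]; simp

/-- The quantum integer `1 + q + ⋯ + q ^ (m - 1)`. -/
def qNum (q : k) (m : ℕ) : k := ∑ t ∈ Finset.range m, q ^ t

/-- The quantum factorial. -/
def qFact (q : k) (m : ℕ) : k := ∏ l ∈ Finset.range m, qNum q (l + 1)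

theorem qNum_add (q : k) (a b : ℕ) : qNum q (a + b) = qNum q a + q ^ a * qNum q b := by
  simp [qNum, Finset.sum_range_add, Finset.mul_sum, pow_add]

theorem qFact_succ (q : k) (m : ℕ) : qFact q (m + 1) = qFact q m * qNum q (m + 1) :=
  Finset.prod_range_succ _ _

theorem qFact_mul_gaussBinom (q : k) : ∀ i j : ℕ,
    qFact q i * qFact q j * gaussBinom q (i + j) i = qFact q (i + j)
  | 0, j => by simp [qFact, gaussBinom_zero_right]
  | i + 1, 0 => by simp [qFact, gaussBinom_self]
  | i + 1, j + 1 => by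
    have h1 := qFact_mul_gaussBinom q i (j + 1)
    have h2 := qFact_mul_gaussBinom q (i + 1) j
    rw [show i + 1 + (j + 1) = (i + (j + 1)) + 1 by omega, gaussBinom, qFact_succ q (i + (j + 1)),
      show i + (j + 1) + 1 = (i + 1) + (j + 1) by omega, qNum_add]
    rw [show i + 1 + j = i + (j + 1) by omega] at h2
    linear_combination qNum q (i + 1) * h1 + q ^ (i + 1) * qNum q (j + 1) * h2 +
      qFact q (j + 1) * (gaussBinom q (i + (j + 1)) i) * qFact_succ q i +
      q ^ (i + 1) * qFact q (i + 1) * gaussBinom q (i + (j + 1)) (i + 1) * qFact_succ q j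

theorem qNum_eq_zero_iff {q : k} {n : ℕ} (hn : 2 ≤ n) (hq : IsPrimitiveRoot q n) {m : ℕ} :
    qNum q m = 0 ↔ n ∣ m := by
  have h1 : q - 1 ≠ 0 := sub_ne_zero.2 (hq.ne_one (by omega))
  have h2 : qNum q m * (q - 1) = q ^ m - 1 := geom_sum_mul q m
  rw [← hq.pow_eq_one_iff_dvd, ← sub_eq_zero (a := q ^ m), ← h2]
  simp [h1]

theorem gaussBinom_eq_zero {q : k} {n : ℕ} (hq : IsPrimitiveRoot q n) {i : ℕ}
    (h0 : 0 < i) (hi : i < n) : gaussBinom q n i = 0 := by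
  have hn : 2 ≤ n := by omega
  have h := qFact_mul_gaussBinom q i (n - i)
  rw [show i + (n - i) = n by omega] at h
  have hz : qFact q n = 0 :=
    Finset.prod_eq_zero (Finset.mem_range.2 (show n - 1 < n by omega))
      ((qNum_eq_zero_iff hn hq).2 (by rw [show n - 1 + 1 = n by omega]))
  have hne : ∀ m < n, qFact q m ≠ 0 := fun m hm => Finset.prod_ne_zero_iff.2 fun l hl => by
    rw [Finset.mem_range] at hl
    rw [Ne, qNum_eq_zero_iff hn hq]
    exact fun hd => by have := Nat.le_of_dvd (by omega) hd; omega
  rw [hz] at h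
  exact (mul_eq_zero.1 h).resolve_left (mul_ne_zero (hne _ hi) (hne _ (by omega)))

variable {C : Type w} [Ring C] [Algebra k C]

theorem qComm_pow {q : k} {a b : C} (h : b * a = q • (a * b)) (i : ℕ) :
    b * a ^ i = q ^ i • (a ^ i * b) := by
  induction i with
  | zero => simp
  | succ i ih =>
    rw [pow_succ, ← mul_assoc, ih, smul_mul_assoc, mul_assoc, h, mul_smul_comm, smul_smul,
      ← mul_assoc, pow_succ]

theorem qBinomial {q : k} {a b : C} (h : b * a = q • (a * b)) (m : ℕ) :
    (a + b) ^ m = ∑ i ∈ Finset.range (m + 1), gaussBinom q m i • (a ^ i * b ^ (m - i)) := by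
  induction m with
  | zero => simp [gaussBinom]
  | succ m ih =>
    have hb : ∀ i ∈ Finset.range (m + 1), b * (gaussBinom q m i • (a ^ i * b ^ (m - i))) =
        (q ^ i * gaussBinom q m i) • (a ^ i * b ^ (m + 1 - i)) := by
      intro i hi
      rw [Finset.mem_range] at hi
      rw [mul_smul_comm, ← mul_assoc, qComm_pow h, smul_mul_assoc, smul_smul, mul_assoc,
        ← pow_succ', show m - i + 1 = m + 1 - i by omega, mul_comm]
    have ha : ∀ i ∈ Finset.range (m + 1), a * (gaussBinom q m i • (a ^ i * b ^ (m - i))) =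
        gaussBinom q m i • (a ^ (i + 1) * b ^ (m + 1 - (i + 1))) := by
      intro i _
      rw [mul_smul_comm, ← mul_assoc, ← pow_succ', Nat.add_sub_add_right]
    rw [pow_succ', ih, add_mul, Finset.mul_sum, Finset.mul_sum, Finset.sum_congr rfl ha,
      Finset.sum_congr rfl hb, Finset.sum_range_succ' _ (m + 1)]
    have hlast : ∑ i ∈ Finset.range (m + 1),
        (q ^ i * gaussBinom q m i) • (a ^ i * b ^ (m + 1 - i)) =
        ∑ i ∈ Finset.range (m + 1),
          (q ^ (i + 1) * gaussBinom q m (i + 1)) • (a ^ (i + 1) * b ^ (m + 1 - (i + 1))) +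
          gaussBinom q (m + 1) 0 • (a ^ 0 * b ^ (m + 1 - 0)) := by
      have := Finset.sum_range_succ (fun i =>
        (q ^ i * gaussBinom q m i) • (a ^ i * b ^ (m + 1 - i))) (m + 1)
      rw [gaussBinom_of_lt q m (m + 1) (by omega), mul_zero, zero_smul, add_zero] at this
      rw [← this, Finset.sum_range_succ']
      simp [gaussBinom_zero_right]
    rw [hlast, ← add_assoc, ← Finset.sum_add_distrib]
    simp only [gaussBinom, add_smul]

theorem add_pow_of_qComm {q : k} {n : ℕ} (hn : 0 < n) (hq : IsPrimitiveRoot q n) {a b : C}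
    (h : b * a = q • (a * b)) : (a + b) ^ n = a ^ n + b ^ n := by
  obtain ⟨m, rfl⟩ : ∃ m, n = m + 1 := ⟨n - 1, by omega⟩
  rw [qBinomial h, Finset.sum_range_succ, Finset.sum_range_succ', Finset.sum_eq_zero]
  · simp [gaussBinom_self, gaussBinom_zero_right, add_comm]
  · intro i hi
    rw [Finset.mem_range] at hi
    rw [gaussBinom_eq_zero hq (by omega) (by omega), zero_smul]

/-- Powers of a product of `q`-commuting elements. -/
theorem mul_pow_of_qComm {q : k} {a b : C} (h : b * a = q • (a * b)) (m : ℕ) :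
    (a * b) ^ m = q ^ (m * (m - 1) / 2) • (a ^ m * b ^ m) := by
  induction m with
  | zero => simp
  | succ m ih =>
    have hb : b ^ m * a = q ^ m • (a * b ^ m) := by
      clear ih
      induction m with
      | zero => simp
      | succ m ih =>
        rw [pow_succ', mul_assoc, ih, mul_smul_comm, ← mul_assoc, h, smul_mul_assoc, smul_smul,
          mul_assoc, pow_succ]
    have hm : (m + 1) * (m + 1 - 1) / 2 = m * (m - 1) / 2 + m := by
      rw [← Finset.sum_range_id_mul_two, ← Finset.sum_range_id_mul_two,
        Finset.sum_range_succ]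
      simp
    rw [pow_succ, ih, hm, pow_add, mul_smul, smul_mul_assoc, mul_assoc (a ^ m), ← mul_assoc (b ^ m),
      hb, smul_mul_assoc, mul_smul_comm, pow_succ a, pow_succ b]
    simp only [mul_assoc]

theorem neg_one_pow_mul_primitiveRoot {q : k} {n : ℕ} (hn : 0 < n) (hq : IsPrimitiveRoot q n) :
    (-1 : k) ^ n * q ^ (n * (n - 1) / 2) = -1 := by
  rcases Nat.even_or_odd' n with ⟨m, rfl | rfl⟩
  · have hm : q ^ m = -1 := by
      have h1 : q ^ m * q ^ m = 1 := by rw [← pow_add, ← two_mul, hq.pow_eq_one]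
      rcases mul_self_eq_one_iff.1 h1 with h | h
      · have := Nat.le_of_dvd (by omega) (hq.dvd_of_pow_eq_one m h)
        omega
      · exact h
    rw [show 2 * m * (2 * m - 1) / 2 = m * (2 * m - 1) by
      rw [mul_assoc]; exact Nat.mul_div_cancel_left _ (by omega)]
    rw [pow_mul q, hm, ← pow_add, Odd.neg_one_pow]
    exact ⟨2 * m - 1, by omega⟩
  · rw [show (2 * m + 1) * (2 * m + 1 - 1) / 2 = (2 * m + 1) * m by
      rw [Nat.add_sub_cancel, mul_left_comm]; exact Nat.mul_div_cancel_left _ (by omega)]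
    rw [pow_mul q, hq.pow_eq_one, one_pow, mul_one, Odd.neg_one_pow ⟨m, rfl⟩]

end QBinomial

/-! ## The Hopf algebra of a group datum -/

/-- A group datum `(G, χ, g, μ)`; the last field says `χ ^ n = 1` or `μ (g ^ n - 1) = 0`, where
`n` is the order of `χ(g)`. -/
structure GroupDatum (k : Type u) (G : Type v) [Field k] [Group G] where
  χ : G →* kˣ
  g : G
  μ : k
  central : g ∈ Subgroup.center G
  condition : χ ^ orderOf (χ g) = 1 ∨
    μ • (MonoidAlgebra.of k G (g ^ orderOf (χ g)) - 1) = 0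

namespace GroupDatum

variable {k : Type u} {G : Type v} [Field k] [Group G]

/-- The order of `χ(g)`. -/
def n (D : GroupDatum k G) : ℕ := orderOf (D.χ D.g)

/-- The datum is of non-nilpotent type: `μ (g ^ n - 1) ≠ 0` in `k[G]` and `χ ^ n = 1`. -/
def IsNonNilpotent (D : GroupDatum k G) : Prop :=
  D.μ • (MonoidAlgebra.of k G (D.g ^ D.n) - 1) ≠ 0 ∧ D.χ ^ D.n = 1

/-- Generators of `H_D`: an element `y` and the elements of `G`. -/
inductive Gen (G : Type v) : Type v
  | y : Gen G
  | grp : G → Gen G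

/-- The free algebra generator `y`. -/
abbrev freeY (k : Type u) (G : Type v) [Field k] : FreeAlgebra k (Gen G) := FreeAlgebra.ι k Gen.y

/-- The free algebra generator attached to `h : G`. -/
abbrev freeG (k : Type u) {G : Type v} [Field k] (h : G) : FreeAlgebra k (Gen G) :=
  FreeAlgebra.ι k (Gen.grp h)

/-- The defining relations of `H_D`. -/
inductive Rel (D : GroupDatum k G) : FreeAlgebra k (Gen G) → FreeAlgebra k (Gen G) → Prop
  | one : Rel D (freeG k 1) 1
  | mul (h h' : G) : Rel D (freeG k (h * h')) (freeG k h * freeG k h')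
  | comm (h : G) : Rel D (freeY k G * freeG k h) ((D.χ h : k) • (freeG k h * freeY k G))
  | pow : Rel D (freeY k G ^ D.n) (D.μ • (freeG k (D.g ^ D.n) - 1))

/-- The algebra `H_D`, generated by `y` and the elements of `G`. -/
def H (D : GroupDatum k G) : Type (max u v) := RingQuot D.Rel

variable (D : GroupDatum k G)

instance : Ring D.H := inferInstanceAs (Ring (RingQuot D.Rel))

instance : Algebra k D.H := inferInstanceAs (Algebra k (RingQuot D.Rel))

/-- The element `y` of `H_D`. -/
def y : D.H := RingQuot.mkAlgHom k D.Rel (freeY k G)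

/-- The image of `h : G` in `H_D`. -/
def grp : G →* D.H where
  toFun h := RingQuot.mkAlgHom k D.Rel (freeG k h)
  map_one' := (RingQuot.mkAlgHom_rel k Rel.one).trans (map_one _)
  map_mul' h h' := (RingQuot.mkAlgHom_rel k (Rel.mul h h')).trans (map_mul _ _ _)

theorem y_mul_grp (h : G) : D.y * D.grp h = (D.χ h : k) • (D.grp h * D.y) := by
  have := RingQuot.mkAlgHom_rel k (Rel.comm (D := D) h)
  rwa [map_mul, map_smul, map_mul] at this

theorem y_pow : D.y ^ D.n = D.μ • (D.grp (D.g ^ D.n) - 1) := by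
  have := RingQuot.mkAlgHom_rel k (Rel.pow (D := D))
  rwa [map_pow, map_smul, map_sub, map_one] at this

section Lift

variable {B : Type w} [Ring B] [Algebra k B]

/-- The universal property of `H_D`. -/
def lift (Y : B) (γ : G →* B) (hc : ∀ h, Y * γ h = (D.χ h : k) • (γ h * Y))
    (hp : Y ^ D.n = D.μ • (γ (D.g ^ D.n) - 1)) : D.H →ₐ[k] B :=
  RingQuot.liftAlgHom k ⟨FreeAlgebra.lift k (fun x => Gen.rec Y γ x), by
    rintro _ _ (_ | ⟨h, h'⟩ | h | _)
    · simp
    · simp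
    · simpa using hc h
    · simpa using hp⟩

variable (Y : B) (γ : G →* B) (hc : ∀ h, Y * γ h = (D.χ h : k) • (γ h * Y))
    (hp : Y ^ D.n = D.μ • (γ (D.g ^ D.n) - 1))

@[simp] theorem lift_y : D.lift Y γ hc hp D.y = Y := by
  refine (RingQuot.liftAlgHom_mkAlgHom_apply _ _ _ _).trans ?_
  simp

@[simp] theorem lift_grp (h : G) : D.lift Y γ hc hp (D.grp h) = γ h := by
  refine (RingQuot.liftAlgHom_mkAlgHom_apply _ _ _ _).trans ?_
  simp

theorem algHom_ext {f f' : D.H →ₐ[k] B} (hy : f D.y = f' D.y)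
    (hg : ∀ h, f (D.grp h) = f' (D.grp h)) : f = f' := by
  refine RingQuot.ringQuot_ext' k f f' (FreeAlgebra.hom_ext ?_)
  funext x
  cases x with
  | y => exact hy
  | grp h => exact hg h

/-- Induction on elements of `H_D`. -/
theorem induction {p : D.H → Prop} (hs : ∀ c : k, p (algebraMap k D.H c)) (hy : p D.y)
    (hg : ∀ h, p (D.grp h)) (hadd : ∀ a b, p a → p b → p (a + b))
    (hmul : ∀ a b, p a → p b → p (a * b)) (x : D.H) : p x := by
  obtain ⟨z, rfl⟩ := RingQuot.mkAlgHom_surjective k D.Rel x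
  induction z using FreeAlgebra.induction with
  | grade0 c =>
    have : RingQuot.mkAlgHom k D.Rel (algebraMap k _ c) = algebraMap k D.H c :=
      AlgHom.commutes _ c
    exact this ▸ hs c
  | grade1 x =>
    cases x with
    | y => exact hy
    | grp h => exact hg h
  | mul a b ha hb => rw [map_mul]; exact hmul _ _ ha hb
  | add a b ha hb => rw [map_add]; exact hadd _ _ ha hb

end Lift

theorem n_pos [Finite G] : 0 < D.n :=
  (D.χ.isOfFinOrder (isOfFinOrder_of_finite D.g)).orderOf_pos

theorem isPrimitiveRoot : IsPrimitiveRoot ((D.χ D.g : kˣ) : k) D.n :=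
  IsPrimitiveRoot.coe_units_iff.2 (IsPrimitiveRoot.orderOf _)

theorem g_comm (h : G) : h * D.g = D.g * h := (Subgroup.mem_center_iff.1 D.central h)

/-- The group homomorphism `h ↦ h ⊗ h`. -/
def grpTensor : G →* D.H ⊗[k] D.H where
  toFun h := D.grp h ⊗ₜ D.grp h
  map_one' := by simp [Algebra.TensorProduct.one_def]
  map_mul' := by simp

@[simp] theorem grpTensor_apply (h : G) : D.grpTensor h = D.grp h ⊗ₜ D.grp h := rfl

/-- The homomorphism `h ↦ h⁻¹` to the opposite algebra. -/
def grpInv : G →* D.Hᵐᵒᵖ where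
  toFun h := MulOpposite.op (D.grp h⁻¹)
  map_one' := by simp
  map_mul' h h' := by simp [← MulOpposite.op_mul]

@[simp] theorem grpInv_apply (h : G) : D.grpInv h = MulOpposite.op (D.grp h⁻¹) := rfl

theorem grp_inv_mul_y (h : G) : D.grp h⁻¹ * D.y = (D.χ h : k) • (D.y * D.grp h⁻¹) := by
  rw [y_mul_grp, smul_smul, ← Units.val_mul, ← map_mul, mul_inv_cancel, map_one, Units.val_one,
    one_smul]

variable [Finite G]

/-- The comultiplication: `Δ(y) = y ⊗ g + 1 ⊗ y` and `Δ(h) = h ⊗ h`. -/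
def comulHom : D.H →ₐ[k] D.H ⊗[k] D.H :=
  D.lift (D.y ⊗ₜ D.grp D.g + 1 ⊗ₜ D.y) D.grpTensor
    (fun h => by
      simp only [grpTensor_apply, add_mul, mul_add,
        Algebra.TensorProduct.tmul_mul_tmul, y_mul_grp, one_mul, mul_one, smul_add,
        TensorProduct.tmul_smul, TensorProduct.smul_tmul', ← map_mul, g_comm])
    (by
      have hba : (1 ⊗ₜ D.y : D.H ⊗[k] D.H) * (D.y ⊗ₜ D.grp D.g) =
          (D.χ D.g : k) • ((D.y ⊗ₜ D.grp D.g) * (1 ⊗ₜ D.y)) := by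
        simp only [Algebra.TensorProduct.tmul_mul_tmul, y_mul_grp, one_mul, mul_one,
          TensorProduct.tmul_smul]
      rw [add_pow_of_qComm D.n_pos D.isPrimitiveRoot hba]
      simp only [Algebra.TensorProduct.tmul_pow, y_pow, one_pow, grpTensor_apply,
        map_pow, Algebra.TensorProduct.one_def]
      simp only [TensorProduct.tmul_smul, ← TensorProduct.smul_tmul', TensorProduct.sub_tmul,
        TensorProduct.tmul_sub, ← smul_add]
      congr 1
      abel)

/-- The counit: `ε(y) = 0` and `ε(h) = 1`. -/
def counitHom : D.H →ₐ[k] k :=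
  D.lift 0 1 (by simp) (by simp [D.n_pos.ne'])

instance : Bialgebra k D.H :=
  Bialgebra.ofAlgHom D.comulHom D.counitHom
    (by
      apply D.algHom_ext
      · simp [comulHom, TensorProduct.add_tmul, TensorProduct.tmul_add,
          Algebra.TensorProduct.one_def, add_assoc]
      · intro h
        simp [comulHom])
    (by
      apply D.algHom_ext
      · simp [comulHom, counitHom]
      · intro h
        simp [comulHom, counitHom])
    (by
      apply D.algHom_ext
      · simp [comulHom, counitHom]
      · intro h
        simp [comulHom, counitHom])

theorem comul_y : Coalgebra.comul (R := k) D.y = D.y ⊗ₜ D.grp D.g + 1 ⊗ₜ D.y := by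
  change D.comulHom D.y = _
  simp [comulHom]

theorem comul_grp (h : G) : Coalgebra.comul (R := k) (D.grp h) = D.grp h ⊗ₜ D.grp h := by
  change D.comulHom (D.grp h) = _
  simp [comulHom]

theorem counit_y : Coalgebra.counit (R := k) D.y = 0 := by
  change D.counitHom D.y = _
  simp [counitHom]

theorem counit_grp (h : G) : Coalgebra.counit (R := k) (D.grp h) = 1 := by
  change D.counitHom (D.grp h) = _
  simp [counitHom]

/-- The antipode as an algebra map to the opposite algebra: `S(y) = -y g⁻¹`, `S(h) = h⁻¹`. -/
def antipodeOp : D.H →ₐ[k] D.Hᵐᵒᵖ :=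
  D.lift (MulOpposite.op (-(D.y * D.grp D.g⁻¹))) D.grpInv
    (fun h => by
      have hg : h⁻¹ * D.g⁻¹ = D.g⁻¹ * h⁻¹ := by rw [← mul_inv_rev, ← mul_inv_rev, g_comm]
      rw [grpInv_apply, ← MulOpposite.op_mul, ← MulOpposite.op_mul, ← MulOpposite.op_smul,
        mul_neg, neg_mul, ← mul_assoc, grp_inv_mul_y, smul_neg, smul_mul_assoc, mul_assoc,
        mul_assoc, ← map_mul, ← map_mul, hg])
    (by
      have hp : (-(D.y * D.grp D.g⁻¹)) ^ D.n = -(D.y ^ D.n * D.grp D.g⁻¹ ^ D.n) := by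
        rw [neg_pow, mul_pow_of_qComm (D.grp_inv_mul_y D.g)]
        have h := neg_one_pow_mul_primitiveRoot D.n_pos D.isPrimitiveRoot
        have h' : ((-1 : D.H)) ^ D.n = ((-1 : k) ^ D.n) • (1 : D.H) := by
          rcases neg_one_pow_eq_or k D.n with h1 | h1 <;>
          rcases Nat.even_or_odd D.n with h2 | h2 <;>
          simp [h2.neg_one_pow]
        rw [h', smul_mul_assoc, one_mul, smul_smul, h, neg_one_smul]
      rw [← MulOpposite.op_pow, hp, y_pow, grpInv_apply, ← MulOpposite.op_one,
        ← MulOpposite.op_sub, ← MulOpposite.op_smul]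
      congr 1
      rw [smul_mul_assoc, ← smul_neg, ← map_pow, sub_mul, ← map_mul, inv_pow, mul_inv_cancel,
        map_one, one_mul, neg_sub])

/-- The antipode: the antimultiplicative map with `S(y) = -y g⁻¹` and `S(h) = h⁻¹`. -/
def antipodeLin : D.H →ₗ[k] D.H :=
  (MulOpposite.opLinearEquiv k).symm.toLinearMap.comp D.antipodeOp.toLinearMap

theorem antipodeLin_mul (a b : D.H) :
    D.antipodeLin (a * b) = D.antipodeLin b * D.antipodeLin a := by
  simp [antipodeLin]

theorem antipodeLin_algebraMap (c : k) :
    D.antipodeLin (algebraMap k D.H c) = algebraMap k D.H c := by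
  simp [antipodeLin]

theorem antipodeLin_one : D.antipodeLin 1 = 1 := by
  simpa using D.antipodeLin_algebraMap 1

theorem antipodeLin_y : D.antipodeLin D.y = -(D.y * D.grp D.g⁻¹) := by
  simp [antipodeLin, antipodeOp]

theorem antipodeLin_grp (h : G) : D.antipodeLin (D.grp h) = D.grp h⁻¹ := by
  simp [antipodeLin, antipodeOp]

theorem antipode_left_mul {s : D.H ⊗[k] D.H} {c : k}
    (hs : LinearMap.mul' k D.H (D.antipodeLin.rTensor D.H s) = algebraMap k D.H c)
    (t : D.H ⊗[k] D.H) :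
    LinearMap.mul' k D.H (D.antipodeLin.rTensor D.H (s * t)) =
      algebraMap k D.H c * LinearMap.mul' k D.H (D.antipodeLin.rTensor D.H t) := by
  induction t with
  | zero => simp
  | add t t' ht ht' => simp only [mul_add, map_add, ht, ht']
  | tmul x y =>
    have : LinearMap.mul' k D.H (D.antipodeLin.rTensor D.H (s * x ⊗ₜ y)) =
        D.antipodeLin x * LinearMap.mul' k D.H (D.antipodeLin.rTensor D.H s) * y := by
      clear hs
      induction s with
      | zero => simp
      | add s s' hs hs' => simp only [add_mul, mul_add, map_add, hs, hs']
      | tmul a b => simp [antipodeLin_mul, mul_assoc]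
    rw [this, hs, ← Algebra.commutes, mul_assoc]
    simp

theorem antipode_right_mul (s : D.H ⊗[k] D.H) {t : D.H ⊗[k] D.H} {c : k}
    (ht : LinearMap.mul' k D.H (D.antipodeLin.lTensor D.H t) = algebraMap k D.H c) :
    LinearMap.mul' k D.H (D.antipodeLin.lTensor D.H (s * t)) =
      LinearMap.mul' k D.H (D.antipodeLin.lTensor D.H s) * algebraMap k D.H c := by
  induction s with
  | zero => simp
  | add s s' hs hs' => simp only [add_mul, map_add, hs, hs']
  | tmul x y =>
    have : LinearMap.mul' k D.H (D.antipodeLin.lTensor D.H (x ⊗ₜ y * t)) =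
        x * LinearMap.mul' k D.H (D.antipodeLin.lTensor D.H t) * D.antipodeLin y := by
      clear ht
      induction t with
      | zero => simp
      | add s s' hs hs' => simp only [add_mul, mul_add, map_add, hs, hs']
      | tmul a b => simp [antipodeLin_mul, mul_assoc]
    rw [this, ht, mul_assoc, Algebra.commutes, ← mul_assoc]
    simp

instance : HopfAlgebra k D.H where
  antipode := D.antipodeLin
  mul_antipode_rTensor_comul := by
    ext x
    change LinearMap.mul' k D.H (D.antipodeLin.rTensor D.H (Coalgebra.comul x)) =
      algebraMap k D.H (Coalgebra.counit x)
    induction x using D.induction with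
    | hs c => simp [antipodeLin_algebraMap, Algebra.TensorProduct.algebraMap_apply]
    | hy => simp [comul_y, counit_y, antipodeLin_y, antipodeLin_one, ← map_mul,
        mul_assoc]
    | hg h => simp [comul_grp, counit_grp, antipodeLin_grp, ← map_mul]
    | hadd a b ha hb => simp only [map_add, ha, hb]
    | hmul a b ha hb =>
      rw [Bialgebra.comul_mul, D.antipode_left_mul ha, hb, Bialgebra.counit_mul, map_mul]
  mul_antipode_lTensor_comul := by
    ext x
    change LinearMap.mul' k D.H (D.antipodeLin.lTensor D.H (Coalgebra.comul x)) =
      algebraMap k D.H (Coalgebra.counit x)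
    induction x using D.induction with
    | hs c => simp [antipodeLin_one, Algebra.TensorProduct.algebraMap_apply]
    | hy => simp [comul_y, counit_y, antipodeLin_y, antipodeLin_grp]
    | hg h => simp [comul_grp, counit_grp, antipodeLin_grp, ← map_mul]
    | hadd a b ha hb => simp only [map_add, ha, hb]
    | hmul a b ha hb =>
      rw [Bialgebra.comul_mul, D.antipode_right_mul _ hb, ha, Bialgebra.counit_mul, map_mul]

theorem antipode_y : HopfAlgebra.antipode k D.y = -(D.y * D.grp D.g⁻¹) := D.antipodeLin_y

theorem antipode_grp (h : G) : HopfAlgebra.antipode k (D.grp h) = D.grp h⁻¹ := D.antipodeLin_grp h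

end GroupDatum

end

noncomputable section

/-! ## Representations of finite groups in characteristic zero -/

/-! Restriction to G controls the Grothendieck ring, and the kernels of the powers of y control the
Green ring modulo induced modules. Classification. The central element g^n acts semisimply and
commutes with y, so on an indecomposable module it acts by a single scalar ν. If ν ≠ 1, then y^n
acts by the nonzero scalar μ(ν - 1), and the module is induced from an eigenspace of g. If ν = 1,
then y is nilpotent and the module is a block `blk` with layers U, yU, ..., y^(r-1)U, where r ≤ n
(`exists_blk_equiv`). The blocks with n layers are the induced modules, and these are projective
because kG is semisimple. J is contained in ker(φ|P). A ring homomorphism to a field of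
characteristic zero with integral values kills the Jacobson radical (`map_eq_zero_of_mem_jacobson`),
and two families of such homomorphisms suffice. The first consists of the traces of the elements of
G. Modules with the same traces have the same class in G₀ (`grothendieck_eq_of_character_eq`), so J
lies in ker φ. The second comes from the functionals `layerHom`, weighted second differences in s of
the trace of x on ker y^s. They vanish on induced modules and read off the character of U from a
block with s < n layers. Tensoring with the two dimensional uniserial module acts on them by a
three-term recurrence (`layerHom_two_mul`). Hence a Chebyshev type sequence (a^s - b^s)/(a - b) with
ab = χ(x)⁻¹ and a^n = b^n gives a combination that is multiplicative (`layerSum_mul`). There are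
enough such sequences to separate the functionals, so every `layerHom` vanishes on J. An element
killed by all of them is a difference of two induced modules (`exists_eq_ind_sub_ind`), so J lies in
P. ker(φ|P) is contained in J. A projective module tensored with a short exact sequence gives a
split one, so P · ker φ = 0. An element z of P ∩ ker φ therefore satisfies z r z = 0 for every r,
which puts it in J. The form. The square of the antipode is conjugation by g, and this makes the
form symmetric. Since Hom out of a projective module is exact, ker φ lies in P^⊥. Conversely,
pairing [M] with the module induced from V gives dim Hom_G(V, M*), so elements of P^⊥ have zero
traces and lie in ker φ. -/

theorem LinearMap.trace_eq_trace_ker_add_trace_range {k V W : Type*} [Field k] [AddCommGroup V]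
    [Module k V] [Module.Finite k V] [AddCommGroup W] [Module k W]
    (f : V →ₗ[k] W) (A : V →ₗ[k] V) (B : W →ₗ[k] W) (h : ∀ x, f (A x) = B (f x))
    (hA : ∀ x ∈ LinearMap.ker f, A x ∈ LinearMap.ker f)
    (hB : ∀ x ∈ LinearMap.range f, B x ∈ LinearMap.range f) :
    LinearMap.trace k V A =
      LinearMap.trace k _ (A.restrict hA) + LinearMap.trace k _ (B.restrict hB) := by
  obtain ⟨σ, hσ⟩ := f.rangeRestrict.exists_rightInverse_of_surjective f.range_rangeRestrict
  have hσ' : ∀ y, f (σ y) = y := fun y => congrArg Subtype.val (LinearMap.congr_fun hσ y)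
  let π : V →ₗ[k] LinearMap.ker f := LinearMap.codRestrict _
    (LinearMap.id - σ ∘ₗ f.rangeRestrict) (fun x => by simp [hσ'])
  have hπ : ∀ x, ((π x : V)) = x - σ (f.rangeRestrict x) := fun x => rfl
  -- A section σ of f gives the projection π onto the kernel. The two summands of A become the two
  -- traces on the right by cyclicity of the trace.
  have h1 : A = A ∘ₗ ((LinearMap.ker f).subtype ∘ₗ π) + (A ∘ₗ σ) ∘ₗ f.rangeRestrict := by
    ext x
    simp [hπ]
  have h2 : LinearMap.trace k V (A ∘ₗ ((LinearMap.ker f).subtype ∘ₗ π)) =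
      LinearMap.trace k _ (A.restrict hA) := by
    rw [← LinearMap.comp_assoc, LinearMap.trace_comp_comm']
    congr 1
    ext x
    have hx : f.rangeRestrict (A x) = 0 := Subtype.ext (hA x x.2)
    simp [hπ, hx]
  have h3 : LinearMap.trace k V ((A ∘ₗ σ) ∘ₗ f.rangeRestrict) =
      LinearMap.trace k _ (B.restrict hB) := by
    rw [LinearMap.trace_comp_comm']
    congr 1
    ext x
    simp [h, hσ']
  conv_lhs => rw [h1]
  rw [map_add, h2, h3]

namespace Representation

section Average

variable {k G : Type*} [Field k] [CharZero k] [Group G] [Finite G]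
variable {U V W : Type*} [AddCommGroup U] [Module k U] [AddCommGroup V] [Module k V]
  [AddCommGroup W] [Module k W]

theorem IntertwiningMap.map_rep {k G V W : Type*} [Field k] [Group G] [AddCommGroup V] [Module k V]
    [AddCommGroup W] [Module k W] {ρ : Representation k G V} {σ : Representation k G W}
    (f : IntertwiningMap ρ σ) (g : G) (v : V) : f (ρ g v) = σ g (f v) :=
  LinearMap.congr_fun (f.isIntertwining' g) v

theorem Equiv.map_rep {k G V W : Type*} [Field k] [Group G] [AddCommGroup V] [Module k V]
    [AddCommGroup W] [Module k W] {ρ : Representation k G V} {σ : Representation k G W}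
    (f : ρ.Equiv σ) (g : G) (v : V) : f (ρ g v) = σ g (f v) :=
  LinearMap.congr_fun (f.isIntertwining' g) v

/-- The average of a linear map over the group. -/
def averageHom (ρ : Representation k G V) (σ : Representation k G W) (f : V →ₗ[k] W) :
    IntertwiningMap ρ σ where
  toLinearMap := letI := Fintype.ofFinite G
    (Nat.card G : k)⁻¹ • ∑ h : G, σ h ∘ₗ f ∘ₗ ρ h⁻¹
  isIntertwining' g := by
    let _ := Fintype.ofFinite G
    ext v
    simp only [LinearMap.comp_apply, LinearMap.smul_apply, LinearMap.sum_apply, map_smul, map_sum]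
    congr 1
    refine Fintype.sum_equiv (Equiv.mulLeft g⁻¹) _ _ fun h => ?_
    simp only [Equiv.coe_mulLeft, ← Module.End.mul_apply, ← map_mul]
    simp

omit [CharZero k] in
theorem averageHom_apply [Fintype G] (ρ : Representation k G V) (σ : Representation k G W)
    (f : V →ₗ[k] W) (v : V) :
    averageHom ρ σ f v = (Nat.card G : k)⁻¹ • ∑ h : G, σ h (f (ρ h⁻¹ v)) := by
  change (letI := Fintype.ofFinite G; (Nat.card G : k)⁻¹ • ∑ h : G, σ h ∘ₗ f ∘ₗ ρ h⁻¹) v = _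
  rw [Subsingleton.elim (Fintype.ofFinite G) ‹_›]
  simp

theorem average_const [Fintype G] (w : W) : (Nat.card G : k)⁻¹ • ∑ _h : G, w = w := by
  rw [Finset.sum_const, Finset.card_univ, ← Nat.card_eq_fintype_card, ← Nat.cast_smul_eq_nsmul k,
    smul_smul, inv_mul_cancel₀ (Nat.cast_ne_zero.2 Nat.card_pos.ne'), one_smul]

/-- Maschke: averaging a linear retraction makes it equivariant, and it stays a retraction because f
already is equivariant. -/
theorem exists_leftInverse {ρ : Representation k G V} {σ : Representation k G W}
    (f : IntertwiningMap ρ σ) (hf : Function.Injective f) :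
    ∃ r : IntertwiningMap σ ρ, ∀ v, r (f v) = v := by
  let _ := Fintype.ofFinite G
  obtain ⟨r, hr⟩ := f.toLinearMap.exists_leftInverse_of_injective (LinearMap.ker_eq_bot.2 hf)
  refine ⟨averageHom σ ρ r, fun v => ?_⟩
  have hr' : ∀ x, r (f x) = x := fun x => LinearMap.congr_fun hr x
  simp only [averageHom_apply, ← f.map_rep, hr', ← Module.End.mul_apply, ← map_mul,
    mul_inv_cancel, map_one, Module.End.one_apply]
  exact average_const v

theorem exists_lift {τ : Representation k G U} {ρ : Representation k G V}
    {σ : Representation k G W}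
    (p : IntertwiningMap ρ σ) (hp : Function.Surjective p) (f : IntertwiningMap τ σ) :
    ∃ s : IntertwiningMap τ ρ, ∀ x, p (s x) = f x := by
  let _ := Fintype.ofFinite G
  obtain ⟨s, hs⟩ := p.toLinearMap.exists_rightInverse_of_surjective (LinearMap.range_eq_top.2 hp)
  have hs' : ∀ x, p (s x) = x := fun x => LinearMap.congr_fun hs x
  refine ⟨averageHom τ ρ (s ∘ₗ f.toLinearMap), fun v => ?_⟩
  simp only [averageHom_apply, map_smul, map_sum, p.map_rep, LinearMap.comp_apply, hs',
    IntertwiningMap.coe_toLinearMap, f.map_rep, ← Module.End.mul_apply, ← map_mul,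
    mul_inv_cancel, map_one, Module.End.one_apply]
  exact average_const (f v)

/-- Complete reducibility for a surjection. -/
theorem exists_equiv_ker_prod {ρ : Representation k G V} {σ : Representation k G W}
    (p : IntertwiningMap ρ σ) (hp : Function.Surjective p) :
    Nonempty (ρ.Equiv (p.ker.toRepresentation.prod σ)) := by
  obtain ⟨s, hs⟩ := exists_lift p hp (.id σ)
  have hs' : ∀ x, p (s x) = x := hs
  refine ⟨.mk (LinearEquiv.ofLinearMap
    (LinearMap.prod (LinearMap.codRestrict _ (LinearMap.id - (s.comp p).toLinearMap)
      (fun x => (IntertwiningMap.mem_ker _ _ p _).2 (by simp [hs']))) p.toLinearMap)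
    (LinearMap.coprod p.ker.toSubmodule.subtype s.toLinearMap) ?_ ?_) ?_⟩
  · refine LinearMap.ext fun x => Prod.ext (Subtype.ext ?_) ?_
    · have hx : p (x.1 : V) = 0 := x.1.2
      simp [hx, hs']
    · have hx : p (x.1 : V) = 0 := x.1.2
      simp [hx, hs']
  · ext x
    simp
  · intro g
    refine LinearMap.ext fun x => Prod.ext (Subtype.ext ?_) ?_
    · change ρ g x - s (p (ρ g x)) = ρ g (x - s (p x))
      rw [map_sub, p.map_rep, s.map_rep]
    · exact p.map_rep g x

omit [CharZero k] [Finite G] in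
theorem finrank_hom_congr {τ : Representation k G U} {ρ : Representation k G V}
    {σ : Representation k G W} (e : ρ.Equiv σ) :
    Module.finrank k (IntertwiningMap τ ρ) = Module.finrank k (IntertwiningMap τ σ) :=
  LinearEquiv.finrank_eq (LinearEquiv.ofLinearMap
    (IntertwiningMap.llcomp τ ρ σ e.toIntertwiningMap)
    (IntertwiningMap.llcomp τ σ ρ e.symm.toIntertwiningMap)
    (by
      refine LinearMap.ext fun f => DFunLike.ext _ _ fun x => ?_
      exact e.apply_symm_apply (f x))
    (by
      refine LinearMap.ext fun f => DFunLike.ext _ _ fun x => ?_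
      exact e.symm_apply_apply (f x)))

omit [CharZero k] [Finite G] in
theorem finrank_hom_prod [Module.Finite k U] [Module.Finite k V] [Module.Finite k W]
    (τ : Representation k G U) (ρ : Representation k G V) (σ : Representation k G W) :
    Module.finrank k (IntertwiningMap τ (ρ.prod σ)) =
      Module.finrank k (IntertwiningMap τ ρ) + Module.finrank k (IntertwiningMap τ σ) := by
  rw [← Module.finrank_prod]
  refine LinearEquiv.finrank_eq (LinearEquiv.ofLinearMap
    (LinearMap.prod (IntertwiningMap.llcomp τ _ _ (IntertwiningMap.fst k ρ σ))
      (IntertwiningMap.llcomp τ _ _ (IntertwiningMap.snd k ρ σ)))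
    (LinearMap.coprod (IntertwiningMap.llcomp τ _ _ (IntertwiningMap.inl k ρ σ))
      (IntertwiningMap.llcomp τ _ _ (IntertwiningMap.inr k ρ σ))) ?_ ?_)
  · refine LinearMap.ext fun f => Prod.ext (DFunLike.ext _ _ fun x => ?_)
      (DFunLike.ext _ _ fun x => ?_)
    · exact add_zero _
    · exact zero_add _
  · refine LinearMap.ext fun f => DFunLike.ext _ _ fun x => Prod.ext ?_ ?_
    · exact add_zero _
    · exact zero_add _

omit [CharZero k] [Finite G] in
theorem prod_congr {V' W' : Type*} [AddCommGroup V'] [Module k V'] [AddCommGroup W'] [Module k W']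
    {ρ : Representation k G V} {σ : Representation k G W} {ρ' : Representation k G V'}
    {σ' : Representation k G W'} (e : ρ.Equiv ρ') (f : σ.Equiv σ') :
    Nonempty ((ρ.prod σ).Equiv (ρ'.prod σ')) :=
  ⟨.mk (e.toLinearEquiv.prodCongr f.toLinearEquiv) fun g => by
    refine LinearMap.ext fun x => Prod.ext ?_ ?_
    · exact e.map_rep g x.1
    · exact f.map_rep g x.2⟩

end Average

section Determined

variable {k : Type u} {G : Type v} [Field k] [CharZero k] [Group G] [Finite G]

/-- A representation is determined by the dimensions of the spaces of homomorphisms into it. -/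
theorem nonempty_equiv_of_finrank_hom {V W : Type u} [AddCommGroup V] [Module k V]
    [Module.Finite k V] [AddCommGroup W] [Module k W] [Module.Finite k W]
    (ρ : Representation k G V) (σ : Representation k G W)
    (h : ∀ (U : Type u) [AddCommGroup U] [Module k U] [Module.Finite k U]
      (τ : Representation k G U),
      Module.finrank k (IntertwiningMap τ ρ) = Module.finrank k (IntertwiningMap τ σ)) :
    Nonempty (ρ.Equiv σ) := by
  induction hd : Module.finrank k V using Nat.strong_induction_on generalizing V W with
  | _ d ih =>
    -- By complete reducibility the image of a nonzero map is a direct summand of both V and W. It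
    -- can be cancelled from all dimension counts, and induction applies to the complements.
    by_cases hf : ∃ f : IntertwiningMap ρ σ, f ≠ 0
    · obtain ⟨f, hf⟩ := hf
      let f' : IntertwiningMap ρ f.range.toRepresentation :=
        ⟨f.toLinearMap.rangeRestrict, fun g => by
          ext x
          exact f.map_rep g x⟩
      have hf' : Function.Surjective f' := f.toLinearMap.surjective_rangeRestrict
      let i : IntertwiningMap f.range.toRepresentation σ := ⟨f.range.toSubmodule.subtype,
        fun g => rfl⟩
      obtain ⟨r, hr⟩ := exists_leftInverse i Subtype.val_injective
      obtain ⟨e1⟩ := exists_equiv_ker_prod f' hf'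
      obtain ⟨e2⟩ := exists_equiv_ker_prod r (fun x => ⟨i x, hr x⟩)
      have hlt : Module.finrank k f'.ker.toSubmodule < d := by
        rw [← hd]
        refine Submodule.finrank_lt fun htop => hf ?_
        refine DFunLike.ext _ _ fun x => ?_
        have hx : x ∈ f'.ker.toSubmodule := htop ▸ Submodule.mem_top
        exact congrArg Subtype.val ((IntertwiningMap.mem_ker _ _ f' x).1 hx)
      obtain ⟨e3⟩ := ih _ hlt f'.ker.toRepresentation r.ker.toRepresentation (by
        intro U _ _ _ τ
        have h1 := h U τ
        rw [finrank_hom_congr e1, finrank_hom_congr e2, finrank_hom_prod, finrank_hom_prod] at h1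
        exact Nat.add_right_cancel h1) rfl
      obtain ⟨e4⟩ := prod_congr e3 (.refl f.range.toRepresentation)
      exact ⟨(e1.trans e4).trans e2.symm⟩
    · push Not at hf
      have hV : Subsingleton (IntertwiningMap ρ σ) := ⟨fun f f' => by rw [hf f, hf f']⟩
      -- Testing against V itself gives End(V) = 0, hence V = 0. Testing against W then gives W = 0.
      have h1 := h V ρ
      rw [Module.finrank_zero_of_subsingleton (M := IntertwiningMap ρ σ)] at h1
      have h2 := (Module.finrank_zero_iff (R := k)).1 h1
      have hV0 : Subsingleton V := ⟨fun x y => by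
        have h3 : IntertwiningMap.id ρ = 0 := Subsingleton.elim _ _
        have h4 := fun x => DFunLike.congr_fun h3 x
        exact (h4 x).trans (h4 y).symm⟩
      have h5 := h W σ
      have hs : Subsingleton (IntertwiningMap σ ρ) :=
        ⟨fun f f' => DFunLike.ext _ _ fun x => Subsingleton.elim _ _⟩
      rw [Module.finrank_zero_of_subsingleton (M := IntertwiningMap σ ρ)] at h5
      have h6 := (Module.finrank_zero_iff (R := k)).1 h5.symm
      have hW0 : Subsingleton W := ⟨fun x y => by
        have h3 : IntertwiningMap.id σ = 0 := Subsingleton.elim _ _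
        have h4 := fun x => DFunLike.congr_fun h3 x
        exact (h4 x).trans (h4 y).symm⟩
      exact ⟨.mk (LinearEquiv.ofLinearMap 0 0 (by ext x; exact Subsingleton.elim _ _)
        (by ext x; exact Subsingleton.elim _ _)) fun g => by
          ext x; exact Subsingleton.elim _ _⟩

/-- A representation is determined by its character. -/
theorem nonempty_equiv_of_character_eq {V W : Type u} [AddCommGroup V] [Module k V]
    [Module.Finite k V] [AddCommGroup W] [Module k W] [Module.Finite k W]
    (ρ : Representation k G V) (σ : Representation k G W) (h : ρ.character = σ.character) :
    Nonempty (ρ.Equiv σ) := by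
  refine nonempty_equiv_of_finrank_hom ρ σ fun U _ _ _ τ => ?_
  let _ := Fintype.ofFinite G
  let _ : Invertible (Nat.card G : k) :=
    invertibleOfNonzero (Nat.cast_ne_zero.2 Nat.card_pos.ne')
  have h1 := card_inv_mul_sum_char_mul_char_eq_finrank τ ρ
  have h2 := card_inv_mul_sum_char_mul_char_eq_finrank τ σ
  rw [h] at h1
  exact_mod_cast h1.symm.trans h2

end Determined

end Representation

/-- A finite dimensional representation of a group. -/
structure FinRep (k : Type u) (G : Type v) [Field k] [Group G] where
  carrier : Type u
  [addCommGroup : AddCommGroup carrier]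
  [module : Module k carrier]
  [finite : Module.Finite k carrier]
  ρ : Representation k G carrier

namespace FinRep

attribute [instance] addCommGroup module finite

instance {k : Type u} {G : Type v} [Field k] [Group G] : CoeSort (FinRep k G) (Type u) :=
  ⟨carrier⟩

end FinRep

namespace GroupDatum

variable {k : Type u} {G : Type v} [Field k] [Group G] (D : GroupDatum k G)

/-! ## Restriction to the group -/

section Restriction

variable (N : Type*) [AddCommGroup N] [Module k N] [Module D.H N] [IsScalarTower k D.H N]

/-- The representation of `G` underlying a module over `H_D`. -/
def res : Representation k G N := (Algebra.lsmul k k N).toMonoidHom.comp D.grp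

variable {N}

@[simp] theorem res_apply (h : G) (x : N) : D.res N h x = D.grp h • x := rfl

variable {N' : Type*} [AddCommGroup N'] [Module k N'] [Module D.H N'] [IsScalarTower k D.H N']

/-- A linear map commuting with the generators is a module homomorphism. -/
def homOfGen (f : N →ₗ[k] N') (hy : ∀ x, f (D.y • x) = D.y • f x)
    (hg : ∀ h x, f (D.grp h • x) = D.grp h • f x) : N →ₗ[D.H] N' where
  toFun := f
  map_add' := map_add f
  map_smul' a x := by
    change f (a • x) = a • f x
    induction a using D.induction generalizing x with
    | hs c => simp
    | hy => exact hy x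
    | hg h => exact hg h x
    | hadd a b ha hb => simp [add_smul, ha, hb]
    | hmul a b ha hb => simp [mul_smul, ha, hb]

@[simp] theorem homOfGen_apply (f : N →ₗ[k] N') (hy : ∀ x, f (D.y • x) = D.y • f x)
    (hg : ∀ h x, f (D.grp h • x) = D.grp h • f x) (x : N) : D.homOfGen f hy hg x = f x := rfl

/-- The restriction of a module homomorphism to the group. -/
def resMap (f : N →ₗ[D.H] N') : (D.res N).IntertwiningMap (D.res N') :=
  ⟨f.restrictScalars k, fun h => by
    ext x
    exact map_smul f (D.grp h) x⟩

@[simp] theorem resMap_apply (f : N →ₗ[D.H] N') (x : N) : D.resMap f x = f x := rfl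

/-- The restriction of an isomorphism to the group. -/
def resEquiv (e : N ≃ₗ[D.H] N') : (D.res N).Equiv (D.res N') :=
  .mk (e.restrictScalars k) fun h => by
    ext x
    exact map_smul e (D.grp h) x

end Restriction

/-- The representation of `G` underlying a finite dimensional module over `H_D`. -/
def resRep (M : FDMod k D.H) : FinRep k G where
  carrier := M
  ρ := D.res M

theorem y_pow_mul_grp (i : ℕ) (h : G) :
    D.y ^ i * D.grp h = ((D.χ h ^ i : kˣ) : k) • (D.grp h * D.y ^ i) := by
  induction i with
  | zero => simp
  | succ i ih =>
    rw [pow_succ, mul_assoc, y_mul_grp, mul_smul_comm, ← mul_assoc, ih, smul_mul_assoc, smul_smul,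
      mul_assoc, pow_succ (D.χ h), mul_comm, Units.val_mul]

theorem grp_mul_y_pow (i : ℕ) (h : G) :
    D.grp h * D.y ^ i = (((D.χ h)⁻¹ ^ i : kˣ) : k) • (D.y ^ i * D.grp h) := by
  rw [y_pow_mul_grp, smul_smul, ← Units.val_mul, inv_pow, inv_mul_cancel, Units.val_one, one_smul]

/-! ## Uniserial modules and induced modules -/

section Block

variable {D}
variable {U : Type*} [AddCommGroup U] [Module k U]

variable (D) in
/-- The operator through which `y ^ n` acts on the representation `ρ`. -/
def yPow (ρ : Representation k G U) : U →ₗ[k] U := D.μ • (ρ (D.g ^ D.n) - 1)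

variable (D) in
/-- The condition for a representation to be the top of a module with layers
`U, yU, …, y ^ (r - 1) U`. -/
structure Admissible (ρ : Representation k G U) (r : ℕ) : Prop where
  pos : 0 < r
  le : r ≤ D.n
  eq_one : r < D.n → ρ (D.g ^ D.n) = 1

theorem Admissible.yPow_eq_zero {ρ : Representation k G U} {r : ℕ} (h : D.Admissible ρ r)
    (hr : r < D.n) : D.yPow ρ = 0 := by
  simp [yPow, h.eq_one hr]

theorem yPow_comm (ρ : Representation k G U) (h : G) (u : U) :
    D.yPow ρ (ρ h u) = ρ h (D.yPow ρ u) := by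
  have hc : D.g ^ D.n * h = h * D.g ^ D.n :=
    (Subgroup.mem_center_iff.1 (pow_mem D.central D.n) h).symm
  simp only [yPow, LinearMap.smul_apply, LinearMap.sub_apply, Module.End.one_apply, map_smul,
    map_sub]
  rw [← Module.End.mul_apply, ← map_mul, hc, map_mul, Module.End.mul_apply]

variable {ρ : Representation k G U} {r : ℕ} (h : D.Admissible ρ r)

/-- The action of `y` on `Fin r → U`. -/
def shift (h : D.Admissible ρ r) : (Fin r → U) →ₗ[k] (Fin r → U) :=
  LinearMap.lsum k (fun _ : Fin r => U) k fun i =>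
    -- The last layer wraps round to layer 0 through `yPow`, which vanishes for an admissible ρ
    -- unless r = n.
    if hi : (i : ℕ) + 1 < r then LinearMap.single k (fun _ => U) ⟨i + 1, hi⟩
    else LinearMap.single k (fun _ => U) ⟨0, h.pos⟩ ∘ₗ D.yPow ρ

theorem shift_single_of_lt {i : Fin r} (hi : (i : ℕ) + 1 < r) (u : U) :
    shift h (Pi.single i u) = Pi.single ⟨i + 1, hi⟩ u := by
  rw [shift, LinearMap.lsum_piSingle, dif_pos hi]
  rfl

theorem shift_single_of_not_lt {i : Fin r} (hi : ¬ (i : ℕ) + 1 < r) (u : U) :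
    shift h (Pi.single i u) = Pi.single ⟨0, h.pos⟩ (D.yPow ρ u) := by
  rw [shift, LinearMap.lsum_piSingle, dif_neg hi]
  rfl

theorem shift_pow_single (i : Fin r) (u : U) :
    (shift h ^ (i : ℕ)) (Pi.single ⟨0, h.pos⟩ u) = Pi.single i u := by
  obtain ⟨i, hi⟩ := i
  induction i with
  | zero => rfl
  | succ i ih =>
    have := ih (by omega)
    simp only at this ⊢
    rw [pow_succ', Module.End.mul_apply, this, shift_single_of_lt h (by exact hi)]

/-- The r layers form a cycle with one wrap-around, and r steps from any layer pass it exactly once.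
-/
theorem shift_pow_self (i : Fin r) (u : U) :
    (shift h ^ r) (Pi.single i u) = Pi.single i (D.yPow ρ u) := by
  have h0 : ∀ u : U, (shift h ^ r) (Pi.single ⟨0, h.pos⟩ u) =
      Pi.single ⟨0, h.pos⟩ (D.yPow ρ u) := by
    intro u
    have hr : (r - 1) + 1 = r := by have := h.pos; omega
    have h1 := shift_pow_single h ⟨r - 1, by omega⟩ u
    have h2 : shift h ^ r = shift h * shift h ^ (r - 1) := by
      rw [← pow_succ']
      exact congrArg (shift h ^ ·) hr.symm
    simp only at h1
    rw [h2, Module.End.mul_apply, h1]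
    exact shift_single_of_not_lt h (by simp only; omega) u
  rw [← shift_pow_single h i u, ← Module.End.mul_apply, ← pow_add, add_comm, pow_add,
    Module.End.mul_apply, h0, shift_pow_single]

/-- The action of the group on `Fin r → U`. -/
def twist (ρ : Representation k G U) (r : ℕ) : Representation k G (Fin r → U) where
  toFun h := LinearMap.pi fun i => (((D.χ h)⁻¹ ^ (i : ℕ) : kˣ) : k) • (ρ h ∘ₗ LinearMap.proj i)
  map_one' := by
    ext w i
    simp
  map_mul' h h' := by
    refine LinearMap.ext fun w => funext fun i => ?_
    simp [mul_pow, smul_smul, mul_comm]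

theorem twist_single (h : G) (i : Fin r) (u : U) :
    twist (D := D) ρ r h (Pi.single i u) =
      (((D.χ h)⁻¹ ^ (i : ℕ) : kˣ) : k) • Pi.single i (ρ h u) := by
  funext j
  rcases eq_or_ne j i with rfl | hj
  · simp [twist]
  · simp [twist, Pi.single_eq_of_ne hj]

theorem shift_twist (hχ : D.χ ^ D.n = 1) (x : G) :
    shift h * twist (D := D) ρ r x = (D.χ x : k) • (twist (D := D) ρ r x * shift h) := by
  refine LinearMap.pi_ext fun i u => ?_
  simp only [Module.End.mul_apply, LinearMap.smul_apply, twist_single, map_smul]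
  by_cases hi : (i : ℕ) + 1 < r
  · rw [shift_single_of_lt h hi, shift_single_of_lt h hi, twist_single, smul_smul]
    congr 1
    rw [← Units.val_mul]
    congr 1
    rw [pow_succ', mul_inv_cancel_left]
  · rw [shift_single_of_not_lt h hi, shift_single_of_not_lt h hi, twist_single, yPow_comm]
    rcases h.le.lt_or_eq with hr | hr
    · simp [h.yPow_eq_zero hr]
    · simp only [pow_zero, Units.val_one, one_smul]
      congr 1
      -- The step from layer n - 1 back to layer 0 must also produce the factor χ(x). It does, since
      -- χ(x)^(-(n-1)) = χ(x).
      have hx : D.χ x ^ D.n = 1 := by rw [← MonoidHom.pow_apply, hχ, MonoidHom.one_apply]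
      have h1 : (i : ℕ) + 1 = D.n := by have := i.2; omega
      rw [← h1, pow_succ] at hx
      rw [inv_pow, ← eq_inv_of_mul_eq_one_right hx]

/-- Since χ(g^n) = 1, the element g^n acts on every layer by ρ(g^n), so the right side is the r-th
power of the shift. This settles r = n; for r < n both sides are zero. -/
theorem shift_pow_n (hχ : D.χ ^ D.n = 1) :
    shift h ^ D.n = D.μ • (twist (D := D) ρ r (D.g ^ D.n) - 1) := by
  have hx : D.χ (D.g ^ D.n) = 1 := by
    rw [map_pow, ← MonoidHom.pow_apply, hχ, MonoidHom.one_apply]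
  have h1 : D.μ • (twist (D := D) ρ r (D.g ^ D.n) - 1) = shift h ^ r := by
    refine LinearMap.pi_ext fun i u => ?_
    rw [shift_pow_self]
    simp only [LinearMap.smul_apply, LinearMap.sub_apply, twist_single, hx, inv_one, one_pow,
      Units.val_one, one_smul, Module.End.one_apply, yPow, ← Pi.single_sub, ← Pi.single_smul]
  rw [h1]
  rcases h.le.lt_or_eq with hr | hr
  · have h2 : shift h ^ r = 0 := by
      refine LinearMap.pi_ext fun i u => ?_
      rw [shift_pow_self, h.yPow_eq_zero hr]
      simp
    rw [show D.n = r + (D.n - r) by omega, pow_add, h2, zero_mul]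
  · exact congrArg (shift h ^ ·) hr.symm

end Block

variable {D}

/-- The module `U ⊕ yU ⊕ ⋯ ⊕ y ^ (r - 1) U`; for `r = n` it is the induced module. -/
def blk (hD : D.IsNonNilpotent) (U : FinRep k G) {r : ℕ} (h : D.Admissible U.ρ r) :
    FDMod k D.H :=
  FDMod.ofRep (Fin r → U) (D.lift (shift h) (twist (D := D) U.ρ r) (shift_twist h hD.2)
    (shift_pow_n h hD.2))

section Blk

variable (hD : D.IsNonNilpotent) (U : FinRep k G) {r : ℕ} (h : D.Admissible U.ρ r)

/-- The elements of `blk` as functions `Fin r → U`. -/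
def blkOf : (Fin r → U) ≃ₗ[k] blk hD U h := LinearEquiv.refl k (Fin r → U)

theorem y_smul_blkOf (w : Fin r → U) : D.y • blkOf hD U h w = blkOf hD U h (shift h w) :=
  LinearMap.congr_fun (lift_y D _ _ (shift_twist h hD.2) (shift_pow_n h hD.2)) w

theorem grp_smul_blkOf (x : G) (w : Fin r → U) :
    D.grp x • blkOf hD U h w = blkOf hD U h (twist (D := D) U.ρ r x w) :=
  LinearMap.congr_fun (lift_grp D _ _ (shift_twist h hD.2) (shift_pow_n h hD.2) x) w

theorem y_pow_smul_blkOf (i : ℕ) (w : Fin r → U) :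
    D.y ^ i • blkOf hD U h w = blkOf hD U h ((shift h ^ i) w) := by
  induction i generalizing w with
  | zero => simp
  | succ i ih => rw [pow_succ, mul_smul, y_smul_blkOf, ih, pow_succ, Module.End.mul_apply]

/-- The inclusion of the top layer. -/
def inc : U.ρ.IntertwiningMap (D.res (blk hD U h)) where
  toLinearMap := (blkOf hD U h).toLinearMap ∘ₗ
    LinearMap.single k (fun _ : Fin r => U.carrier) ⟨0, h.pos⟩
  isIntertwining' x := by
    refine LinearMap.ext fun u => ?_
    have h1 := twist_single (D := D) (ρ := U.ρ) x (⟨0, h.pos⟩ : Fin r) u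
    simp only [pow_zero, Units.val_one, one_smul] at h1
    refine (congrArg (blkOf hD U h) h1.symm).trans (grp_smul_blkOf hD U h x _).symm

theorem inc_apply (u : U) : inc hD U h u = blkOf hD U h (Pi.single ⟨0, h.pos⟩ u) := rfl

theorem y_pow_smul_inc (i : Fin r) (u : U) :
    D.y ^ (i : ℕ) • inc hD U h u = blkOf hD U h (Pi.single i u) := by
  rw [inc_apply, y_pow_smul_blkOf, shift_pow_single]

theorem y_pow_self_smul_inc (u : U) :
    D.y ^ r • inc hD U h u = inc hD U h (D.yPow U.ρ u) := by
  rw [inc_apply, inc_apply, y_pow_smul_blkOf, shift_pow_self]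

theorem finrank_blk : Module.finrank k (blk hD U h) = r * Module.finrank k U := by
  rw [← (blkOf hD U h).finrank_eq, Module.finrank_pi_fintype]
  simp

variable {N : Type*} [AddCommGroup N] [Module k N] [Module D.H N] [IsScalarTower k D.H N]
variable {hD U h}

/-- The linear map underlying `blkLift`. -/
def blkLiftAux (r : ℕ) (f : U.ρ.IntertwiningMap (D.res N)) : (Fin r → U) →ₗ[k] N :=
  LinearMap.lsum k (fun _ : Fin r => U.carrier) k fun i =>
    (Algebra.lsmul k k N (D.y ^ (i : ℕ))) ∘ₗ f.toLinearMap

theorem blkLiftAux_single (f : U.ρ.IntertwiningMap (D.res N)) (i : Fin r) (u : U) :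
    blkLiftAux r f (Pi.single i u) = D.y ^ (i : ℕ) • f u := by
  rw [blkLiftAux, LinearMap.lsum_piSingle]
  rfl

theorem blkLiftAux_shift (f : U.ρ.IntertwiningMap (D.res N))
    (hf : ∀ u, D.y ^ r • f u = f (D.yPow U.ρ u)) (w : Fin r → U) :
    blkLiftAux r f (shift h w) = D.y • blkLiftAux r f w := by
  suffices h1 : blkLiftAux r f ∘ₗ shift h = Algebra.lsmul k k N D.y ∘ₗ blkLiftAux r f from
    LinearMap.congr_fun h1 w
  refine LinearMap.pi_ext fun i u => ?_
  simp only [LinearMap.comp_apply, Algebra.lsmul_coe, blkLiftAux_single]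
  by_cases hi : (i : ℕ) + 1 < r
  · rw [shift_single_of_lt h hi, blkLiftAux_single, pow_succ', mul_smul]
  · have hr : r = (i : ℕ) + 1 := by have := i.2; omega
    rw [shift_single_of_not_lt h hi, blkLiftAux_single, pow_zero, one_smul, ← hf, ← mul_smul,
      ← pow_succ', ← hr]

theorem blkLiftAux_twist (f : U.ρ.IntertwiningMap (D.res N)) (x : G) (w : Fin r → U) :
    blkLiftAux r f (twist (D := D) U.ρ r x w) = D.grp x • blkLiftAux r f w := by
  suffices h1 : blkLiftAux r f ∘ₗ twist (D := D) U.ρ r x =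
      Algebra.lsmul k k N (D.grp x) ∘ₗ blkLiftAux r f from LinearMap.congr_fun h1 w
  refine LinearMap.pi_ext fun i u => ?_
  simp only [LinearMap.comp_apply, Algebra.lsmul_coe, blkLiftAux_single, twist_single, map_smul,
    f.map_rep, res_apply, ← mul_smul, grp_mul_y_pow, smul_assoc]

/-- The universal property of `blk`. -/
def blkLift (f : U.ρ.IntertwiningMap (D.res N)) (hf : ∀ u, D.y ^ r • f u = f (D.yPow U.ρ u)) :
    blk hD U h →ₗ[D.H] N :=
  D.homOfGen (blkLiftAux r f ∘ₗ (blkOf hD U h).symm.toLinearMap)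
    (fun w => by
      obtain ⟨w, rfl⟩ := (blkOf hD U h).surjective w
      simp [y_smul_blkOf, blkLiftAux_shift f hf])
    (fun x w => by
      obtain ⟨w, rfl⟩ := (blkOf hD U h).surjective w
      simp [grp_smul_blkOf, blkLiftAux_twist])

theorem blkLift_blkOf (f : U.ρ.IntertwiningMap (D.res N))
    (hf : ∀ u, D.y ^ r • f u = f (D.yPow U.ρ u)) (w : Fin r → U) :
    blkLift (hD := hD) (h := h) f hf (blkOf hD U h w) = ∑ i : Fin r, D.y ^ (i : ℕ) • f (w i) := by
  simp only [blkLift, homOfGen_apply, LinearMap.comp_apply, LinearEquiv.coe_coe,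
    LinearEquiv.symm_apply_apply]
  simp only [blkLiftAux, LinearMap.lsum_apply, LinearMap.sum_apply, LinearMap.comp_apply,
    Algebra.lsmul_coe, LinearMap.proj_apply, Representation.IntertwiningMap.coe_toLinearMap]

@[simp] theorem blkLift_inc (f : U.ρ.IntertwiningMap (D.res N))
    (hf : ∀ u, D.y ^ r • f u = f (D.yPow U.ρ u)) (u : U) :
    blkLift (hD := hD) (h := h) f hf (inc hD U h u) = f u := by
  simp [inc_apply, blkLift, blkLiftAux_single]

/-- A module generated by a copy of `U` of the right dimension is isomorphic to `blk`. -/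
theorem nonempty_blk_equiv {M : FDMod k D.H} (f : U.ρ.IntertwiningMap (D.res M))
    (hf : ∀ u, D.y ^ r • f u = f (D.yPow U.ρ u))
    (hspan : ∀ p : Submodule k M, (∀ (i : ℕ) u, i < r → D.y ^ i • f u ∈ p) → p = ⊤)
    (hdim : Module.finrank k M = r * Module.finrank k U) :
    Nonempty (blk hD U h ≃ₗ[D.H] M) := by
  have hs : Function.Surjective ((blkLift (hD := hD) (h := h) f hf).restrictScalars k) := by
    rw [← LinearMap.range_eq_top]
    refine hspan _ fun i u hi => ?_
    refine ⟨D.y ^ i • inc hD U h u, ?_⟩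
    simp
  have hi : Function.Injective ((blkLift (hD := hD) (h := h) f hf).restrictScalars k) :=
    (LinearMap.injective_iff_surjective_of_finrank_eq_finrank
      ((finrank_blk hD U h).trans hdim.symm)).2 hs
  exact ⟨LinearEquiv.ofBijective (blkLift (hD := hD) (h := h) f hf) ⟨hi, hs⟩⟩

end Blk

end GroupDatum

/-! ## Classes in the Green ring -/

section Green

variable {k : Type u} {A : Type v} [Field k] [Ring A] [HopfAlgebra k A]

theorem FDMod.green_eq {M N : FDMod k A} (e : M ≃ₗ[A] N) : M.green = N.green := by
  simp only [FDMod.green, FDMod.free, FDMod.cls_eq e]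

theorem FDMod.green_directSum (M N : FDMod k A) :
    (M.directSum N).green = M.green + N.green := by
  refine (Ideal.Quotient.eq.2 ?_).trans (map_add _ _ _)
  exact AddSubgroup.subset_closure ⟨M, N, (sub_sub _ _ _).symm⟩

theorem FDMod.green_mul (M N : FDMod k A) : M.green * N.green = (M.tensor N).green := by
  simp only [FDMod.green, ← map_mul, FDMod.free_mul]

/-- A zero module satisfies M ⊕ M ≅ M, so its class equals its own double. -/
theorem FDMod.green_of_subsingleton (M : FDMod k A) [Subsingleton M] : M.green = 0 := by
  have e : M.directSum M ≃ₗ[A] M :=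
    { toFun := fun x => x.1
      invFun := fun x => (x, x)
      left_inv := fun x => Prod.ext rfl (Subsingleton.elim _ _)
      right_inv := fun x => rfl
      map_add' := fun x y => rfl
      map_smul' := fun a x => rfl }
  have h := FDMod.green_eq e
  rwa [FDMod.green_directSum, add_eq_left] at h

theorem GreenRing.one_eq : (1 : GreenRing k A) = (FDMod.trivial k A).green := rfl

/-- A subgroup of the Green ring containing all classes of modules is everything. -/
theorem GreenRing.mem_of_forall_green (S : AddSubgroup (GreenRing k A))
    (h : ∀ M : FDMod k A, M.green ∈ S) (x : GreenRing k A) : x ∈ S := by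
  obtain ⟨x, rfl⟩ := Ideal.Quotient.mk_surjective x
  induction x using FreeAbelianGroup.induction_on with
  | zero => simp
  | of a =>
    obtain ⟨M⟩ := a
    exact h M
  | neg a ha =>
    rw [map_neg]
    exact neg_mem ha
  | add a b ha hb =>
    rw [map_add]
    exact add_mem ha hb

/-- Every element of the Green ring is a difference of two classes. -/
theorem GreenRing.exists_sub (x : GreenRing k A) :
    ∃ M N : FDMod k A, x = M.green - N.green := by
  have z : FDMod k A :=
    letI : Module A PUnit.{u + 1} := inferInstance
    haveI : IsScalarTower k A PUnit.{u + 1} := ⟨fun _ _ _ => rfl⟩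
    { carrier := PUnit.{u + 1} }
  refine GreenRing.mem_of_forall_green
    { carrier := {x | ∃ M N : FDMod k A, x = M.green - N.green}
      zero_mem' := ⟨z, z, by simp⟩
      add_mem' := ?_
      neg_mem' := ?_ } (fun M => ⟨M.directSum z, z, by simp [FDMod.green_directSum]⟩) x
  · rintro _ _ ⟨M, N, rfl⟩ ⟨M', N', rfl⟩
    refine ⟨M.directSum M', N.directSum N', ?_⟩
    simp only [FDMod.green_directSum]
    abel
  · rintro _ ⟨M, N, rfl⟩
    exact ⟨N, M, by simp⟩

/-- A submodule, as a finite dimensional module. -/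
def FDMod.ofSub {M : FDMod k A} (p : Submodule A M) : FDMod k A where
  carrier := p
  finite := Module.Finite.of_injective (p.subtype.restrictScalars k) Subtype.val_injective

/-- A quotient, as a finite dimensional module. -/
def FDMod.quot {M : FDMod k A} (p : Submodule A M) : FDMod k A where
  carrier := M ⧸ p
  finite := Module.Finite.of_surjective (p.mkQ.restrictScalars k) p.mkQ_surjective

theorem FDMod.green_eq_of_isCompl {M : FDMod k A} {p q : Submodule A M} (h : IsCompl p q) :
    M.green = (FDMod.ofSub p).green + (FDMod.ofSub q).green := by
  rw [← FDMod.green_directSum]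
  exact FDMod.green_eq (M := M) (N := (FDMod.ofSub p).directSum (FDMod.ofSub q))
    (p.prodEquivOfIsCompl q h).symm

/-- Decomposition into indecomposables, for a property of modules that passes to summands. -/
theorem FDMod.green_mem_closure_indecomposable (Q : FDMod k A → Prop)
    (hQ : ∀ (M : FDMod k A) (p q : Submodule A M), IsCompl p q → Q M → Q (FDMod.ofSub p))
    (M : FDMod k A) (hM : Q M) :
    M.green ∈ AddSubgroup.closure {x | ∃ N : FDMod k A, N.IsIndecomposable ∧ Q N ∧ x = N.green} := by
  induction hd : Module.finrank k M using Nat.strong_induction_on generalizing M with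
  | _ d ih =>
    rcases subsingleton_or_nontrivial M with h | h
    · rw [FDMod.green_of_subsingleton]
      exact zero_mem _
    by_cases hi : M.IsIndecomposable
    · exact AddSubgroup.subset_closure ⟨M, hi, hM, rfl⟩
    · simp only [FDMod.IsIndecomposable, h, true_and, not_forall, not_or] at hi
      obtain ⟨p, q, hpq, hp, hq⟩ := hi
      have hlt : ∀ p q : Submodule A M, IsCompl p q → q ≠ ⊥ → Module.finrank k p < d := by
        intro p q hpq hq
        rw [← hd]
        have : Module.finrank k (p.restrictScalars k) < Module.finrank k M := by
          refine Submodule.finrank_lt fun ht => hq ?_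
          have hp : p = ⊤ := Submodule.restrictScalars_injective k A M ht
          rw [hp] at hpq
          exact hpq.disjoint.eq_bot_of_ge le_top
        exact this
      rw [FDMod.green_eq_of_isCompl hpq]
      exact add_mem (ih _ (hlt p q hpq hq) (FDMod.ofSub p) (hQ M p q hpq hM) rfl)
        (ih _ (hlt q p hpq.symm hp) (FDMod.ofSub q) (hQ M q p hpq.symm hM) rfl)

/-- Summands of projective modules are projective, so splitting into indecomposables never leaves
the generators of P. -/
theorem FDMod.green_mem_projectiveSpan (M : FDMod k A) (hM : Module.Projective A M) :
    M.green ∈ projectiveSpan k A := by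
  have h := FDMod.green_mem_closure_indecomposable (fun N => Module.Projective A N)
    (fun N p q hpq hN => Module.Projective.of_split p.subtype (p.projectionOnto q hpq)
      (LinearMap.ext fun x => Submodule.projectionOnto_apply_left hpq x)) M hM
  exact h

end Green

namespace GroupDatum

variable {k : Type u} {G : Type v} [Field k] [Group G] {D : GroupDatum k G}

section Blk

variable (hD : D.IsNonNilpotent)

theorem blk_span {U : FinRep k G} {r : ℕ} {h : D.Admissible U.ρ r}
    (p : Submodule k (blk hD U h)) (hp : ∀ (i : ℕ) u, i < r → D.y ^ i • inc hD U h u ∈ p) :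
    p = ⊤ := by
  rw [eq_top_iff]
  intro w _
  obtain ⟨w, rfl⟩ := (blkOf hD U h).surjective w
  rw [← Finset.univ_sum_single w, map_sum]
  refine Submodule.sum_mem _ fun i _ => ?_
  rw [← y_pow_smul_inc]
  exact hp i _ i.2

theorem blk_hom_ext {U : FinRep k G} {r : ℕ} {h : D.Admissible U.ρ r}
    {N : Type*} [AddCommGroup N] [Module k N] [Module D.H N] [IsScalarTower k D.H N]
    {f f' : blk hD U h →ₗ[D.H] N} (hf : ∀ u, f (inc hD U h u) = f' (inc hD U h u)) : f = f' := by
  have := blk_span hD (LinearMap.eqLocus (f.restrictScalars k) (f'.restrictScalars k)) (by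
    intro i u _
    simp [hf])
  ext x
  have hx : x ∈ LinearMap.eqLocus (f.restrictScalars k) (f'.restrictScalars k) :=
    this ▸ Submodule.mem_top
  exact hx

/-- Isomorphic representations give isomorphic modules. -/
theorem blk_green_congr {U V : FinRep k G} (e : U.ρ.Equiv V.ρ) {r : ℕ}
    (h : D.Admissible U.ρ r) (h' : D.Admissible V.ρ r) [Finite G] :
    (blk hD U h).green = (blk hD V h').green := by
  have hy : ∀ u, e (D.yPow U.ρ u) = D.yPow V.ρ (e u) := by
    intro u
    simp only [yPow, LinearMap.smul_apply, LinearMap.sub_apply, Module.End.one_apply, map_smul,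
      map_sub, e.map_rep]
  obtain ⟨e'⟩ := nonempty_blk_equiv (hD := hD) (h := h) (M := blk hD V h')
    ((inc hD V h').comp e.toIntertwiningMap) (fun u => by
      have := y_pow_self_smul_inc hD V h' (e u)
      rw [← hy] at this
      exact this)
    (fun p hp => blk_span hD p fun i u hi => by
      have := hp i (e.symm u) hi
      simpa using this)
    (by rw [finrank_blk, e.toLinearEquiv.finrank_eq])
  exact FDMod.green_eq e'

/-- The direct sum of representations. -/
def _root_.FinRep.prod (U V : FinRep k G) : FinRep k G where
  carrier := U × V
  ρ := U.ρ.prod V.ρ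

theorem Admissible.prod {U V : FinRep k G} {r : ℕ} (h : D.Admissible U.ρ r)
    (h' : D.Admissible V.ρ r) : D.Admissible (U.prod V).ρ r where
  pos := h.pos
  le := h.le
  eq_one hr := by
    refine LinearMap.ext fun x => Prod.ext ?_ ?_
    · exact LinearMap.congr_fun (h.eq_one hr) x.1
    · exact LinearMap.congr_fun (h'.eq_one hr) x.2

/-- Additivity in U lets a sum of blocks with equally many layers be stored as one block. This is
what makes the normal form `exists_eq_sum_blk` possible. -/
theorem blk_green_prod [Finite G] {U V : FinRep k G} {r : ℕ} (h : D.Admissible U.ρ r)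
    (h' : D.Admissible V.ρ r) :
    (blk hD (U.prod V) (h.prod h')).green = (blk hD U h).green + (blk hD V h').green := by
  rw [← FDMod.green_directSum]
  obtain ⟨e⟩ := nonempty_blk_equiv (hD := hD) (h := h.prod h')
    (M := (blk hD U h).directSum (blk hD V h'))
    ⟨LinearMap.prodMap (inc hD U h).toLinearMap (inc hD V h').toLinearMap, fun g => by
      refine LinearMap.ext fun x => Prod.ext ?_ ?_
      · exact (inc hD U h).map_rep g x.1
      · exact (inc hD V h').map_rep g x.2⟩
    (fun u => by
      refine Prod.ext ?_ ?_
      · exact y_pow_self_smul_inc hD U h u.1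
      · exact y_pow_self_smul_inc hD V h' u.2)
    (fun p hp => by
      have h1 := blk_span hD (p.comap (LinearMap.inl k (blk hD U h) (blk hD V h')))
        (fun i u hi => by
          have h2 := hp i (u, 0) hi
          refine (congrArg (· ∈ p) (Prod.ext ?_ ?_)).mp h2
          · rfl
          · change D.y ^ i • inc hD V h' 0 = 0
            rw [map_zero, smul_zero])
      have h2 := blk_span hD (p.comap (LinearMap.inr k (blk hD U h) (blk hD V h')))
        (fun i u hi => by
          have h2 := hp i (0, u) hi
          refine (congrArg (· ∈ p) (Prod.ext ?_ ?_)).mp h2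
          · change D.y ^ i • inc hD U h 0 = 0
            rw [map_zero, smul_zero]
          · rfl)
      rw [eq_top_iff]
      intro x _
      have h3 : x.1 ∈ p.comap (LinearMap.inl k (blk hD U h) (blk hD V h')) := h1 ▸ Submodule.mem_top
      have h4 : x.2 ∈ p.comap (LinearMap.inr k (blk hD U h) (blk hD V h')) := h2 ▸ Submodule.mem_top
      refine (congrArg (· ∈ p) (Prod.ext ?_ ?_)).mp (p.add_mem h3 h4)
      · exact add_zero x.1
      · exact zero_add x.2)
    (by
      have h1 : Module.finrank k ((blk hD U h) × (blk hD V h')) = _ := Module.finrank_prod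
      have h2 : Module.finrank k (U × V) = _ := Module.finrank_prod
      refine h1.trans ?_
      rw [finrank_blk, finrank_blk, ← mul_add]
      exact congrArg (r * ·) h2.symm)
  exact FDMod.green_eq e

/-- The zero representation. -/
def _root_.FinRep.zero (k : Type u) (G : Type v) [Field k] [Group G] : FinRep k G where
  carrier := PUnit.{u + 1}
  ρ := Representation.trivial k G PUnit.{u + 1}

instance : Subsingleton (FinRep.zero k G) := inferInstanceAs (Subsingleton PUnit.{u + 1})

theorem blk_green_of_subsingleton [Finite G] {U : FinRep k G} [Subsingleton U] {r : ℕ}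
    (h : D.Admissible U.ρ r) : (blk hD U h).green = 0 := by
  have : Subsingleton (blk hD U h) := (blkOf hD U h).symm.injective.subsingleton
  exact FDMod.green_of_subsingleton _

theorem admissible_zero {r : ℕ} (h0 : 0 < r) (h1 : r ≤ D.n) :
    D.Admissible (FinRep.zero k G).ρ r :=
  ⟨h0, h1, fun _ => rfl⟩

end Blk

/-! ## Induced modules -/

section Ind

theorem y_pow_n_smul {N : Type*} [AddCommGroup N] [Module k N] [Module D.H N]
    [IsScalarTower k D.H N] (x : N) : D.y ^ D.n • x = D.yPow (D.res N) x := by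
  rw [y_pow, smul_assoc, sub_smul, one_smul]
  rfl

variable [Finite G]

variable (D) in
theorem admissible_n {U : Type*} [AddCommGroup U] [Module k U] (ρ : Representation k G U) :
    D.Admissible ρ D.n := ⟨D.n_pos, le_rfl, fun h => absurd h (lt_irrefl _)⟩

/-- The induced module `H ⊗_{k[G]} U`. -/
abbrev ind (hD : D.IsNonNilpotent) (U : FinRep k G) : FDMod k D.H :=
  blk hD U (D.admissible_n U.ρ)

-- For r = n the compatibility condition of `blkLift` is the defining relation for y^n, hence
-- automatic. This makes `ind` left adjoint to restriction.
omit [Finite G] in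
theorem y_pow_n_smul_map {U : FinRep k G} {N : Type*} [AddCommGroup N] [Module k N] [Module D.H N]
    [IsScalarTower k D.H N] (f : U.ρ.IntertwiningMap (D.res N)) (u : U) :
    D.y ^ D.n • f u = f (D.yPow U.ρ u) := by
  rw [y_pow_n_smul]
  simp only [yPow, LinearMap.smul_apply, LinearMap.sub_apply, Module.End.one_apply, map_smul,
    map_sub, f.map_rep]

/-- The universal property of induced modules. -/
abbrev indLift (hD : D.IsNonNilpotent) {U : FinRep k G} {N : Type*} [AddCommGroup N] [Module k N]
    [Module D.H N] [IsScalarTower k D.H N] (f : U.ρ.IntertwiningMap (D.res N)) :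
    ind hD U →ₗ[D.H] N :=
  blkLift f (y_pow_n_smul_map f)

variable [CharZero k]

/-- Lifting along surjections onto induced modules. -/
theorem ind_projective (hD : D.IsNonNilpotent) (U : FinRep k G) :
    Module.Projective D.H (ind hD U) := by
  let p : (ind hD U →₀ D.H) →ₗ[D.H] ind hD U := Finsupp.linearCombination D.H id
  have hp : Function.Surjective p := Finsupp.linearCombination_surjective D.H Function.surjective_id
  -- Averaging gives a lift over kG of the inclusion of the top layer. The adjunction makes it
  -- H-linear, and that it is a section need only be checked on the top layer.
  obtain ⟨s, hs⟩ := Representation.exists_lift (D.resMap p) hp (inc hD U (D.admissible_n U.ρ))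
  refine ⟨indLift hD s, fun x => ?_⟩
  have : p ∘ₗ indLift hD s = LinearMap.id := blk_hom_ext hD fun u => by
    simpa using hs u
  exact LinearMap.congr_fun this x

omit [CharZero k] in
/-- The dimension of the space of homomorphisms from an induced module. -/
theorem finrank_ind_hom (hD : D.IsNonNilpotent) (U : FinRep k G) (M : FDMod k D.H) :
    Module.finrank k (ind hD U →ₗ[D.H] M) =
      Module.finrank k (U.ρ.IntertwiningMap (D.res M)) := by
  refine LinearEquiv.finrank_eq (LinearEquiv.ofBijective
    ({ toFun := fun f => (D.resMap f).comp (inc hD U (D.admissible_n U.ρ))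
       map_add' := fun f f' => rfl
       map_smul' := fun c f => rfl } : (ind hD U →ₗ[D.H] M) →ₗ[k] U.ρ.IntertwiningMap (D.res M))
    ⟨fun f f' hf => blk_hom_ext hD fun u => DFunLike.congr_fun hf u, fun f => ⟨indLift hD f, ?_⟩⟩)
  refine DFunLike.ext _ _ fun u => ?_
  exact blkLift_inc f (y_pow_n_smul_map f) u

end Ind

end GroupDatum

/-! ### Eigenspaces of g^n and of g; modules with g^n acting by a scalar other than 1 -/

theorem Module.End.isFinitelySemisimple_of_pow_eq_one {k V : Type*} [Field k] [CharZero k]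
    [AddCommGroup V] [Module k V] [Module.Finite k V] {a : Module.End k V} {N : ℕ} (hN : N ≠ 0)
    (ha : a ^ N = 1) : a.IsFinitelySemisimple := by
  rw [Module.End.isFinitelySemisimple_iff_isSemisimple]
  refine Module.End.isSemisimple_of_squarefree_aeval_eq_zero
    (p := Polynomial.X ^ N - Polynomial.C 1)
    (Polynomial.separable_X_pow_sub_C 1 (Nat.cast_ne_zero.2 hN) one_ne_zero).squarefree ?_
  simp [ha]

namespace GroupDatum

variable {k : Type u} {G : Type v} [Field k] [Group G] {D : GroupDatum k G}

theorem IsNonNilpotent.mu_ne_zero (hD : D.IsNonNilpotent) : D.μ ≠ 0 := by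
  intro h
  exact hD.1 (by rw [h, zero_smul])

theorem IsNonNilpotent.chi_pow (hD : D.IsNonNilpotent) (h : G) : D.χ h ^ D.n = 1 := by
  rw [← MonoidHom.pow_apply, hD.2, MonoidHom.one_apply]

variable (D) in
/-- The endomorphism of a module given by a group element. -/
abbrev resEnd (M : FDMod k D.H) (h : G) : Module.End k M := D.res M h

theorem isFinitelySemisimple_grp [CharZero k] [Finite G] (M : FDMod k D.H) (h : G) :
    (D.resEnd M h).IsFinitelySemisimple := by
  refine Module.End.isFinitelySemisimple_of_pow_eq_one (N := Nat.card G) Nat.card_pos.ne' ?_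
  rw [resEnd, ← map_pow, pow_card_eq_one', map_one]

/-- The endomorphism `g ^ n - ν` of a module. -/
def gPowSub (hD : D.IsNonNilpotent) (M : FDMod k D.H) (ν : k) : M →ₗ[D.H] M :=
  D.homOfGen (D.res M (D.g ^ D.n) - ν • LinearMap.id)
    (fun x => by
      have hc : D.y * D.grp (D.g ^ D.n) = D.grp (D.g ^ D.n) * D.y := by
        rw [y_mul_grp, map_pow, hD.chi_pow, Units.val_one, one_smul]
      simp only [LinearMap.sub_apply, res_apply, LinearMap.smul_apply, LinearMap.id_apply,
        smul_sub, ← mul_smul, hc, smul_comm D.y ν x])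
    (fun h x => by
      have hc : D.grp (D.g ^ D.n) * D.grp h = D.grp h * D.grp (D.g ^ D.n) := by
        rw [← map_mul, ← map_mul, Subgroup.mem_center_iff.1 (pow_mem D.central D.n) h]
      simp only [LinearMap.sub_apply, res_apply, LinearMap.smul_apply, LinearMap.id_apply,
        smul_sub, ← mul_smul, hc, smul_comm (D.grp h) ν x])

theorem gPowSub_apply (hD : D.IsNonNilpotent) (M : FDMod k D.H) (ν : k) (x : M) :
    gPowSub hD M ν x = D.grp (D.g ^ D.n) • x - ν • x := rfl

/-- An element of finite order acts semisimply in characteristic zero, so T = g^n - ν has ker T² =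
ker T. As T is H-linear, its kernel and range split M as an H-module. -/
theorem isCompl_gPowSub [CharZero k] [Finite G] (hD : D.IsNonNilpotent) (M : FDMod k D.H) (ν : k) :
    IsCompl (LinearMap.ker (gPowSub hD M ν)) (LinearMap.range (gPowSub hD M ν)) := by
  set T := gPowSub hD M ν
  have h1 : ∀ x, T (T x) = 0 → T x = 0 := by
    intro x hx
    have hs := (isFinitelySemisimple_grp M (D.g ^ D.n)).genEigenspace_eq_eigenspace ν
      (k := (2 : ℕ)) (by norm_num)
    have hT : ∀ x, T x = 0 ↔ x ∈ (D.resEnd M (D.g ^ D.n)).eigenspace ν := by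
      intro x
      rw [Module.End.mem_eigenspace_iff]
      exact sub_eq_zero
    rw [hT, ← hs, Module.End.mem_genEigenspace_nat, LinearMap.mem_ker, pow_two]
    exact hx
  have hinj : Function.Injective ((T.restrictScalars k).restrict
      (p := LinearMap.range (T.restrictScalars k)) (q := LinearMap.range (T.restrictScalars k))
      (fun x _ => ⟨x, rfl⟩)) := by
    rw [injective_iff_map_eq_zero]
    rintro ⟨_, x, rfl⟩ hx
    exact Subtype.ext (h1 x (congrArg Subtype.val hx))
  refine ⟨?_, ?_⟩
  · rw [Submodule.disjoint_def]
    rintro _ hx ⟨x, rfl⟩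
    exact h1 x hx
  · rw [codisjoint_iff, eq_top_iff]
    intro x _
    obtain ⟨⟨_, z, rfl⟩, hz⟩ := LinearMap.injective_iff_surjective.1 hinj ⟨T x, x, rfl⟩
    have hz' : T (T z) = T x := congrArg Subtype.val hz
    rw [← sub_add_cancel x (T z)]
    refine Submodule.add_mem_sup ?_ ⟨z, rfl⟩
    rw [LinearMap.mem_ker, map_sub, hz', sub_self]

theorem grp_g_mul_y_pow (i : ℕ) :
    D.grp D.g * D.y ^ i = (((D.χ D.g)⁻¹ ^ i : kˣ) : k) • (D.y ^ i * D.grp D.g) :=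
  D.grp_mul_y_pow i D.g

theorem gEigen_le (M : FDMod k D.H) (l : k) (h : G) : (D.resEnd M D.g).eigenspace l ≤
    ((D.resEnd M D.g).eigenspace l).comap (D.res M h) := fun x hx => by
  rw [Submodule.mem_comap, Module.End.mem_eigenspace_iff]
  rw [Module.End.mem_eigenspace_iff] at hx
  rw [← Module.End.mul_apply, ← map_mul, ← g_comm, map_mul, Module.End.mul_apply, hx, map_smul]

/-- The eigenspace of the central element `g`, as a representation. -/
def gEigen (M : FDMod k D.H) (l : k) : FinRep k G where
  carrier := (D.resEnd M D.g).eigenspace l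
  ρ := (D.res M).subrepresentation _ (gEigen_le M l)

/-- The inclusion of the eigenspace. -/
def gEigenIncl (M : FDMod k D.H) (l : k) : (gEigen M l).ρ.IntertwiningMap (D.res M) :=
  ⟨((D.resEnd M D.g).eigenspace l).subtype, fun _ => rfl⟩

theorem grp_g_smul_gEigen {M : FDMod k D.H} {l : k} (u : gEigen M l) :
    D.grp D.g • gEigenIncl M l u = l • gEigenIncl M l u :=
  Module.End.mem_eigenspace_iff.1 u.2

variable [IsAlgClosed k] [CharZero k] [Finite G]

/-- A module on which `g ^ n` acts by a scalar `l ^ n ≠ 1` is induced. -/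
theorem nonempty_ind_gEigen_equiv (hD : D.IsNonNilpotent) (M : FDMod k D.H) {l : k}
    (hl : l ^ D.n ≠ 1) (hM : ∀ x : M, D.grp (D.g ^ D.n) • x = l ^ D.n • x) :
    Nonempty (ind hD (gEigen M l) ≃ₗ[D.H] M) := by
  -- g^n acts invertibly, so l = 0 is possible only for the zero module.
  have hl0 : l ≠ 0 ∨ Subsingleton M := by
    by_cases h0 : l = 0
    · right
      refine subsingleton_of_forall_eq 0 fun x => ?_
      have h1 := hM x
      rw [h0, zero_pow D.n_pos.ne', zero_smul] at h1
      have h2 : D.grp (D.g ^ D.n)⁻¹ • D.grp (D.g ^ D.n) • x = x := by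
        rw [← mul_smul, ← map_mul, inv_mul_cancel, map_one, one_smul]
      rw [← h2, h1, smul_zero]
    · exact Or.inl h0
  rcases hl0 with hl0 | hs
  swap
  · refine ⟨LinearEquiv.ofBijective (indLift hD (gEigenIncl M l)) ⟨?_, ?_⟩⟩
    · have : Subsingleton (gEigen M l) :=
        inferInstanceAs (Subsingleton ((D.resEnd M D.g).eigenspace l))
      have : Subsingleton (ind hD (gEigen M l)) := (blkOf hD _ _).symm.injective.subsingleton
      exact Function.injective_of_subsingleton _
    · exact Function.surjective_to_subsingleton _
  set q : k := (D.χ D.g : k) with hq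
  have hprim := D.isPrimitiveRoot
  have : NeZero D.n := ⟨D.n_pos.ne'⟩
  have hq0 : q ≠ 0 := (D.χ D.g).ne_zero
  have hyn : ∀ x : M, D.y ^ D.n • x = (D.μ * (l ^ D.n - 1)) • x := by
    intro x
    rw [y_pow_n_smul, mul_smul, sub_smul, one_smul]
    simp [yPow, hM, -map_pow]
  -- This is the scalar by which y^n acts, so y is invertible on M.
  have hz : D.μ * (l ^ D.n - 1) ≠ 0 := mul_ne_zero hD.mu_ne_zero (sub_ne_zero.2 hl)
  have heig : ∀ (i : ℕ) (κ : k) (x : M), D.grp D.g • x = κ • x →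
      D.grp D.g • D.y ^ i • x = (q⁻¹ ^ i * κ) • D.y ^ i • x := by
    intro i κ x hx
    rw [← mul_smul, grp_g_mul_y_pow, smul_assoc, mul_smul, hx, smul_comm _ κ x, smul_smul]
    simp [q]
  have hf : Function.Surjective (indLift hD (gEigenIncl M l)) := by
    have hle : ∀ κ, (D.resEnd M D.g).eigenspace κ ≤
        LinearMap.range ((indLift hD (gEigenIncl M l)).restrictScalars k) := by
      intro κ m hm
      rw [Module.End.mem_eigenspace_iff] at hm
      change D.grp D.g • m = κ • m at hm
      by_cases hm0 : m = 0
      · rw [hm0]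
        exact zero_mem _
      -- Eigenvalues κ of g have the same n-th power as l, so l/κ = q^i for some i < n. Then y^(n-i)
      -- carries the κ-eigenspace into the l-eigenspace, and y^i brings m back up to the nonzero
      -- scalar by which y^n acts.
      have hκ : κ ^ D.n = l ^ D.n := by
        have h1 : ∀ j : ℕ, D.grp D.g ^ j • m = κ ^ j • m := by
          intro j
          induction j with
          | zero => simp
          | succ j ih => rw [pow_succ', mul_smul, ih, smul_comm, hm, smul_smul, ← pow_succ]
        have h2 := h1 D.n
        rw [← map_pow, hM] at h2
        exact (smul_left_injective k hm0 h2).symm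
      have hκ0 : κ ≠ 0 := by
        rintro rfl
        rw [zero_pow D.n_pos.ne'] at hκ
        exact pow_ne_zero _ hl0 hκ.symm
      obtain ⟨i, hi, hqi⟩ := hprim.eq_pow_of_pow_eq_one (ξ := l / κ) (by
        rw [div_pow, hκ, div_self (pow_ne_zero _ hl0)])
      have hw := heig (D.n - i) κ m hm
      have hc : q⁻¹ ^ (D.n - i) * κ = l := by
        have h3 : q ^ i * q ^ (D.n - i) = 1 := by
          rw [← pow_add, Nat.add_sub_cancel' hi.le, hprim.pow_eq_one]
        rw [inv_pow, ← eq_inv_of_mul_eq_one_left h3, hqi, div_mul_cancel₀ _ hκ0]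
      rw [hc] at hw
      let w : gEigen M l := ⟨D.y ^ (D.n - i) • m, Module.End.mem_eigenspace_iff.2 hw⟩
      refine ⟨D.y ^ i • (D.μ * (l ^ D.n - 1))⁻¹ • inc hD _ (D.admissible_n _) w, ?_⟩
      simp only [LinearMap.restrictScalars_apply, map_smul,
        LinearMap.map_smul_of_tower, blkLift_inc]
      change D.y ^ i • (D.μ * (l ^ D.n - 1))⁻¹ • D.y ^ (D.n - i) • m = m
      rw [smul_comm _ (D.μ * (l ^ D.n - 1))⁻¹, ← mul_smul, ← pow_add, Nat.add_sub_cancel' hi.le, hyn,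
        smul_smul, inv_mul_cancel₀ hz, one_smul]
    have htop := Module.End.iSup_maxGenEigenspace_eq_top (D.resEnd M D.g)
    simp only [(isFinitelySemisimple_grp M D.g).maxGenEigenspace_eq_eigenspace] at htop
    have := iSup_le hle
    rw [htop, top_le_iff] at this
    exact (LinearMap.range_eq_top (f := (indLift hD (gEigenIncl M l)).restrictScalars k)).1 this
  refine ⟨LinearEquiv.ofBijective (indLift hD (gEigenIncl M l)) ⟨?_, hf⟩⟩
  rw [injective_iff_map_eq_zero]
  intro w hw
  obtain ⟨w, rfl⟩ := (blkOf hD _ _).surjective w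
  rw [blkLift_blkOf] at hw
  -- The layers y^i U, for 0 ≤ i < n, lie in eigenspaces of g for the distinct eigenvalues q^(-i) l,
  -- so a vanishing sum vanishes term by term.
  have hind := (D.resEnd M D.g).eigenspaces_iSupIndep.comp
    (f := fun i : Fin D.n => q⁻¹ ^ (i : ℕ) * l) (by
      intro i j hij
      have h1 := mul_right_cancel₀ hl0 hij
      exact Fin.ext (hprim.inv.pow_inj i.2 j.2 h1))
  rw [iSupIndep_iff_finsetSum_eq_zero_imp_eq_zero] at hind
  have hzero := hind Finset.univ (fun i => D.y ^ (i : ℕ) • gEigenIncl M l (w i))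
    (fun i _ => Module.End.mem_eigenspace_iff.2 (heig i l _ (grp_g_smul_gEigen (w i)))) hw
  have : w = 0 := by
    funext i
    have h1 := hzero i (Finset.mem_univ i)
    have h2 : D.y ^ (D.n - i : ℕ) • D.y ^ (i : ℕ) • gEigenIncl M l (w i) = 0 := by
      rw [h1, smul_zero]
    rw [← mul_smul, ← pow_add, Nat.sub_add_cancel i.2.le, hyn] at h2
    exact Subtype.ext ((smul_eq_zero.1 h2).resolve_left hz)
  rw [this, map_zero]

end GroupDatum

/-! ### Classification of the indecomposable modules: the case of nilpotent y -/

namespace GroupDatum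

variable {k : Type u} {G : Type v} [Field k] [Group G] {D : GroupDatum k G}

/-- The kernel of `y ^ s`. -/
def kerY (M : FDMod k D.H) (s : ℕ) : Submodule k M := LinearMap.ker (M.rep (D.y ^ s))

@[simp] theorem mem_kerY {M : FDMod k D.H} {s : ℕ} {x : M} : x ∈ kerY M s ↔ D.y ^ s • x = 0 :=
  Iff.rfl

theorem grp_smul_mem_kerY {M : FDMod k D.H} {s : ℕ} (h : G) {x : M} (hx : x ∈ kerY M s) :
    D.grp h • x ∈ kerY M s := by
  rw [mem_kerY] at hx ⊢
  rw [← mul_smul, y_pow_mul_grp, smul_assoc, mul_smul, hx, smul_zero, smul_zero]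

/-- The kernel of `y ^ s`, as a representation. -/
def kerYRep (M : FDMod k D.H) (s : ℕ) : FinRep k G where
  carrier := kerY M s
  ρ := (D.res M).subrepresentation (kerY M s) (fun h _ hx => grp_smul_mem_kerY h hx)

section Retraction

variable (hD : D.IsNonNilpotent) {M : FDMod k D.H} {U : FinRep k G} {r : ℕ}
  (h : D.Admissible U.ρ (r + 1))

/-- A functional on the bottom layer induces a map to `blk`. -/
theorem exists_blk_colift (hz : D.yPow U.ρ = 0) (hM : ∀ x : M, D.y ^ (r + 1) • x = 0)
    (π : M →ₗ[k] U) (hπ : ∀ (x : G) m, π (D.grp x • m) = (((D.χ x)⁻¹ ^ r : kˣ) : k) • U.ρ x (π m)) :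
    ∃ R : M →ₗ[D.H] blk hD U h, ∀ m, R m = ∑ i ∈ Finset.range (r + 1),
      D.y ^ i • inc hD U h (π (D.y ^ (r - i) • m)) := by
  let R : M →ₗ[k] blk hD U h := ∑ i ∈ Finset.range (r + 1),
    (blk hD U h).rep (D.y ^ i) ∘ₗ (inc hD U h).toLinearMap ∘ₗ π ∘ₗ M.rep (D.y ^ (r - i))
  have hR : ∀ m, R m = ∑ i ∈ Finset.range (r + 1),
      D.y ^ i • inc hD U h (π (D.y ^ (r - i) • m)) := by
    intro m
    simp only [R, LinearMap.sum_apply, LinearMap.comp_apply, FDMod.rep_apply,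
      Representation.IntertwiningMap.coe_toLinearMap]
  refine ⟨D.homOfGen R (fun m => ?_) (fun x m => ?_), hR⟩
  -- Multiplying by y shifts the index of the sum by one. The terms left over at the two ends vanish
  -- because y^(r+1) kills both the block and M.
  · have h1 : ∀ u, D.y • D.y ^ r • inc hD U h u = 0 := by
      intro u
      rw [← mul_smul, ← pow_succ', y_pow_self_smul_inc, hz, LinearMap.zero_apply, map_zero]
    have h2 : D.y ^ (r - 0) • D.y • m = 0 := by
      rw [← mul_smul, Nat.sub_zero, ← pow_succ, hM]
    rw [hR, hR, Finset.sum_range_succ', Finset.sum_range_succ, smul_add, h1, h2, map_zero, map_zero,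
      smul_zero, add_zero, add_zero, Finset.smul_sum]
    refine Finset.sum_congr rfl fun i hi => ?_
    rw [Finset.mem_range] at hi
    rw [← mul_smul, ← mul_smul, ← pow_succ', ← pow_succ, show r - (i + 1) + 1 = r - i by omega]
  · rw [hR, hR, Finset.smul_sum]
    refine Finset.sum_congr rfl fun i hi => ?_
    rw [Finset.mem_range] at hi
    rw [← mul_smul, ← mul_smul, y_pow_mul_grp, smul_assoc, mul_smul, map_smul, hπ,
      grp_mul_y_pow, map_smul, map_smul, (inc hD U h).map_rep, res_apply, smul_assoc, mul_smul,
      smul_smul, smul_comm (D.y ^ i), ← Units.val_mul]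
    congr 2
    rw [inv_pow, inv_pow, mul_inv_eq_iff_eq_mul, eq_inv_mul_iff_mul_eq, ← pow_add,
      show i + (r - i) = r by omega]

end Retraction

/-- Let r + 1 be the nilpotency index of y on M, and let U be a G-stable complement of ker y^r.
Since y^r is injective on U, the block with r + 1 layers on U embeds in M. The embedding splits,
because a map from M to such a block can be prescribed through its component in the bottom layer
(`exists_blk_colift`). Indecomposability leaves nothing else. -/
theorem exists_blk_equiv_of_nilpotent [CharZero k] [Finite G] (hD : D.IsNonNilpotent)
    (M : FDMod k D.H) (hind : M.IsIndecomposable) (hM : ∀ x : M, D.grp (D.g ^ D.n) • x = x) :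
    ∃ (U : FinRep k G) (r : ℕ) (h : D.Admissible U.ρ r), Nonempty (M ≃ₗ[D.H] blk hD U h) := by
  have hyn : ∀ x : M, D.y ^ D.n • x = 0 := by
    intro x
    rw [y_pow_n_smul]
    simp [yPow, hM, -map_pow]
  have hex : ∃ r, ∀ x : M, D.y ^ r • x = 0 := ⟨D.n, hyn⟩
  classical
  obtain ⟨r, hr, hmin⟩ : ∃ r, (∀ x : M, D.y ^ r • x = 0) ∧
      ∀ m < r, ¬ ∀ x : M, D.y ^ m • x = 0 :=
    ⟨Nat.find hex, Nat.find_spec hex, fun m hm => Nat.find_min hex hm⟩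
  have := hind.1
  obtain ⟨r, rfl⟩ : ∃ r', r = r' + 1 := by
    refine ⟨r - 1, ?_⟩
    rcases Nat.eq_zero_or_pos r with h0 | h0
    · obtain ⟨x, hx⟩ := exists_ne (0 : M)
      exact absurd (by simpa [h0] using hr x) hx
    · omega
  have hrn : r + 1 ≤ D.n := by
    by_contra hlt
    exact hmin D.n (by omega) hyn
  let i0 : (kerYRep M r).ρ.IntertwiningMap (D.res M) := ⟨(kerY M r).subtype, fun _ => rfl⟩
  obtain ⟨p0, hp0⟩ := Representation.exists_leftInverse i0 Subtype.val_injective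
  let U : FinRep k G :=
    { carrier := p0.ker.toSubmodule
      ρ := p0.ker.toRepresentation }
  let f : U.ρ.IntertwiningMap (D.res M) := ⟨p0.ker.toSubmodule.subtype, fun _ => rfl⟩
  have hfinj : Function.Injective f := Subtype.val_injective
  have hp0U : ∀ u, p0 (f u) = 0 := fun u => u.2
  have hUinj : ∀ u, D.y ^ r • f u = 0 → u = 0 := by
    intro u hu
    have h1 : p0 (i0 ⟨f u, hu⟩) = ⟨f u, hu⟩ := hp0 _
    have h2 : i0 ⟨f u, hu⟩ = f u := rfl
    rw [h2, hp0U] at h1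
    exact hfinj ((congrArg Subtype.val h1.symm).trans (map_zero f).symm)
  have hU1 : U.ρ (D.g ^ D.n) = 1 := by
    refine LinearMap.ext fun u => hfinj ?_
    rw [f.map_rep]
    exact hM _
  have hz : D.yPow U.ρ = 0 := by simp [yPow, hU1]
  have hadm : D.Admissible U.ρ (r + 1) := ⟨by omega, hrn, fun _ => hU1⟩
  have hf : ∀ u, D.y ^ (r + 1) • f u = f (D.yPow U.ρ u) := by
    intro u
    rw [hr, hz, LinearMap.zero_apply, map_zero]
  let F : blk hD U hadm →ₗ[D.H] M := blkLift f hf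
  have hFinj : Function.Injective F := by
    rw [injective_iff_map_eq_zero]
    intro w hw
    obtain ⟨w, rfl⟩ := (blkOf hD U hadm).surjective w
    have hw' : ∑ i : Fin (r + 1), D.y ^ (i : ℕ) • f (w i) = 0 :=
      (blkLift_blkOf f hf w).symm.trans hw
    -- Once the coordinates before m are zero, y^(r-m) leaves only y^r f(w_m), since the later terms
    -- are killed by y^(r+1). Injectivity of y^r on U then gives w_m = 0.
    have hzero : ∀ (m : ℕ) (hm : m < r + 1), w ⟨m, hm⟩ = 0 := by
      intro m
      induction m using Nat.strong_induction_on with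
      | _ m ih =>
        intro hm
        apply hUinj
        have h1 : D.y ^ (r - m) • ∑ i : Fin (r + 1), D.y ^ (i : ℕ) • f (w i) = 0 := by
          rw [hw', smul_zero]
        rw [Finset.smul_sum, Finset.sum_eq_single ⟨m, hm⟩] at h1
        · simp only [← mul_smul, ← pow_add] at h1
          rwa [Nat.sub_add_cancel (by omega)] at h1
        · intro i _ hi
          rcases lt_or_gt_of_ne (fun h => hi (Fin.ext h) : (i : ℕ) ≠ m) with hlt | hgt
          · have h2 := ih i hlt i.2
            simp only [Fin.eta] at h2
            rw [h2, map_zero, smul_zero, smul_zero]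
          · rw [← mul_smul, ← pow_add,
              show r - m + (i : ℕ) = (i - m - 1) + (r + 1) by omega, pow_add, mul_smul, hr,
              smul_zero]
        · intro h
          exact absurd (Finset.mem_univ _) h
    rw [show w = 0 from funext fun i => hzero i i.2, map_zero]
  obtain ⟨r0, hr0⟩ := Representation.exists_leftInverse (D.resMap F) hFinj
  -- A G-equivariant retraction of F, followed by the coordinate of the bottom layer y^r U. The
  -- twist of that layer accounts for the factor χ^(-r) in `hπg`.
  let π : M →ₗ[k] U := LinearMap.proj (Fin.last r) ∘ₗ (blkOf hD U hadm).symm.toLinearMap ∘ₗ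
    r0.toLinearMap
  have hπ : ∀ m, π m = (blkOf hD U hadm).symm (r0 m) (Fin.last r) := fun m => rfl
  have hπg : ∀ (x : G) m, π (D.grp x • m) = (((D.χ x)⁻¹ ^ r : kˣ) : k) • U.ρ x (π m) := by
    intro x m
    have h1 : r0 (D.grp x • m) = D.grp x • r0 m := r0.map_rep x m
    obtain ⟨w, hw⟩ := (blkOf hD U hadm).surjective (r0 m)
    rw [hπ, hπ, h1, ← hw, grp_smul_blkOf, LinearEquiv.symm_apply_apply,
      LinearEquiv.symm_apply_apply]
    rfl
  obtain ⟨R, hR⟩ := exists_blk_colift hD hadm hz hr π hπg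
  have hRF : R ∘ₗ F = LinearMap.id := blk_hom_ext hD fun u => by
    have h1 : F (inc hD U hadm u) = f u := blkLift_inc f hf u
    have h2 : ∀ (i : ℕ) (hi : i < r + 1), π (D.y ^ i • f u) =
        (Pi.single ⟨i, hi⟩ u : Fin (r + 1) → U) (Fin.last r) := by
      intro i hi
      have h3 : D.y ^ i • f u = F (blkOf hD U hadm (Pi.single ⟨i, hi⟩ u)) := by
        rw [← y_pow_smul_inc, map_smul, h1]
      have h4 := hr0 (blkOf hD U hadm (Pi.single ⟨i, hi⟩ u))
      rw [resMap_apply, ← h3] at h4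
      rw [hπ, h4, LinearEquiv.symm_apply_apply]
    rw [LinearMap.comp_apply, h1, hR, LinearMap.id_apply, Finset.sum_eq_single 0]
    · rw [Nat.sub_zero, h2 r (by omega), pow_zero, one_smul]
      congr 1
      exact Pi.single_eq_same (M := fun _ : Fin (r + 1) => U.carrier) (Fin.last r) u
    · intro i hi hi0
      rw [Finset.mem_range] at hi
      rw [h2 (r - i) (by omega), Pi.single_eq_of_ne (by
        intro h
        have := congrArg Fin.val h
        simp only [Fin.val_last] at this
        omega), map_zero, smul_zero]
    · simp
  have hRF' : ∀ x, R (F x) = x := LinearMap.congr_fun hRF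
  have hcompl : IsCompl (LinearMap.range F) (LinearMap.ker R) := by
    refine ⟨?_, ?_⟩
    · rw [Submodule.disjoint_def]
      rintro _ ⟨x, rfl⟩ hx
      rw [LinearMap.mem_ker, hRF'] at hx
      rw [hx, map_zero]
    · rw [codisjoint_iff, eq_top_iff]
      intro x _
      rw [← add_sub_cancel (F (R x)) x]
      refine Submodule.add_mem_sup ⟨_, rfl⟩ ?_
      rw [LinearMap.mem_ker, map_sub, hRF', sub_self]
  refine ⟨U, r + 1, hadm, ?_⟩
  rcases hind.2 _ _ hcompl with h0 | h0
  -- If the image of F is zero then U = 0, so y^r already kills M, against the minimality of r + 1.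
  · exfalso
    have hU0 : ∀ u, f u = 0 := by
      intro u
      have h1 : f u ∈ LinearMap.range F := ⟨inc hD U hadm u, blkLift_inc f hf u⟩
      rw [h0] at h1
      exact h1
    refine hmin r (by omega) fun x => ?_
    have h2 : x - i0 (p0 x) ∈ p0.ker.toSubmodule := by
      change p0 (x - i0 (p0 x)) = 0
      rw [map_sub, hp0, sub_self]
    have h3 : x - i0 (p0 x) = 0 := hU0 ⟨_, h2⟩
    rw [sub_eq_zero.1 h3]
    exact (p0 x).2
  · exact ⟨LinearEquiv.ofBijective R ⟨LinearMap.ker_eq_bot.1 h0, fun x => ⟨F x, hRF' x⟩⟩⟩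

/-- Every indecomposable module is isomorphic to some `blk hD U h`. -/
theorem exists_blk_equiv [IsAlgClosed k] [CharZero k] [Finite G] (hD : D.IsNonNilpotent)
    (M : FDMod k D.H) (hind : M.IsIndecomposable) :
    ∃ (U : FinRep k G) (r : ℕ) (h : D.Admissible U.ρ r), Nonempty (M ≃ₗ[D.H] blk hD U h) := by
  have := hind.1
  obtain ⟨ν, hν⟩ := Module.End.exists_eigenvalue (D.resEnd M (D.g ^ D.n))
  have hker : LinearMap.ker (gPowSub hD M ν) ≠ ⊥ := by
    obtain ⟨x, hx⟩ := hν.exists_hasEigenvector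
    intro h0
    refine hx.2 ?_
    have : x ∈ LinearMap.ker (gPowSub hD M ν) :=
      sub_eq_zero.2 (Module.End.mem_eigenspace_iff.1 hx.1)
    rwa [h0] at this
  have hr := (hind.2 _ _ (isCompl_gPowSub hD M ν)).resolve_left hker
  have hM : ∀ x : M, D.grp (D.g ^ D.n) • x = ν • x := by
    intro x
    have : gPowSub hD M ν x ∈ LinearMap.range (gPowSub hD M ν) := ⟨x, rfl⟩
    rw [hr] at this
    exact sub_eq_zero.1 this
  by_cases h1 : ν = 1
  · exact exists_blk_equiv_of_nilpotent hD M hind fun x => by rw [hM, h1, one_smul]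
  -- Any n-th root l of ν will do: the module is induced from the l-eigenspace of g.
  · obtain ⟨l, hl⟩ := IsAlgClosed.exists_pow_nat_eq ν D.n_pos
    rw [← hl] at h1 hM
    obtain ⟨e⟩ := nonempty_ind_gEigen_equiv hD M h1 hM
    exact ⟨_, _, _, ⟨e.symm⟩⟩

end GroupDatum

/-- The trace is additive on short exact sequences. -/
theorem LinearMap.trace_eq_add_of_exact {k V' V W : Type*} [Field k] [AddCommGroup V'] [Module k V']
    [AddCommGroup V] [Module k V] [Module.Finite k V] [AddCommGroup W] [Module k W]
    {i : V' →ₗ[k] V} {f : V →ₗ[k] W} (hi : Function.Injective i) (hif : Function.Exact i f)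
    (hf : Function.Surjective f) {A' : V' →ₗ[k] V'} {A : V →ₗ[k] V} {B : W →ₗ[k] W}
    (h1 : ∀ x, i (A' x) = A (i x)) (h2 : ∀ x, f (A x) = B (f x)) :
    LinearMap.trace k V A = LinearMap.trace k V' A' + LinearMap.trace k W B := by
  have hA : ∀ x ∈ LinearMap.ker f, A x ∈ LinearMap.ker f := by
    intro x hx
    rw [LinearMap.mem_ker] at hx ⊢
    rw [h2, hx, map_zero]
  have hB : ∀ x ∈ LinearMap.range f, B x ∈ LinearMap.range f := fun x _ => hf _
  rw [LinearMap.trace_eq_trace_ker_add_trace_range f A B h2 hA hB]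
  congr 1
  · let e : V' ≃ₗ[k] LinearMap.ker f := LinearEquiv.ofBijective
      (LinearMap.codRestrict _ i fun x => hif.apply_apply_eq_zero x)
      ⟨fun x y hxy => hi (congrArg Subtype.val hxy), fun x => by
        obtain ⟨y, hy⟩ := (hif x).1 x.2
        exact ⟨y, Subtype.ext hy⟩⟩
    rw [← LinearMap.trace_conj' A' e]
    congr 1
    refine LinearMap.ext fun x => ?_
    obtain ⟨x, rfl⟩ := e.surjective x
    refine Subtype.ext ?_
    simp only [LinearEquiv.conj_apply, LinearMap.comp_apply, LinearEquiv.coe_coe,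
      LinearEquiv.symm_apply_apply]
    exact (h1 x).symm
  · let e : LinearMap.range f ≃ₗ[k] W := LinearEquiv.ofTop _ (LinearMap.range_eq_top.2 hf)
    rw [← LinearMap.trace_conj' _ e]
    congr 1

theorem Representation.char_prod {k G V W : Type*} [Field k] [Group G] [AddCommGroup V] [Module k V]
    [Module.Finite k V] [AddCommGroup W] [Module k W] [Module.Finite k W]
    (ρ : Representation k G V) (σ : Representation k G W) (h : G) :
    (ρ.prod σ).character h = ρ.character h + σ.character h :=
  LinearMap.trace_prodMap' _ _

namespace GroupDatum

variable {k : Type u} {G : Type v} [Field k] [Group G] {D : GroupDatum k G}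

/-! ## Traces on the kernels of the powers of `y` -/

/-- The trace of `h` on the kernel of `y ^ s`. -/
def kerTrace (h : G) (s : ℕ) (M : FDMod k D.H) : k := (kerYRep M s).ρ.character h

theorem kerTrace_congr (h : G) (s : ℕ) {M N : FDMod k D.H} (e : M ≃ₗ[D.H] N) :
    kerTrace h s M = kerTrace h s N := by
  have h1 : ∀ x : M, x ∈ kerY M s ↔ e x ∈ kerY N s := by
    intro x
    rw [mem_kerY, mem_kerY, ← map_smul, e.map_eq_zero_iff]
  have φ : (kerYRep M s).ρ.Equiv (kerYRep N s).ρ := .mk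
    (LinearEquiv.ofLinearMap
      (((e.restrictScalars k).toLinearMap ∘ₗ (kerY M s).subtype).codRestrict (kerY N s)
        fun x => (h1 _).1 x.2)
      (((e.restrictScalars k).symm.toLinearMap ∘ₗ (kerY N s).subtype).codRestrict (kerY M s)
        fun x => (h1 _).2 (by simp))
      (LinearMap.ext fun x => Subtype.ext (e.apply_symm_apply x.1))
      (LinearMap.ext fun x => Subtype.ext (e.symm_apply_apply x.1)))
    (fun g => by
      refine LinearMap.ext fun x => Subtype.ext ?_
      exact map_smul e (D.grp g) x.1)
  exact congrFun (Representation.char_iso φ) h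

theorem kerTrace_directSum (h : G) (s : ℕ) (M N : FDMod k D.H) :
    kerTrace h s (M.directSum N) = kerTrace h s M + kerTrace h s N := by
  refine LinearMap.trace_eq_add_of_exact (V' := kerY M s) (W := kerY N s)
    (i := LinearMap.codRestrict (kerY (M.directSum N) s) (LinearMap.inl k M N ∘ₗ (kerY M s).subtype)
      fun x => Prod.ext x.2 (smul_zero _))
    (f := LinearMap.codRestrict (kerY N s)
      (LinearMap.snd k M N ∘ₗ (kerY (M.directSum N) s).subtype)
      fun x => congrArg Prod.snd x.2)
    (fun x y hxy => Subtype.ext (congrArg Prod.fst (congrArg Subtype.val hxy)))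
    (fun x => ⟨fun hx => ?_, ?_⟩)
    (fun x => ⟨⟨(0, x.1), Prod.ext (smul_zero _) x.2⟩, rfl⟩)
    (fun x => Subtype.ext (Prod.ext rfl (smul_zero _).symm)) (fun x => rfl)
  · exact ⟨⟨x.1.1, congrArg Prod.fst x.2⟩,
      Subtype.ext (Prod.ext rfl (congrArg Subtype.val hx).symm)⟩
  · rintro ⟨y, rfl⟩
    rfl

section GreenRing

variable [Finite G]

variable (D) in
/-- `kerTrace` on the Green ring. -/
def kerTraceHom (h : G) (s : ℕ) : GreenRing k D.H →+ k :=
  GreenRing.liftAdd (Quotient.lift (kerTrace h s) fun _ _ ⟨e⟩ => kerTrace_congr h s e)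
    (kerTrace_directSum h s)

theorem kerTraceHom_green (h : G) (s : ℕ) (M : FDMod k D.H) :
    D.kerTraceHom h s M.green = kerTrace h s M := GreenRing.liftAdd_green _ _ M

theorem kerTraceHom_zero (h : G) : D.kerTraceHom h 0 = 0 := by
  refine GreenRing.addHom_ext fun M => ?_
  rw [kerTraceHom_green]
  have : Subsingleton (kerYRep M 0) := by
    refine ⟨fun x y => Subtype.ext ?_⟩
    have hx : D.y ^ 0 • x.1 = 0 := x.2
    have hy : D.y ^ 0 • y.1 = 0 := y.2
    rw [pow_zero, one_smul] at hx hy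
    rw [hx, hy]
  rw [kerTrace, Representation.character, Subsingleton.elim ((kerYRep M 0).ρ h) 0, map_zero]
  rfl

end GreenRing

/-! ### Values on `blk` -/

section Blk

variable (hD : D.IsNonNilpotent) (U : FinRep k G) {r : ℕ} (h : D.Admissible U.ρ r)

theorem shift_apply (w : Fin r → U) (j : Fin r) : shift h w j =
    if hj : 0 < (j : ℕ) then w ⟨j - 1, by omega⟩ else D.yPow U.ρ (w ⟨r - 1, by omega⟩) := by
  have h0 := h.pos
  have : ∀ j : Fin r, LinearMap.proj j ∘ₗ shift h =
    if hj : 0 < (j : ℕ) then LinearMap.proj (⟨j - 1, by omega⟩ : Fin r)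
      else D.yPow U.ρ ∘ₗ LinearMap.proj (⟨r - 1, by omega⟩ : Fin r) := by
    intro j
    refine LinearMap.pi_ext fun i u => ?_
    simp only [LinearMap.comp_apply, LinearMap.proj_apply]
    by_cases hi : (i : ℕ) + 1 < r
    · rw [shift_single_of_lt h hi]
      by_cases hj : 0 < (j : ℕ)
      · rw [dif_pos hj, LinearMap.proj_apply]
        by_cases hij : (i : ℕ) + 1 = j
        · obtain rfl : j = ⟨i + 1, hi⟩ := Fin.ext hij.symm
          rw [Pi.single_eq_same]
          exact (Pi.single_eq_same (M := fun _ : Fin r => U.carrier) i u).symm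
        · rw [Pi.single_eq_of_ne (fun h => hij (congrArg Fin.val h).symm),
            Pi.single_eq_of_ne (fun h => hij (by have := congrArg Fin.val h; simp at this; omega))]
      · rw [dif_neg hj, LinearMap.comp_apply, LinearMap.proj_apply,
          Pi.single_eq_of_ne (fun h => hj (by have := congrArg Fin.val h; simp at this; omega)),
          Pi.single_eq_of_ne (fun h => by have := congrArg Fin.val h; simp at this; omega),
          map_zero]
    · rw [shift_single_of_not_lt h hi]
      by_cases hj : 0 < (j : ℕ)
      · rw [dif_pos hj, LinearMap.proj_apply,
          Pi.single_eq_of_ne (fun h => by have := congrArg Fin.val h; simp at this; omega),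
          Pi.single_eq_of_ne (fun h => by have := congrArg Fin.val h; simp at this; omega)]
      · obtain rfl : j = ⟨0, h0⟩ := Fin.ext (by simp; omega)
        have hir : i = ⟨r - 1, by omega⟩ := Fin.ext (by simp; omega)
        rw [dif_neg hj, ← hir, LinearMap.comp_apply, LinearMap.proj_apply, Pi.single_eq_same,
          Pi.single_eq_same]
  have h1 := LinearMap.congr_fun (this j) w
  rw [LinearMap.comp_apply, LinearMap.proj_apply] at h1
  rw [h1]
  split_ifs <;> rfl

theorem shift_pow_apply {s : ℕ} (hs : s ≤ r) (w : Fin r → U) (j : Fin r) : (shift h ^ s) w j =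
    if hj : s ≤ (j : ℕ) then w ⟨j - s, by omega⟩ else D.yPow U.ρ (w ⟨r - s + j, by omega⟩) := by
  induction s generalizing j with
  | zero => simp
  | succ s ih =>
    rw [pow_succ', Module.End.mul_apply, shift_apply]
    by_cases hj : 0 < (j : ℕ)
    · rw [dif_pos hj, ih (by omega)]
      by_cases hsj : s + 1 ≤ (j : ℕ)
      · rw [dif_pos hsj, dif_pos (by simp; omega)]
        congr 2
        simp only
        omega
      · rw [dif_neg hsj, dif_neg (by simp; omega)]
        congr 3
        simp only
        omega
    · rw [dif_neg hj, dif_neg (by omega), ih (by omega), dif_pos (by simp; omega)]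
      congr 3
      simp only
      omega

/-- y^s moves the first r - s layers injectively and returns the last s layers to the bottom
positions through `yPow`. The images occupy distinct coordinates, so the conditions separate. -/
theorem blkOf_mem_kerY {s : ℕ} (hs : s ≤ r) (w : Fin r → U) :
    blkOf hD U h w ∈ kerY (blk hD U h) s ↔
      ∀ i : Fin r, if (i : ℕ) + s < r then w i = 0 else D.yPow U.ρ (w i) = 0 := by
  rw [mem_kerY, y_pow_smul_blkOf, LinearEquiv.map_eq_zero_iff, funext_iff]
  constructor
  · intro hw i
    split_ifs with hi
    · have := hw ⟨i + s, hi⟩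
      rw [shift_pow_apply U h hs, dif_pos (by simp)] at this
      simpa using this
    · have := hw ⟨i + s - r, by omega⟩
      rw [shift_pow_apply U h hs, dif_neg (by simp; omega)] at this
      have h2 : (⟨r - s + (i + s - r), by omega⟩ : Fin r) = i := Fin.ext (by simp; omega)
      simp only [h2] at this
      exact this
  · intro hw j
    rw [shift_pow_apply U h hs]
    split_ifs with hj
    · have := hw ⟨j - s, by omega⟩
      rwa [if_pos (by simp; omega)] at this
    · have := hw ⟨r - s + j, by omega⟩
      rwa [if_neg (by simp; omega)] at this

/-- The kernel of `y ^ n` on a representation. -/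
def yPowKer (U : FinRep k G) : FinRep k G where
  carrier := LinearMap.ker (D.yPow U.ρ)
  ρ := U.ρ.subrepresentation (LinearMap.ker (D.yPow U.ρ)) fun x u hu => by
    rw [Submodule.mem_comap, LinearMap.mem_ker, yPow_comm, LinearMap.mem_ker.1 hu, map_zero]

/-- Passing from ker y^s to ker y^(s+1) relaxes a single coordinate, that of layer r - (s + 1), from
zero to ker `yPow`. On this layer x acts with the twist χ(x)^(-(r-s-1)). -/
theorem kerTrace_blk_succ (x : G) {s : ℕ} (hs : s < r) :
    kerTrace x (s + 1) (blk hD U h) = kerTrace x s (blk hD U h) +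
      (((D.χ x)⁻¹ ^ (r - (s + 1)) : kˣ) : k) * (yPowKer (D := D) U).ρ.character x := by
  have hmem : ∀ (s : ℕ) (hs : s ≤ r) (z : blk hD U h), z ∈ kerY (blk hD U h) s ↔
      ∀ i : Fin r, if (i : ℕ) + s < r then (blkOf hD U h).symm z i = 0 else
        D.yPow U.ρ ((blkOf hD U h).symm z i) = 0 := by
    intro s hs z
    rw [← blkOf_mem_kerY hD U h hs, LinearEquiv.apply_symm_apply]
  let j : Fin r := ⟨r - (s + 1), by omega⟩
  rw [← smul_eq_mul, Representation.character, ← map_smul]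
  refine LinearMap.trace_eq_add_of_exact (V' := kerY (blk hD U h) s)
    (W := LinearMap.ker (D.yPow U.ρ))
    (i := Submodule.inclusion (fun z hz => ?_))
    (f := LinearMap.codRestrict _ ((LinearMap.proj j : (Fin r → U) →ₗ[k] U) ∘ₗ
      (blkOf hD U h).symm.toLinearMap ∘ₗ (kerY (blk hD U h) (s + 1)).subtype)
        (fun z => ?_))
    (Submodule.inclusion_injective _)
    (fun z => ⟨fun hz => ?_, ?_⟩) (fun u => ?_) (fun z => rfl) (fun z => ?_)
  · rw [mem_kerY] at hz ⊢
    rw [pow_succ', mul_smul, hz, smul_zero]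
  · have := (hmem (s + 1) (by omega) z.1).1 z.2 j
    rwa [if_neg (by simp [j]; omega)] at this
  · have hz1 : (blkOf hD U h).symm z.1 j = 0 := congrArg Subtype.val hz
    refine ⟨⟨z.1, (hmem s (by omega) z.1).2 fun i => ?_⟩, rfl⟩
    have := (hmem (s + 1) (by omega) z.1).1 z.2 i
    split_ifs with hi
    · by_cases hij : i = j
      · rw [hij, hz1]
      · rwa [if_pos (by
          have : (i : ℕ) ≠ r - (s + 1) := fun h => hij (Fin.ext h)
          omega)] at this
    · rwa [if_neg (by omega)] at this
  · rintro ⟨y, rfl⟩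
    refine Subtype.ext ?_
    have := (hmem s (by omega) y.1).1 y.2 j
    rwa [if_pos (by simp [j]; omega)] at this
  · refine ⟨⟨blkOf hD U h (Pi.single j u.1), (blkOf_mem_kerY hD U h (by omega) _).2 fun i => ?_⟩,
      Subtype.ext ?_⟩
    · by_cases hij : i = j
      · subst hij
        rw [if_neg (by simp [j]; omega), Pi.single_eq_same]
        exact u.2
      · simp [Pi.single_eq_of_ne hij]
    · exact Pi.single_eq_same (M := fun _ : Fin r => U.carrier) j u.1
  · refine Subtype.ext ?_
    obtain ⟨w, hw⟩ := (blkOf hD U h).surjective z.1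
    change (blkOf hD U h).symm (D.grp x • z.1) j = _ • U.ρ x ((blkOf hD U h).symm z.1 j)
    rw [← hw, grp_smul_blkOf, LinearEquiv.symm_apply_apply, LinearEquiv.symm_apply_apply]
    rfl

theorem kerTrace_blk_of_le (x : G) {s : ℕ} (hs : r ≤ s) (hr : r < D.n) :
    kerTrace x s (blk hD U h) = kerTrace x r (blk hD U h) := by
  have : ∀ s, r ≤ s → kerY (blk hD U h) s = ⊤ := by
    intro s hs
    rw [eq_top_iff]
    intro z _
    obtain ⟨w, rfl⟩ := (blkOf hD U h).surjective z
    have h1 := (blkOf_mem_kerY hD U h le_rfl w).2 (fun i => by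
      rw [if_neg (by omega), h.yPow_eq_zero hr, LinearMap.zero_apply])
    rw [mem_kerY] at h1 ⊢
    rw [show s = (s - r) + r by omega, pow_add, mul_smul, h1, smul_zero]
  have h2 : kerY (blk hD U h) s = kerY (blk hD U h) r := (this s hs).trans (this r le_rfl).symm
  exact congrFun (Representation.char_iso (.mk (LinearEquiv.ofEq _ _ h2) fun g => rfl)) x

end Blk

end GroupDatum

namespace GroupDatum

variable {k : Type u} {G : Type v} [Field k] [Group G] {D : GroupDatum k G} [Finite G]

/-! ## Multiplicities of the non-projective indecomposable modules -/

variable (D) in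
/-- The functional on the Green ring which detects the modules `blk hD U h` with `s < n` layers. -/
def layerHom (x : G) (s : ℕ) : GreenRing k D.H →+ k :=
  if 0 < s ∧ s < D.n then
    (1 + (D.χ x : k)) • D.kerTraceHom x s - (D.χ x : k) • D.kerTraceHom x (s - 1) -
      D.kerTraceHom x (s + 1)
  else 0

theorem layerHom_zero (x : G) : D.layerHom x 0 = 0 := if_neg (by simp)

theorem layerHom_of_le (x : G) {s : ℕ} (hs : D.n ≤ s) : D.layerHom x s = 0 :=
  if_neg (by omega)

theorem layerHom_apply (x : G) {s : ℕ} (h0 : 0 < s) (hs : s < D.n) (z : GreenRing k D.H) :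
    D.layerHom x s z = (1 + (D.χ x : k)) * D.kerTraceHom x s z -
      D.χ x * D.kerTraceHom x (s - 1) z - D.kerTraceHom x (s + 1) z := by
  rw [layerHom, if_pos ⟨h0, hs⟩]
  rfl

section Blk

variable (hD : D.IsNonNilpotent) (U : FinRep k G) {r : ℕ} (h : D.Admissible U.ρ r)

omit [Finite G] in
theorem char_yPowKer (hU : D.yPow U.ρ = 0) (x : G) :
    (yPowKer (D := D) U).ρ.character x = U.ρ.character x :=
  congrFun (Representation.char_iso (.mk
    (LinearEquiv.ofTop (LinearMap.ker (D.yPow U.ρ)) (LinearMap.ker_eq_top.2 hU)) fun _ => rfl)) x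

/-- Let d_s be the trace of x on ker y^s minus that on ker y^(s-1). Then `layerHom` is χ d_s -
d_(s+1), and `kerTrace_blk_succ` gives d_(s+1) = χ d_s while s + 1 ≤ r. The pattern breaks only at s
= r, where d_(r+1) = 0 and d_r is the character of U; beyond r all differences vanish. -/
theorem layerHom_blk_of_lt (hr : r < D.n) (x : G) (s : ℕ) :
    D.layerHom x s (blk hD U h).green = if s = r then (D.χ x : k) * U.ρ.character x else 0 := by
  have h0 := h.pos
  have hc : (D.χ x : k) ≠ 0 := Units.ne_zero _
  by_cases hs : 0 < s ∧ s < D.n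
  swap
  · rw [layerHom, if_neg hs, if_neg (by omega), AddMonoidHom.zero_apply]
  obtain ⟨s, rfl⟩ : ∃ t, s = t + 1 := ⟨s - 1, by omega⟩
  rw [layerHom_apply x hs.1 hs.2, kerTraceHom_green, kerTraceHom_green, kerTraceHom_green,
    Nat.add_sub_cancel]
  rcases lt_trichotomy (s + 1) r with hlt | heq | hgt
  · rw [if_neg hlt.ne, kerTrace_blk_succ hD U h x hlt, kerTrace_blk_succ hD U h x (by omega),
      show r - (s + 1) = r - (s + 1 + 1) + 1 by omega, pow_succ]
    push_cast
    field_simp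
    ring
  · subst heq
    rw [if_pos rfl, kerTrace_blk_of_le hD U h x (Nat.le_succ _) hr,
      kerTrace_blk_succ hD U h x (Nat.lt_succ_self _), Nat.sub_self, pow_zero, Units.val_one,
      char_yPowKer U (h.yPow_eq_zero hr)]
    ring
  · rw [if_neg hgt.ne', kerTrace_blk_of_le hD U h x (show r ≤ s + 1 + 1 by omega) hr,
      kerTrace_blk_of_le hD U h x (show r ≤ s + 1 by omega) hr,
      kerTrace_blk_of_le hD U h x (show r ≤ s by omega) hr]
    ring

/-- With n layers the consecutive differences satisfy d_(s+1) = χ d_s for all 0 < s < n, so the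
break at s = n is never seen. -/
theorem layerHom_ind (x : G) (s : ℕ) : D.layerHom x s (ind hD U).green = 0 := by
  have hc : (D.χ x : k) ≠ 0 := Units.ne_zero _
  by_cases hs : 0 < s ∧ s < D.n
  swap
  · rw [layerHom, if_neg hs, AddMonoidHom.zero_apply]
  obtain ⟨s, rfl⟩ : ∃ t, s = t + 1 := ⟨s - 1, by omega⟩
  rw [layerHom_apply x hs.1 hs.2, kerTraceHom_green, kerTraceHom_green, kerTraceHom_green,
    Nat.add_sub_cancel, kerTrace_blk_succ hD U _ x hs.2, kerTrace_blk_succ hD U _ x (by omega),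
    show D.n - (s + 1) = D.n - (s + 1 + 1) + 1 by omega, pow_succ]
  push_cast
  field_simp
  ring

end Blk

section NormalForm

variable (hD : D.IsNonNilpotent)

theorem blk_green_eq {U V : FinRep k G} (e : U = V) {r s : ℕ} (ers : r = s)
    (h : D.Admissible U.ρ r) (h' : D.Admissible V.ρ s) :
    (blk hD U h).green = (blk hD V h').green := by
  subst e
  subst ers
  rfl

/-- Every element of the Green ring is a combination of classes of modules `blk`. -/
theorem exists_eq_sum_blk [IsAlgClosed k] [CharZero k] (z : GreenRing k D.H) :
    ∃ (A B : Fin D.n → FinRep k G) (hA : ∀ i, D.Admissible (A i).ρ (i + 1))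
      (hB : ∀ i, D.Admissible (B i).ρ (i + 1)),
      z = ∑ i, ((blk hD (A i) (hA i)).green - (blk hD (B i) (hB i)).green) := by
  have h0 : ∀ i : Fin D.n, D.Admissible (FinRep.zero k G).ρ (i + 1) := fun i =>
    admissible_zero (Nat.succ_pos _) i.2
  refine GreenRing.mem_of_forall_green
    { carrier := {z | ∃ (A B : Fin D.n → FinRep k G) (hA : ∀ i, D.Admissible (A i).ρ (i + 1))
        (hB : ∀ i, D.Admissible (B i).ρ (i + 1)),
        z = ∑ i, ((blk hD (A i) (hA i)).green - (blk hD (B i) (hB i)).green)}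
      zero_mem' := ⟨fun _ => FinRep.zero k G, fun _ => FinRep.zero k G, h0, h0, by simp⟩
      add_mem' := ?_
      neg_mem' := ?_ } (fun M => ?_) z
  · rintro _ _ ⟨A, B, hA, hB, rfl⟩ ⟨A', B', hA', hB', rfl⟩
    refine ⟨fun i => (A i).prod (A' i), fun i => (B i).prod (B' i), fun i => (hA i).prod (hA' i),
      fun i => (hB i).prod (hB' i), ?_⟩
    rw [← Finset.sum_add_distrib]
    refine Finset.sum_congr rfl fun i _ => ?_
    rw [blk_green_prod hD (hA i) (hA' i), blk_green_prod hD (hB i) (hB' i)]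
    abel
  · rintro _ ⟨A, B, hA, hB, rfl⟩
    refine ⟨B, A, hB, hA, ?_⟩
    rw [← Finset.sum_neg_distrib]
    exact Finset.sum_congr rfl fun i _ => neg_sub _ _
  · refine (AddSubgroup.closure_le _).2 ?_ (FDMod.green_mem_closure_indecomposable
      (fun _ => True) (fun _ _ _ _ _ => trivial) M trivial)
    rintro _ ⟨N, hN, -, rfl⟩
    obtain ⟨U, r, h, ⟨e⟩⟩ := exists_blk_equiv hD N hN
    obtain ⟨r, rfl⟩ : ∃ t, r = t + 1 := ⟨r - 1, by have := h.pos; omega⟩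
    -- Index i stands for blocks with i + 1 layers. The given block is placed at i0 and the zero
    -- representation everywhere else.
    let i0 : Fin D.n := ⟨r, h.le⟩
    let A : Fin D.n → FinRep k G := Function.update (fun _ => FinRep.zero k G) i0 U
    have hA0 : A i0 = U := Function.update_self _ _ _
    have hA1 : ∀ i, i ≠ i0 → A i = FinRep.zero k G := fun i hi => Function.update_of_ne hi _ _
    have hA : ∀ i, D.Admissible (A i).ρ (i + 1) := by
      intro i
      by_cases hi : i = i0
      · subst hi
        rw [hA0]
        exact h
      · rw [hA1 i hi]
        exact h0 i
    refine ⟨A, fun _ => FinRep.zero k G, hA, h0, ?_⟩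
    rw [FDMod.green_eq e, Finset.sum_eq_single i0]
    · rw [blk_green_of_subsingleton hD (h0 i0), sub_zero]
      exact blk_green_eq hD hA0.symm rfl h _
    · intro i _ hi
      rw [blk_green_eq hD (hA1 i hi) rfl (hA i) (h0 i), sub_self]
    · intro hi
      exact absurd (Finset.mem_univ _) hi

variable [IsAlgClosed k] [CharZero k]

/-- An element on which all `layerHom` vanish is a combination of induced modules. -/
theorem exists_eq_ind_sub_ind (z : GreenRing k D.H) (hz : ∀ x s, D.layerHom x s z = 0) :
    ∃ C C' : FinRep k G, z = (ind hD C).green - (ind hD C').green := by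
  obtain ⟨A, B, hA, hB, rfl⟩ := exists_eq_sum_blk hD z
  have hn := D.n_pos
  let l : Fin D.n := ⟨D.n - 1, by omega⟩
  have hl : (l : ℕ) + 1 = D.n := by simp only [l]; omega
  have hind : ∀ (C : Fin D.n → FinRep k G) (hC : ∀ i, D.Admissible (C i).ρ (i + 1)),
      (blk hD (C l) (hC l)).green = (ind hD (C l)).green := fun C hC => blk_green_eq hD rfl hl _ _
  have hlt : ∀ i, i ≠ l → (i : ℕ) + 1 < D.n := by
    intro i hi
    have : (i : ℕ) ≠ D.n - 1 := fun h => hi (Fin.ext h)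
    omega
  have hval : ∀ (C : Fin D.n → FinRep k G) (hC : ∀ i, D.Admissible (C i).ρ (i + 1)) (i j : Fin D.n)
      (x : G), j ≠ l → D.layerHom x (j + 1) (blk hD (C i) (hC i)).green =
        if i = j then (D.χ x : k) * (C i).ρ.character x else 0 := by
    intro C hC i j x hj
    by_cases hi : i = l
    · subst hi
      rw [hind, layerHom_ind, if_neg (Ne.symm hj)]
    · rw [layerHom_blk_of_lt hD _ _ (hlt i hi)]
      refine if_congr ?_ rfl rfl
      rw [Fin.ext_iff]
      omega
  -- `layerHom` at j + 1 isolates χ times the difference of the characters of A j and B j.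
  -- Characters determine representations, so the terms with fewer than n layers cancel in pairs and
  -- only index l survives.
  have heq : ∀ j, j ≠ l → (blk hD (A j) (hA j)).green = (blk hD (B j) (hB j)).green := by
    intro j hj
    have hch : (A j).ρ.character = (B j).ρ.character := by
      funext x
      have h1 := hz x (j + 1)
      rw [map_sum] at h1
      simp only [map_sub, hval _ _ _ _ _ hj] at h1
      rw [Finset.sum_eq_single j (fun i _ hi => by simp [hi]) (by simp), if_pos rfl, if_pos rfl,
        ← mul_sub] at h1
      exact sub_eq_zero.1 ((mul_eq_zero.1 h1).resolve_left (Units.ne_zero _))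
    obtain ⟨e⟩ := Representation.nonempty_equiv_of_character_eq _ _ hch
    exact blk_green_congr hD e _ _
  refine ⟨A l, B l, ?_⟩
  rw [Finset.sum_eq_single l (fun i _ hi => by rw [heq i hi, sub_self]) (by simp), hind, hind]

end NormalForm

end GroupDatum

namespace FDMod

variable {k : Type u} {A : Type v} [Field k] [Ring A] [HopfAlgebra k A]

/-- The tensor product of elements, as an element of the module `M ⊗ N`. -/
def tmul (M N : FDMod k A) : M →ₗ[k] N →ₗ[k] M.tensor N := TensorProduct.mk k M N

theorem span_tmul {M N : FDMod k A} (p : Submodule k (M.tensor N)) (h : ∀ a b, tmul M N a b ∈ p) :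
    p = ⊤ := by
  rw [eq_top_iff]
  intro t _
  induction (show M ⊗[k] N from t) using TensorProduct.induction_on with
  | zero => exact p.zero_mem
  | tmul a b => exact h a b
  | add s t hs ht => exact p.add_mem hs ht

theorem finrank_tensor (M N : FDMod k A) :
    Module.finrank k (M.tensor N) = Module.finrank k M * Module.finrank k N :=
  Module.finrank_tensorProduct (R := k) (S := k) (M := M) (M' := N)

end FDMod

namespace GroupDatum

variable {k : Type u} {G : Type v} [Field k] [Group G] {D : GroupDatum k G}

theorem nonempty_blk_equiv_of_span {hD : D.IsNonNilpotent} {U : FinRep k G} {r : ℕ}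
    {h : D.Admissible U.ρ r} {M : FDMod k D.H} (f : U.ρ.IntertwiningMap (D.res M))
    (hf : ∀ u, D.y ^ r • f u = f (D.yPow U.ρ u))
    (hspan : ∀ p : Submodule D.H M, (∀ u, f u ∈ p) → p = ⊤)
    (hdim : Module.finrank k M = r * Module.finrank k U) :
    Nonempty (blk hD U h ≃ₗ[D.H] M) := by
  have hs : Function.Surjective ((blkLift (hD := hD) (h := h) f hf).restrictScalars k) := by
    have : LinearMap.range (blkLift (hD := hD) (h := h) f hf) = ⊤ :=
      hspan _ fun u => ⟨inc hD U h u, blkLift_inc f hf u⟩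
    exact (LinearMap.range_eq_top (f := blkLift (hD := hD) (h := h) f hf)).1 this
  have hi : Function.Injective ((blkLift (hD := hD) (h := h) f hf).restrictScalars k) :=
    (LinearMap.injective_iff_surjective_of_finrank_eq_finrank
      ((finrank_blk hD U h).trans hdim.symm)).2 hs
  exact ⟨LinearEquiv.ofBijective (blkLift (hD := hD) (h := h) f hf) ⟨hi, hs⟩⟩

variable [Finite G]

/-! ## Tensor products -/

theorem y_smul_tmul (M N : FDMod k D.H) (a : M) (b : N) :
    D.y • FDMod.tmul M N a b = FDMod.tmul M N (D.y • a) (D.grp D.g • b) + FDMod.tmul M N a (D.y • b) := by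
  refine (FDMod.tensor_smul M N D.y (a ⊗ₜ b)).trans ?_
  rw [comul_y, map_add, LinearMap.add_apply, FDMod.tensorAct_tmul, FDMod.tensorAct_tmul, one_smul]
  rfl

theorem grp_smul_tmul (M N : FDMod k D.H) (x : G) (a : M) (b : N) :
    D.grp x • FDMod.tmul M N a b = FDMod.tmul M N (D.grp x • a) (D.grp x • b) := by
  refine (FDMod.tensor_smul M N (D.grp x) (a ⊗ₜ b)).trans ?_
  rw [comul_grp, FDMod.tensorAct_tmul]
  rfl

/-- The tensor product of representations. -/
def _root_.FinRep.tensor (U V : FinRep k G) : FinRep k G where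
  carrier := U ⊗[k] V
  ρ := U.ρ.tprod V.ρ

/-- The tensor product of elements. -/
def _root_.FinRep.tmul (U V : FinRep k G) : U →ₗ[k] V →ₗ[k] U.tensor V := TensorProduct.mk k U V

omit [Finite G] in
theorem _root_.FinRep.tensor_hom_ext {U V : FinRep k G} {N : Type*} [AddCommGroup N] [Module k N]
    {f f' : U.tensor V →ₗ[k] N} (h : ∀ u v, f (U.tmul V u v) = f' (U.tmul V u v)) : f = f' :=
  TensorProduct.ext' h

omit [Finite G] in
theorem _root_.FinRep.ρ_tmul (U V : FinRep k G) (x : G) (u : U) (v : V) :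
    (U.tensor V).ρ x (U.tmul V u v) = U.tmul V (U.ρ x u) (V.ρ x v) := rfl

omit [Finite G] in
theorem _root_.FinRep.finrank_tensor (U V : FinRep k G) :
    Module.finrank k (U.tensor V) = Module.finrank k U * Module.finrank k V :=
  Module.finrank_tensorProduct (R := k) (S := k) (M := U) (M' := V)

/-- Tensoring an equivariant map from `W` with one from `U`. -/
def tensorHom {W U : FinRep k G} {M N : FDMod k D.H} (a : W.ρ.IntertwiningMap (D.res M))
    (b : U.ρ.IntertwiningMap (D.res N)) :
    (W.tensor U).ρ.IntertwiningMap (D.res (M.tensor N)) where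
  toLinearMap := TensorProduct.map a.toLinearMap b.toLinearMap
  isIntertwining' x := by
    refine TensorProduct.ext' fun w u => ?_
    change FDMod.tmul M N (a (W.ρ x w)) (b (U.ρ x u)) = D.grp x • FDMod.tmul M N (a w) (b u)
    rw [grp_smul_tmul, a.map_rep, b.map_rep]
    rfl

omit [Finite G] in
theorem yPow_tensor_tmul {W U : FinRep k G} (hW : W.ρ (D.g ^ D.n) = 1) (w : W) (u : U) :
    D.yPow (W.tensor U).ρ (W.tmul U w u) = W.tmul U w (D.yPow U.ρ u) := by
  simp only [yPow, LinearMap.smul_apply, LinearMap.sub_apply, Module.End.one_apply, FinRep.ρ_tmul,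
    hW, map_smul, map_sub]

omit [Finite G] in
theorem admissible_tensor {W U : FinRep k G} (hW : W.ρ (D.g ^ D.n) = 1) {r : ℕ}
    (h : D.Admissible U.ρ r) : D.Admissible (W.tensor U).ρ r where
  pos := h.pos
  le := h.le
  eq_one hr := by
    refine FinRep.tensor_hom_ext fun w u => ?_
    rw [FinRep.ρ_tmul, hW, h.eq_one hr]
    rfl

/-- Tensoring with a module on which `y` vanishes. -/
theorem blk_one_tensor_blk (hD : D.IsNonNilpotent) {W U : FinRep k G} (hW : D.Admissible W.ρ 1)
    (hn : 1 < D.n) {r : ℕ} (h : D.Admissible U.ρ r) (h' : D.Admissible (W.tensor U).ρ r) :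
    (blk hD W hW).green * (blk hD U h).green = (blk hD (W.tensor U) h').green := by
  rw [FDMod.green_mul]
  -- y kills the one-layer factor, so the summand y ⊗ g of Δ(y) contributes nothing.
  have hy : ∀ w b, D.y • FDMod.tmul _ _ (inc hD W hW w) b =
      FDMod.tmul (blk hD W hW) (blk hD U h) (inc hD W hW w) (D.y • b) := by
    intro w b
    have := y_pow_self_smul_inc hD W hW w
    rw [pow_one, hW.yPow_eq_zero hn, LinearMap.zero_apply, map_zero] at this
    rw [y_smul_tmul, this, map_zero, LinearMap.zero_apply, zero_add]
  have hyr : ∀ (i : ℕ) w b, D.y ^ i • FDMod.tmul _ _ (inc hD W hW w) b =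
      FDMod.tmul (blk hD W hW) (blk hD U h) (inc hD W hW w) (D.y ^ i • b) := by
    intro i w b
    induction i with
    | zero => simp
    | succ i ih => rw [pow_succ', mul_smul, ih, hy, ← mul_smul]
  let f := tensorHom (inc hD W hW) (inc hD U h)
  have hf0 : ∀ w u, f (W.tmul U w u) = FDMod.tmul _ _ (inc hD W hW w) (inc hD U h u) := fun _ _ => rfl
  obtain ⟨e⟩ := nonempty_blk_equiv_of_span (hD := hD) (h := h') f
    (fun t => by
      have : ((blk hD W hW).tensor (blk hD U h)).rep (D.y ^ r) ∘ₗ f.toLinearMap =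
          f.toLinearMap ∘ₗ D.yPow (W.tensor U).ρ := by
        refine FinRep.tensor_hom_ext fun w u => ?_
        change D.y ^ r • f (W.tmul U w u) = f (D.yPow (W.tensor U).ρ (W.tmul U w u))
        rw [yPow_tensor_tmul (hW.eq_one hn), hf0, hf0, hyr, y_pow_self_smul_inc]
      exact LinearMap.congr_fun this t)
    (fun p hp => by
      have h1 : ∀ w b, FDMod.tmul _ _ (inc hD W hW w) b ∈ p := by
        intro w b
        have := blk_span hD ((p.restrictScalars k).comap (FDMod.tmul _ _ (inc hD W hW w)))
          (fun i u hi => by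
            rw [Submodule.mem_comap, ← hyr]
            exact p.smul_mem _ (hp (W.tmul U w u)))
        exact this.ge (Submodule.mem_top (x := b))
      have h2 := FDMod.span_tmul (p.restrictScalars k) (fun a b => by
        have := blk_span hD ((p.restrictScalars k).comap ((FDMod.tmul _ _).flip b))
          (fun i w hi => by
            obtain rfl : i = 0 := by omega
            rw [pow_zero, one_smul]
            exact h1 w b)
        exact this.ge (Submodule.mem_top (x := a)))
      exact Submodule.restrictScalars_injective k D.H _ h2)
    (by
      rw [FDMod.finrank_tensor, finrank_blk, finrank_blk, FinRep.finrank_tensor]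
      ring)
  exact (FDMod.green_eq e).symm

/-- Tensoring an induced module with any module gives an induced module. -/
theorem ind_tensor (hD : D.IsNonNilpotent) (W : FinRep k G) (M : FDMod k D.H) :
    Nonempty (ind hD (W.tensor (D.resRep M)) ≃ₗ[D.H] (ind hD W).tensor M) := by
  let i := inc hD W (D.admissible_n W.ρ)
  let f : (W.tensor (D.resRep M)).ρ.IntertwiningMap (D.res ((ind hD W).tensor M)) :=
    tensorHom (U := D.resRep M) i (.id _)
  have hf0 : ∀ w (m : M), f (W.tmul (D.resRep M) w m) = FDMod.tmul _ _ (i w) m := fun _ _ => rfl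
  refine nonempty_blk_equiv_of_span f (y_pow_n_smul_map f) (fun p hp => ?_) ?_
  · have h1 : ∀ (j : ℕ) w (m : M), FDMod.tmul _ _ (D.y ^ j • i w) m ∈ p := by
      intro j w
      induction j with
      | zero =>
        intro m
        rw [pow_zero, one_smul]
        exact hp (W.tmul (D.resRep M) w m)
      | succ j ih =>
        intro m
        -- Applied to y^j w ⊗ g⁻¹m, the formula for Δ(y) can be solved for y^(j+1) w ⊗ m. By
        -- induction on j, the subspace W ⊗ M generates the tensor product.
        have h2 := y_smul_tmul (ind hD W) M (D.y ^ j • i w) (D.grp D.g⁻¹ • m)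
        rw [← mul_smul, ← pow_succ', ← mul_smul, ← map_mul, mul_inv_cancel, map_one,
          one_smul] at h2
        rw [← sub_eq_iff_eq_add.2 h2]
        exact p.sub_mem (p.smul_mem _ (ih _)) (ih _)
    have h2 := FDMod.span_tmul (p.restrictScalars k) (fun a m => by
      have := blk_span hD ((p.restrictScalars k).comap ((FDMod.tmul _ _).flip m))
        (fun j w _ => h1 j w m)
      exact this.ge (Submodule.mem_top (x := a)))
    exact Submodule.restrictScalars_injective k D.H _ h2
  · rw [FDMod.finrank_tensor, finrank_blk, FinRep.finrank_tensor, mul_assoc]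
    rfl

/-! ## The two dimensional uniserial module -/

/-- The trivial representation. -/
def trivRep (k : Type u) (G : Type v) [Field k] [Group G] : FinRep k G where
  carrier := k
  ρ := Representation.trivial k G k

/-- The basis vector of the trivial representation. -/
def trivOne : trivRep k G := (1 : k)

omit [Finite G] in
theorem smul_trivOne (c : trivRep k G) : (show k from c) • trivOne (G := G) = c :=
  mul_one (show k from c)

omit [Finite G] in
theorem admissible_trivRep {r : ℕ} (h0 : 0 < r) (h1 : r ≤ D.n) :
    D.Admissible (trivRep k G).ρ r := ⟨h0, h1, fun _ => rfl⟩

omit [Finite G] in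
theorem yPow_trivRep : D.yPow (trivRep k G).ρ = 0 := by
  have : (trivRep k G).ρ (D.g ^ D.n) = 1 := rfl
  rw [yPow, this, sub_self, smul_zero]

section Two

variable (hD : D.IsNonNilpotent) (h2 : D.Admissible (trivRep k G).ρ 2) (M : FDMod k D.H)

/-- The two dimensional uniserial module with trivial top. -/
abbrev two : FDMod k D.H := blk hD (trivRep k G) h2

/-- The generator of the module `two`. -/
abbrev twoGen : two hD h2 := inc hD (trivRep k G) h2 trivOne

omit [Finite G] in
theorem y_sq_smul_twoGen : D.y • D.y • twoGen hD h2 = 0 := by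
  have h := y_pow_self_smul_inc hD (trivRep k G) h2 trivOne
  rw [yPow_trivRep, LinearMap.zero_apply, map_zero] at h
  rw [← mul_smul, ← pow_two, h]

omit [Finite G] in
theorem grp_smul_twoGen (x : G) : D.grp x • twoGen hD h2 = twoGen hD h2 :=
  ((inc hD (trivRep k G) h2).map_rep x trivOne).symm

/-- Coordinates on the tensor product of `two` with a module. -/
def twoTensorMap : (M × M) →ₗ[k] (two hD h2).tensor M :=
  LinearMap.coprod (FDMod.tmul _ _ (twoGen hD h2)) (FDMod.tmul _ _ (D.y • twoGen hD h2))

theorem twoTensorMap_apply (a b : M) : twoTensorMap hD h2 M (a, b) =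
    FDMod.tmul _ _ (twoGen hD h2) a + FDMod.tmul _ _ (D.y • twoGen hD h2) b := rfl

theorem twoTensorMap_bijective : Function.Bijective (twoTensorMap hD h2 M) := by
  have hs : Function.Surjective (twoTensorMap hD h2 M) := by
    rw [← LinearMap.range_eq_top]
    refine FDMod.span_tmul _ fun a m => ?_
    have := blk_span hD ((LinearMap.range (twoTensorMap hD h2 M)).comap ((FDMod.tmul _ _).flip m))
      (fun j c hj => by
        rw [← smul_trivOne c, map_smul, smul_comm]
        refine Submodule.smul_mem _ _ ?_
        interval_cases j
        · refine ⟨(m, 0), ?_⟩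
          rw [twoTensorMap_apply, map_zero, add_zero, pow_zero, one_smul]
          rfl
        · refine ⟨(0, m), ?_⟩
          rw [twoTensorMap_apply, map_zero, zero_add, pow_one]
          rfl)
    exact this.ge (Submodule.mem_top (x := a))
  refine ⟨(LinearMap.injective_iff_surjective_of_finrank_eq_finrank ?_).2 hs, hs⟩
  rw [Module.finrank_prod, FDMod.finrank_tensor, finrank_blk]
  change _ = 2 * Module.finrank k k * _
  rw [Module.finrank_self]
  ring

/-- Coordinates on the tensor product of `two` with a module. -/
def twoTensor : (M × M) ≃ₗ[k] (two hD h2).tensor M :=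
  LinearEquiv.ofBijective _ (twoTensorMap_bijective hD h2 M)

theorem twoTensor_apply (a b : M) : twoTensor hD h2 M (a, b) =
    FDMod.tmul _ _ (twoGen hD h2) a + FDMod.tmul _ _ (D.y • twoGen hD h2) b := rfl

theorem y_smul_twoTensor (a b : M) : D.y • twoTensor hD h2 M (a, b) =
    twoTensor hD h2 M (D.y • a, D.grp D.g • a + D.y • b) := by
  rw [twoTensor_apply, twoTensor_apply, smul_add, y_smul_tmul, y_smul_tmul, y_sq_smul_twoGen, map_zero,
    LinearMap.zero_apply, zero_add, map_add]
  abel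

theorem grp_smul_twoTensor (x : G) (a b : M) : D.grp x • twoTensor hD h2 M (a, b) =
    twoTensor hD h2 M (D.grp x • a, (((D.χ x)⁻¹ : kˣ) : k) • D.grp x • b) := by
  have h1 : D.grp x • D.y • twoGen hD h2 = (((D.χ x)⁻¹ : kˣ) : k) • D.y • twoGen hD h2 := by
    have := D.grp_mul_y_pow 1 x
    rw [pow_one, pow_one] at this
    rw [← mul_smul, this, smul_assoc, mul_smul, grp_smul_twoGen]
  rw [twoTensor_apply, twoTensor_apply, smul_add, grp_smul_tmul, grp_smul_tmul, h1, grp_smul_twoGen,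
    map_smul (FDMod.tmul (two hD h2) M), LinearMap.smul_apply,
    map_smul (FDMod.tmul (two hD h2) M (D.y • twoGen hD h2))]

/-- The contribution of a to the second coordinate is the sum of y^i g y^(s-i) a over 0 ≤ i ≤ s.
Moving g to the front costs q^i, and these powers add up to the quantum integer. -/
theorem y_pow_smul_twoTensor (s : ℕ) (a b : M) : D.y ^ (s + 1) • twoTensor hD h2 M (a, b) =
    twoTensor hD h2 M (D.y ^ (s + 1) • a,
      qNum (D.χ D.g : k) (s + 1) • D.grp D.g • D.y ^ s • a + D.y ^ (s + 1) • b) := by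
  induction s with
  | zero => simp [y_smul_twoTensor, qNum]
  | succ s ih =>
    rw [pow_succ', mul_smul, ih, y_smul_twoTensor]
    congr 1
    refine Prod.ext ?_ ?_
    · simp only [← mul_smul]
    · have h1 : D.y • D.grp D.g • D.y ^ s • a =
          (D.χ D.g : k) • D.grp D.g • D.y ^ (s + 1) • a := by
        rw [← mul_smul, y_mul_grp, smul_assoc, mul_smul, ← mul_smul D.y, ← pow_succ']
      have h3 : qNum (D.χ D.g : k) (s + 1 + 1) = 1 + D.χ D.g * qNum (D.χ D.g : k) (s + 1) := by
        rw [add_comm (s + 1) 1, qNum_add]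
        simp [qNum]
      simp only [smul_add]
      rw [smul_comm D.y (qNum (D.χ D.g : k) (s + 1)), h1, h3, add_smul, one_smul, mul_smul,
        smul_comm (D.χ D.g : k) (qNum (D.χ D.g : k) (s + 1)), ← mul_smul D.y, add_assoc]

end Two

end GroupDatum

/-! ### Tensoring with the two dimensional module: traces on kernels and the three-term recurrence
-/

namespace GroupDatum

variable {k : Type u} {G : Type v} [Field k] [Group G] {D : GroupDatum k G} [Finite G]

section Two

variable (hD : D.IsNonNilpotent) (h2 : D.Admissible (trivRep k G).ρ 2)

theorem twoTensor_mem_kerY {M : FDMod k D.H} {s : ℕ} (a b : M) :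
    twoTensor hD h2 M (a, b) ∈ kerY ((two hD h2).tensor M) (s + 1) ↔
      D.y ^ (s + 1) • a = 0 ∧
        qNum (D.χ D.g : k) (s + 1) • D.grp D.g • D.y ^ s • a + D.y ^ (s + 1) • b = 0 := by
  rw [mem_kerY, y_pow_smul_twoTensor, LinearEquiv.map_eq_zero_iff, Prod.mk_eq_zero]

/-- The trace on the tensor product with `two`, from a short exact sequence of kernels. -/
theorem kerTrace_two_tensor_of_iff (x : G) (M : FDMod k D.H) (s t t' : ℕ)
    (h1 : ∀ a : M, twoTensor hD h2 M (a, 0) ∈ kerY ((two hD h2).tensor M) s ↔ a ∈ kerY M t)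
    (h3 : ∀ b : M, (∃ a, twoTensor hD h2 M (a, b) ∈ kerY ((two hD h2).tensor M) s) ↔
      b ∈ kerY M t') :
    kerTrace x s ((two hD h2).tensor M) =
      kerTrace x t M + (((D.χ x)⁻¹ : kˣ) : k) * kerTrace x t' M := by
  rw [kerTrace, kerTrace, kerTrace, ← smul_eq_mul, Representation.character,
    Representation.character, Representation.character, ← map_smul]
  refine LinearMap.trace_eq_add_of_exact (V' := kerY M t)
    (V := kerY ((two hD h2).tensor M) s) (W := kerY M t')
    (i := LinearMap.codRestrict _
      ((twoTensor hD h2 M).toLinearMap ∘ₗ LinearMap.inl k M M ∘ₗ (kerY M t).subtype)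
      fun a => (h1 _).2 a.2)
    (f := LinearMap.codRestrict _
      (LinearMap.snd k M M ∘ₗ (twoTensor hD h2 M).symm.toLinearMap ∘ₗ Submodule.subtype _)
      fun z => (h3 _).1 ⟨((twoTensor hD h2 M).symm z.1).1, ?_⟩)
    (fun a b hab => ?_) (fun z => ⟨fun hz => ?_, ?_⟩) (fun b => ?_) (fun a => ?_) (fun z => ?_)
  · change twoTensor hD h2 M ((twoTensor hD h2 M).symm z.1) ∈ _
    rw [LinearEquiv.apply_symm_apply]
    exact z.2
  · have hab' := congrArg Subtype.val hab
    have := (twoTensor hD h2 M).injective hab'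
    exact Subtype.ext (congrArg Prod.fst this)
  · obtain ⟨⟨a, b⟩, hab⟩ := (twoTensor hD h2 M).surjective z.1
    have hb : ((twoTensor hD h2 M).symm z.1).2 = 0 := congrArg Subtype.val hz
    rw [← hab, LinearEquiv.symm_apply_apply] at hb
    change b = 0 at hb
    subst hb
    exact ⟨⟨a, (h1 a).1 (hab ▸ z.2)⟩, Subtype.ext hab⟩
  · rintro ⟨a, rfl⟩
    refine Subtype.ext ?_
    change ((twoTensor hD h2 M).symm (twoTensor hD h2 M (a.1, 0))).2 = 0
    rw [LinearEquiv.symm_apply_apply]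
  · obtain ⟨a, ha⟩ := (h3 b).2 b.2
    refine ⟨⟨_, ha⟩, Subtype.ext ?_⟩
    change ((twoTensor hD h2 M).symm (twoTensor hD h2 M (a, b.1))).2 = b.1
    rw [LinearEquiv.symm_apply_apply]
  · refine Subtype.ext ?_
    change twoTensor hD h2 M (D.grp x • a.1, 0) = D.grp x • twoTensor hD h2 M (a.1, 0)
    rw [grp_smul_twoTensor, smul_zero, smul_zero]
  · refine Subtype.ext ?_
    obtain ⟨⟨a, b⟩, hab⟩ := (twoTensor hD h2 M).surjective z.1
    change ((twoTensor hD h2 M).symm (D.grp x • z.1)).2 =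
      _ • D.grp x • ((twoTensor hD h2 M).symm z.1).2
    rw [← hab, grp_smul_twoTensor, LinearEquiv.symm_apply_apply, LinearEquiv.symm_apply_apply]

/-- For s + 1 < n the quantum integer [s+1] is nonzero. Kernel vectors with b = 0 are then those
with y^s a = 0. Multiplying the second equation by y shows that b must satisfy y^(s+2) b = 0, and
for such b the equation can be solved for a. -/
theorem kerTrace_two_tensor (x : G) (M : FDMod k D.H) {s : ℕ} (hs : s + 1 < D.n) :
    kerTrace x (s + 1) ((two hD h2).tensor M) =
      kerTrace x s M + (((D.χ x)⁻¹ : kˣ) : k) * kerTrace x (s + 1 + 1) M := by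
  have hq : qNum (D.χ D.g : k) (s + 1) ≠ 0 := by
    rw [Ne, qNum_eq_zero_iff (by omega) D.isPrimitiveRoot]
    exact fun hd => by have := Nat.le_of_dvd (by omega) hd; omega
  have hg0 : ∀ a : M, D.grp D.g • a = 0 → a = 0 := by
    intro a ha
    rw [← one_smul D.H a, ← map_one D.grp, ← inv_mul_cancel D.g, map_mul, mul_smul, ha, smul_zero]
  refine kerTrace_two_tensor_of_iff hD h2 x M _ _ _ (fun a => ?_) (fun b => ⟨?_, fun hb => ?_⟩)
  · rw [twoTensor_mem_kerY, smul_zero, add_zero, smul_eq_zero_iff_right hq, mem_kerY]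
    refine ⟨fun h => hg0 _ h.2, fun h => ?_⟩
    rw [pow_succ', mul_smul, h, smul_zero, smul_zero]
    exact ⟨rfl, rfl⟩
  · rintro ⟨a, ha⟩
    rw [twoTensor_mem_kerY] at ha
    have h3 : D.y • D.grp D.g • D.y ^ s • a = 0 := by
      rw [← mul_smul, y_mul_grp, smul_assoc, mul_smul, ← mul_smul D.y, ← pow_succ', ha.1,
        smul_zero, smul_zero]
    have h4 := congrArg (D.y • ·) ha.2
    simp only [smul_add, smul_zero] at h4
    rw [smul_comm, h3, smul_zero, zero_add, ← mul_smul, ← pow_succ'] at h4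
    exact h4
  · rw [mem_kerY] at hb
    -- A multiple of g⁻¹ y b is tried for a, so that [s+1] g y^s a is a multiple of y^(s+1) b.
    -- Moving y^s past g⁻¹ gives q^(-s), which the factor q^s in γ undoes, and the total becomes -1.
    let γ : k := -((qNum (D.χ D.g : k) (s + 1))⁻¹ * (D.χ D.g : k) ^ s)
    have h5 : ∀ i, D.y ^ i • D.grp D.g⁻¹ • D.y • b =
        (((D.χ D.g)⁻¹ ^ i : kˣ) : k) • D.grp D.g⁻¹ • D.y ^ (i + 1) • b := by
      intro i
      rw [← mul_smul, y_pow_mul_grp, smul_assoc, mul_smul, ← mul_smul (D.y ^ i), ← pow_succ,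
        map_inv]
    refine ⟨γ • D.grp D.g⁻¹ • D.y • b, (twoTensor_mem_kerY hD h2 _ _).2 ⟨?_, ?_⟩⟩
    · rw [smul_comm, h5, hb, smul_zero, smul_zero, smul_zero]
    · have hcc : qNum (D.χ D.g : k) (s + 1) * γ * (((D.χ D.g)⁻¹ ^ s : kˣ) : k) = -1 := by
        have hc : (D.χ D.g : k) ≠ 0 := Units.ne_zero _
        simp only [γ]
        push_cast
        rw [inv_pow]
        field_simp
      rw [smul_comm (D.y ^ s), h5, smul_comm (D.grp D.g), smul_comm (D.grp D.g),
        ← mul_smul (D.grp D.g), ← map_mul, mul_inv_cancel, map_one, one_smul, smul_smul, smul_smul,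
        hcc, neg_one_smul, neg_add_cancel]

/-- The quantum integer [n] vanishes at a primitive n-th root of unity, so y^n acts on the two
coordinates separately. -/
theorem kerTrace_two_tensor_n (x : G) (M : FDMod k D.H) :
    kerTrace x D.n ((two hD h2).tensor M) =
      kerTrace x D.n M + (((D.χ x)⁻¹ : kˣ) : k) * kerTrace x D.n M := by
  have hn : 2 ≤ D.n := h2.le
  obtain ⟨s, hs⟩ : ∃ s, D.n = s + 1 := ⟨D.n - 1, by omega⟩
  have hq : qNum (D.χ D.g : k) (s + 1) = 0 := by
    rw [qNum_eq_zero_iff hn D.isPrimitiveRoot, hs]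
  rw [hs]
  refine kerTrace_two_tensor_of_iff hD h2 x M _ _ _ (fun a => ?_) (fun b => ⟨?_, fun hb => ?_⟩)
  · rw [twoTensor_mem_kerY, hq, zero_smul, zero_add, smul_zero, mem_kerY]
    simp
  · rintro ⟨a, ha⟩
    rw [twoTensor_mem_kerY, hq, zero_smul, zero_add] at ha
    exact ha.2
  · refine ⟨0, (twoTensor_mem_kerY hD h2 _ _).2 ⟨smul_zero _, ?_⟩⟩
    rw [hq, zero_smul, zero_add]
    exact hb

/-- The kernel formulas, inserted into the second difference, turn multiplication by `two` into a
weighted adjacency operator on the path 1, ..., n - 1. The conventions that `layerHom` is zero at 0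
and at n absorb both ends of the path. -/
theorem layerHom_two_mul (x : G) {s : ℕ} (h0 : 0 < s) (hs : s < D.n) (z : GreenRing k D.H) :
    D.layerHom x s ((two hD h2).green * z) = D.layerHom x (s - 1) z +
      (((D.χ x)⁻¹ : kˣ) : k) * D.layerHom x (s + 1) z := by
  have key1 : ∀ s, s + 1 < D.n → ∀ z, D.kerTraceHom x (s + 1) ((two hD h2).green * z) =
      D.kerTraceHom x s z + (((D.χ x)⁻¹ : kˣ) : k) * D.kerTraceHom x (s + 1 + 1) z := by
    intro s hs z
    refine GreenRing.mem_of_forall_green (AddMonoidHom.eqLocus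
      ((D.kerTraceHom x (s + 1)).comp (AddMonoidHom.mulLeft (two hD h2).green))
      (D.kerTraceHom x s + (((D.χ x)⁻¹ : kˣ) : k) • D.kerTraceHom x (s + 1 + 1))) (fun M => ?_) z
    change D.kerTraceHom x (s + 1) ((two hD h2).green * M.green) = D.kerTraceHom x s M.green +
      (((D.χ x)⁻¹ : kˣ) : k) * D.kerTraceHom x (s + 1 + 1) M.green
    rw [FDMod.green_mul, kerTraceHom_green, kerTraceHom_green, kerTraceHom_green,
      kerTrace_two_tensor hD h2 x M hs]
  have key2 : ∀ z, D.kerTraceHom x D.n ((two hD h2).green * z) =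
      D.kerTraceHom x D.n z + (((D.χ x)⁻¹ : kˣ) : k) * D.kerTraceHom x D.n z := by
    intro z
    refine GreenRing.mem_of_forall_green (AddMonoidHom.eqLocus
      ((D.kerTraceHom x D.n).comp (AddMonoidHom.mulLeft (two hD h2).green))
      (D.kerTraceHom x D.n + (((D.χ x)⁻¹ : kˣ) : k) • D.kerTraceHom x D.n)) (fun M => ?_) z
    change D.kerTraceHom x D.n ((two hD h2).green * M.green) = D.kerTraceHom x D.n M.green +
      (((D.χ x)⁻¹ : kˣ) : k) * D.kerTraceHom x D.n M.green
    rw [FDMod.green_mul, kerTraceHom_green, kerTraceHom_green, kerTrace_two_tensor_n hD h2 x M]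
  have hc : (D.χ x : k) ≠ 0 := Units.ne_zero _
  have hd0 : ∀ z, D.kerTraceHom x 0 z = 0 := fun z => by rw [kerTraceHom_zero]; rfl
  rw [layerHom_apply x h0 hs]
  obtain ⟨s, rfl⟩ : ∃ t, s = t + 1 := ⟨s - 1, by omega⟩
  rw [Nat.add_sub_cancel, key1 s hs]
  have hA : (1 + (D.χ x : k)) * D.kerTraceHom x s z -
      D.χ x * D.kerTraceHom x s ((two hD h2).green * z) = D.layerHom x s z := by
    rcases s with _ | s
    · simp [hd0, layerHom_zero]
    · rw [layerHom_apply (s := s + 1) x (by omega) (by omega), key1 s (by omega), Nat.add_sub_cancel]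
      push_cast
      field_simp
      ring
  have hB : (1 + (D.χ x : k)) * ((((D.χ x)⁻¹ : kˣ) : k) * D.kerTraceHom x (s + 1 + 1) z) -
      D.kerTraceHom x (s + 1 + 1) ((two hD h2).green * z) =
      (((D.χ x)⁻¹ : kˣ) : k) * D.layerHom x (s + 1 + 1) z := by
    rcases (show s + 1 + 1 ≤ D.n from hs).lt_or_eq with hlt | heq
    · rw [layerHom_apply (s := s + 1 + 1) x (by omega) hlt, key1 (s + 1) hlt, Nat.add_sub_cancel]
      push_cast
      field_simp
      ring
    -- At the upper end the decoupled formula for ker y^n applies, and the terms cancel because (1 +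
    -- χ) χ⁻¹ = 1 + χ⁻¹.
    · rw [heq, key2, layerHom_of_le x le_rfl, AddMonoidHom.zero_apply]
      push_cast
      field_simp
      ring
  rw [← hA, ← hB]
  ring

end Two

end GroupDatum

namespace GroupDatum

variable {k : Type u} {G : Type v} [Field k] [Group G] {D : GroupDatum k G} [Finite G]

/-! ## Characters of the Green ring -/

variable (D) in
/-- A combination of the functionals `layerHom`. -/
def layerSum (x : G) (α : ℕ → k) : GreenRing k D.H →+ k :=
  ∑ s ∈ Finset.range D.n, α s • D.layerHom x s

theorem layerSum_apply (x : G) (α : ℕ → k) (z : GreenRing k D.H) :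
    D.layerSum x α z = ∑ s ∈ Finset.range D.n, α s * D.layerHom x s z := by
  simp [layerSum]

section Values

variable (hD : D.IsNonNilpotent) (U : FinRep k G) {r : ℕ} (h : D.Admissible U.ρ r)

theorem layerSum_blk (hr : r < D.n) (x : G) (α : ℕ → k) :
    D.layerSum x α (blk hD U h).green = α r * ((D.χ x : k) * U.ρ.character x) := by
  simp [layerSum_apply, layerHom_blk_of_lt hD U h hr, hr]

theorem layerSum_ind (x : G) (α : ℕ → k) : D.layerSum x α (ind hD U).green = 0 := by
  simp only [layerSum_apply, layerHom_ind, mul_zero, Finset.sum_const_zero]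

omit [Finite G] in
theorem char_trivRep (x : G) : (trivRep k G).ρ.character x = 1 := by
  change LinearMap.trace k k LinearMap.id = 1
  rw [LinearMap.trace_id, Module.finrank_self, Nat.cast_one]

theorem blk_trivRep_one (h1 : D.Admissible (trivRep k G).ρ 1) (hn : 1 < D.n) :
    (blk hD (trivRep k G) h1).green = 1 := by
  rw [GreenRing.one_eq]
  let f : (trivRep k G).ρ.IntertwiningMap (D.res (FDMod.trivial k D.H)) :=
    ⟨LinearMap.id (R := k) (M := k), fun x => by
      refine LinearMap.ext fun c => ?_
      refine Eq.trans ?_ (FDMod.trivial_smul (k := k) (A := D.H) (D.grp x) c).symm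
      rw [counit_grp]
      exact (one_mul (show k from c)).symm⟩
  obtain ⟨e⟩ := nonempty_blk_equiv_of_span (hD := hD) (h := h1) f
    (fun c => by
      rw [h1.yPow_eq_zero hn, LinearMap.zero_apply, map_zero, pow_one]
      refine (FDMod.trivial_smul (k := k) (A := D.H) D.y c).trans ?_
      rw [counit_y]
      exact zero_mul (show k from c))
    (fun p hp => by
      rw [eq_top_iff]
      exact fun c _ => hp c)
    (one_mul _).symm
  exact FDMod.green_eq e

theorem mem_of_forall_blk [IsAlgClosed k] [CharZero k] (S : AddSubgroup (GreenRing k D.H))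
    (hS : ∀ (U : FinRep k G) (r : ℕ) (h : D.Admissible U.ρ r), r < D.n → (blk hD U h).green ∈ S)
    (hS' : ∀ U : FinRep k G, (ind hD U).green ∈ S) (z : GreenRing k D.H) : z ∈ S := by
  have hS2 : ∀ (U : FinRep k G) (r : ℕ) (h : D.Admissible U.ρ r), (blk hD U h).green ∈ S := by
    intro U r h
    rcases h.le.lt_or_eq with hr | hr
    · exact hS U r h hr
    · subst hr
      exact hS' U
  obtain ⟨A, B, hA, hB, rfl⟩ := exists_eq_sum_blk hD z
  exact sum_mem fun i _ => sub_mem (hS2 _ _ _) (hS2 _ _ _)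

end Values

/-- The inverse of the character `χ`. -/
def chiInv (D : GroupDatum k G) : FinRep k G where
  carrier := k
  ρ :=
    { toFun := fun x => (((D.χ x)⁻¹ : kˣ) : k) • LinearMap.id
      map_one' := by
        rw [map_one, inv_one, Units.val_one, one_smul]
        rfl
      map_mul' := fun x x' => by
        rw [map_mul, mul_inv, Units.val_mul, mul_smul]
        rfl }

omit [Finite G] in
theorem char_chiInv (x : G) : D.chiInv.ρ.character x = (((D.χ x)⁻¹ : kˣ) : k) := by
  change LinearMap.trace k k ((((D.χ x)⁻¹ : kˣ) : k) • (LinearMap.id : k →ₗ[k] k)) = _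
  rw [map_smul, LinearMap.trace_id, Module.finrank_self, Nat.cast_one, smul_eq_mul, mul_one]

omit [Finite G] in
theorem chiInv_pow (hD : D.IsNonNilpotent) : D.chiInv.ρ (D.g ^ D.n) = 1 := by
  change (((D.χ (D.g ^ D.n))⁻¹ : kˣ) : k) • (LinearMap.id : k →ₗ[k] k) = _
  rw [map_pow, hD.chi_pow, inv_one, Units.val_one, one_smul k (LinearMap.id : k →ₗ[k] k)]
  rfl

omit [Finite G] in
theorem admissible_one {U : FinRep k G} (hU : U.ρ (D.g ^ D.n) = 1) (hn : 1 < D.n) :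
    D.Admissible U.ρ 1 := ⟨one_pos, hn.le, fun _ => hU⟩

omit [Finite G] in
theorem char_tensor (U V : FinRep k G) (x : G) :
    (U.tensor V).ρ.character x = U.ρ.character x * V.ρ.character x :=
  congrFun (Representation.char_tensor U.ρ V.ρ) x

/-! ### Multiplicativity of the layer sums -/

section Mul

variable [IsAlgClosed k] [CharZero k] (hD : D.IsNonNilpotent)

/-- The class of a uniserial module with `r + 1` layers, through tensor products with `two`. -/
theorem two_mul_blk (h2 : D.Admissible (trivRep k G).ρ 2) {r : ℕ} (hr : r + 2 < D.n)
    (h3 : D.Admissible (trivRep k G).ρ (r + 1)) (h4 : D.Admissible (trivRep k G).ρ (r + 2))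
    (h5 : D.Admissible (trivRep k G).ρ (r + 2 + 1)) (h1 : D.Admissible D.chiInv.ρ 1) :
    ∃ C C' : FinRep k G, (two hD h2).green * (blk hD (trivRep k G) h4).green =
      (blk hD (trivRep k G) h5).green +
        (blk hD D.chiInv h1).green * (blk hD (trivRep k G) h3).green +
        ((ind hD C).green - (ind hD C').green) := by
  -- No explicit decomposition of the tensor product is needed. Once all values of `layerHom` agree
  -- on the two sides, their difference is a combination of induced modules.
  obtain ⟨C, C', hC⟩ := exists_eq_ind_sub_ind hD
    ((two hD h2).green * (blk hD (trivRep k G) h4).green - (blk hD (trivRep k G) h5).green -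
      (blk hD D.chiInv h1).green * (blk hD (trivRep k G) h3).green) (fun x s => by
    by_cases hs : 0 < s ∧ s < D.n
    swap
    · rw [layerHom, if_neg hs, AddMonoidHom.zero_apply]
    have hc : (D.χ x : k) ≠ 0 := Units.ne_zero _
    rw [map_sub, map_sub, layerHom_two_mul hD h2 x hs.1 hs.2, blk_one_tensor_blk hD h1 h2.le h3
      (admissible_tensor (chiInv_pow hD) h3), layerHom_blk_of_lt hD _ _ hr,
      layerHom_blk_of_lt hD _ _ hr, layerHom_blk_of_lt hD _ _ (by omega : r + 1 < D.n), char_tensor,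
      char_trivRep, char_chiInv]
    rcases h5.le.lt_or_eq with hlt | heq
    · rw [layerHom_blk_of_lt hD _ _ hlt, char_trivRep]
      by_cases e1 : s = r + 1
      · subst e1
        simp
      · by_cases e2 : s = r + 2 + 1
        · subst e2
          simp
        · rw [if_neg (by omega), if_neg (by omega), if_neg e2, if_neg e1]
          simp
    -- If r + 3 = n, the longer block is itself induced and invisible to `layerHom`.
    · rw [blk_green_eq hD rfl heq h5 (D.admissible_n _), layerHom_ind]
      by_cases e1 : s = r + 1
      · subst e1
        simp
      · rw [if_neg (by omega), if_neg (by omega), if_neg e1]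
        simp)
  refine ⟨C, C', ?_⟩
  rw [← hC]
  abel

section Ring

variable (x : G) {α : ℕ → k} {t : k} (h0 : α 0 = 0) (h1 : α 1 = (((D.χ x)⁻¹ : kˣ) : k))
  (hrec : ∀ s, α (s + 2) + (((D.χ x)⁻¹ : kˣ) : k) * α s = t * α (s + 1)) (hn : α D.n = 0)

-- Summation by parts transfers the recurrence from the functionals to their coefficients, so α need
-- only be an eigenvector, with eigenvalue t, of the transposed path operator. The boundary terms
-- vanish because both α and `layerHom` are zero at 0 and at n.
include h0 hrec hn in
omit [IsAlgClosed k] [CharZero k] in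
theorem layerSum_two_mul (h2 : D.Admissible (trivRep k G).ρ 2) (z : GreenRing k D.H) :
    D.layerSum x α ((two hD h2).green * z) = t * D.layerSum x α z := by
  obtain ⟨m, hm⟩ : ∃ m, D.n = m + 1 := ⟨D.n - 1, by have := h2.le; omega⟩
  set L := fun s => D.layerHom x s z with hL
  have hL0 : L 0 = 0 := by simp only [hL, layerHom_zero, AddMonoidHom.zero_apply]
  have hLn : L (m + 1) = 0 := by
    simp only [hL, ← hm, layerHom_of_le x le_rfl, AddMonoidHom.zero_apply]
  have e1 : D.layerSum x α ((two hD h2).green * z) =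
      ∑ s ∈ Finset.range m, (α (s + 1) * L s + (((D.χ x)⁻¹ : kˣ) : k) * (α (s + 1) * L (s + 2))) := by
    rw [layerSum_apply, hm, Finset.sum_range_succ', h0, zero_mul, add_zero]
    refine Finset.sum_congr rfl fun s hs => ?_
    rw [Finset.mem_range] at hs
    rw [layerHom_two_mul (s := s + 1) hD h2 x (by omega) (by omega), Nat.add_sub_cancel]
    ring
  have e2 : t * D.layerSum x α z = ∑ s ∈ Finset.range m,
      (α (s + 2) * L (s + 1) + (((D.χ x)⁻¹ : kˣ) : k) * (α s * L (s + 1))) := by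
    rw [layerSum_apply, hm, Finset.sum_range_succ', h0, zero_mul, add_zero, Finset.mul_sum]
    refine Finset.sum_congr rfl fun s hs => ?_
    rw [← mul_assoc, ← hrec]
    ring
  have e3 := Finset.sum_range_succ (fun s => α (s + 1) * L s) m
  have e4 := Finset.sum_range_succ' (fun s => α (s + 1) * L s) m
  have e5 := Finset.sum_range_succ (fun s => α s * L (s + 1)) m
  have e6 := Finset.sum_range_succ' (fun s => α s * L (s + 1)) m
  rw [e4, hL0, mul_zero, add_zero, ← hm, hn, zero_mul, add_zero] at e3
  rw [e6, hLn, mul_zero, h0, zero_mul, add_zero, add_zero] at e5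
  rw [e1, e2, Finset.sum_add_distrib, Finset.sum_add_distrib, ← Finset.mul_sum, ← Finset.mul_sum]
  simp only [add_assoc, one_add_one_eq_two] at e3 e5 ⊢
  rw [e3, e5]

-- The left factors a with ψ(az) = ψ(a)ψ(z) for all z form a subring. It contains the induced
-- modules, for which both sides vanish, the one-layer modules, and `two`, by the eigenvector
-- property. `two_mul_blk` then yields the uniserial modules with trivial top by induction on
-- length, and tensoring these with one-layer modules yields every block.
include hD h0 h1 hrec hn in
theorem layerSum_mul (hn2 : 2 ≤ D.n) (a z : GreenRing k D.H) :
    D.layerSum x α (a * z) = D.layerSum x α a * D.layerSum x α z := by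
  set ψ := D.layerSum x α with hψ
  have hT1 : D.Admissible (trivRep k G).ρ 1 := admissible_trivRep one_pos (by omega)
  have hT2 : D.Admissible (trivRep k G).ρ 2 := admissible_trivRep two_pos hn2
  have hone : ψ 1 = 1 := by
    rw [← blk_trivRep_one hD hT1 hn2, hψ, layerSum_blk hD _ _ hn2, char_trivRep, h1]
    simp
  let S : Subring (GreenRing k D.H) :=
    { carrier := {a | ∀ z, ψ (a * z) = ψ a * ψ z}
      mul_mem' := fun {a b} ha hb z => by rw [mul_assoc, ha, hb, ha, mul_assoc]
      one_mem' := fun z => by rw [one_mul, hone, one_mul]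
      add_mem' := fun {a b} ha hb z => by rw [add_mul, map_add, ha, hb, map_add, add_mul]
      zero_mem' := fun z => by simp
      neg_mem' := fun {a} ha z => by rw [neg_mul, map_neg, ha, map_neg, neg_mul] }
  have hSind : ∀ U, (ind hD U).green ∈ S := by
    intro U z
    rw [hψ, layerSum_ind, zero_mul]
    refine GreenRing.mem_of_forall_green
      (AddMonoidHom.ker ((D.layerSum x α).comp (AddMonoidHom.mulLeft (ind hD U).green)))
      (fun M => ?_) z
    change D.layerSum x α ((ind hD U).green * M.green) = 0
    obtain ⟨e⟩ := ind_tensor hD U M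
    rw [FDMod.green_mul, ← FDMod.green_eq e, layerSum_ind]
  have hSone : ∀ (W : FinRep k G) (hW : D.Admissible W.ρ 1), (blk hD W hW).green ∈ S := by
    intro W hW z
    rw [hψ, layerSum_blk hD _ _ hn2, h1]
    refine mem_of_forall_blk hD (AddMonoidHom.eqLocus
      ((D.layerSum x α).comp (AddMonoidHom.mulLeft (blk hD W hW).green))
      ((AddMonoidHom.mulLeft
        ((((D.χ x)⁻¹ : kˣ) : k) * ((D.χ x : k) * W.ρ.character x))).comp (D.layerSum x α)))
      (fun U r h hr => ?_) (fun U => ?_) z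
    · change D.layerSum x α ((blk hD W hW).green * (blk hD U h).green) =
        _ * D.layerSum x α (blk hD U h).green
      rw [blk_one_tensor_blk hD hW hn2 h (admissible_tensor (hW.eq_one hn2) h),
        layerSum_blk hD _ _ hr, layerSum_blk hD _ _ hr, char_tensor]
      have hc : (D.χ x : k) ≠ 0 := Units.ne_zero _
      push_cast
      field_simp
    · change D.layerSum x α ((blk hD W hW).green * (ind hD U).green) =
        _ * D.layerSum x α (ind hD U).green
      rw [blk_one_tensor_blk hD hW hn2 _ (D.admissible_n _), layerSum_ind, layerSum_ind, mul_zero]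
  have hStwo : (two hD hT2).green ∈ S := by
    intro z
    have ht : ψ (two hD hT2).green = t := by
      rw [← mul_one (two hD hT2).green, hψ, layerSum_two_mul hD x h0 hrec hn, ← hψ, hone, mul_one]
    rw [ht, hψ, layerSum_two_mul hD x h0 hrec hn]
  have hStriv : ∀ (r : ℕ) (h : D.Admissible (trivRep k G).ρ r), r < D.n →
      (blk hD (trivRep k G) h).green ∈ S := by
    intro r
    induction r using Nat.strong_induction_on with
    | _ r ih =>
      intro h hr
      have hpos := h.pos
      rcases (by omega : r = 1 ∨ r = 2 ∨ 3 ≤ r) with rfl | rfl | h3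
      · exact hSone _ h
      · exact hStwo
      · obtain ⟨r, rfl⟩ : ∃ m, r = m + 2 + 1 := ⟨r - 3, by omega⟩
        obtain ⟨C, C', hC⟩ := two_mul_blk hD hT2 (r := r) (by omega)
          (admissible_trivRep (by omega) (by omega)) (admissible_trivRep (by omega) (by omega)) h
          (admissible_one (chiInv_pow hD) hn2)
        rw [add_assoc] at hC
        rw [← sub_eq_of_eq_add hC]
        exact sub_mem (mul_mem hStwo (ih _ (by omega) _ (by omega)))
          (add_mem (mul_mem (hSone _ _) (ih _ (by omega) _ (by omega)))
            (sub_mem (hSind C) (hSind C')))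
  refine mem_of_forall_blk hD S.toAddSubgroup (fun U r h hr => ?_) hSind a z
  have hU := admissible_one (h.eq_one hr) hn2
  have hr' : D.Admissible (trivRep k G).ρ r := admissible_trivRep h.pos h.le
  have e : (U.tensor (trivRep k G)).ρ.Equiv U.ρ := .mk (TensorProduct.rid k U) fun y => by
    refine FinRep.tensor_hom_ext fun u c => ?_
    change TensorProduct.rid k U (U.ρ y u ⊗ₜ[k] (show k from c)) =
      U.ρ y (TensorProduct.rid k U (u ⊗ₜ[k] (show k from c)))
    rw [TensorProduct.rid_tmul, TensorProduct.rid_tmul, map_smul]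
  have key := blk_one_tensor_blk hD hU hn2 hr' (admissible_tensor (h.eq_one hr) hr')
  rw [blk_green_congr hD e _ h] at key
  rw [← key]
  exact S.mul_mem (hSone U hU) (hStriv r hr' hr)

end Ring

end Mul

end GroupDatum

/-! ## Ring homomorphisms vanishing on the Jacobson radical -/

/-- An integral element of a field of characteristic zero which is inverse to an integer. -/
theorem isUnit_of_isIntegral_of_mul_eq_one {K : Type*} [Field K] [CharZero K] {u : K}
    (hu : IsIntegral ℤ u) {m : ℤ} (h : u * m = 1) : IsUnit m := by
  have hm : (m : K) ≠ 0 := right_ne_zero_of_mul_eq_one h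
  have h1 : u = algebraMap ℚ K ((m : ℚ)⁻¹) := by
    rw [map_inv₀, map_intCast]
    exact eq_inv_of_mul_eq_one_left h
  rw [h1, isIntegral_algebraMap_iff (algebraMap ℚ K).injective,
    IsIntegrallyClosed.isIntegral_iff] at hu
  obtain ⟨t, ht⟩ := hu
  have hm' : (m : ℚ) ≠ 0 := by
    intro h0
    exact hm (by rw [Int.cast_eq_zero.1 h0, Int.cast_zero])
  have h2 : m * t = 1 := by
    have h3 : (m : ℚ) * t = 1 := by
      rw [← eq_intCast (algebraMap ℤ ℚ) t, ht, mul_inv_cancel₀ hm']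
    exact_mod_cast h3
  exact IsUnit.of_mul_eq_one t h2

/-- A ring homomorphism to a field of characteristic zero with integral values kills the Jacobson
radical. -/
theorem map_eq_zero_of_mem_jacobson {R K : Type*} [Ring R] [Field K] [CharZero K] (f : R →+* K)
    (hf : ∀ x, IsIntegral ℤ (f x)) {x : R} (hx : x ∈ Ring.jacobson R) : f x = 0 := by
  by_contra h0
  -- Since f x ≠ 0, it is a root of an integer polynomial q with constant term m ≠ 0. Writing q = X
  -- · divX + m exhibits -m as divX(f x) · f x.
  obtain ⟨q, hq0, hq⟩ := (hf x).isAlgebraic.exists_nonzero_coeff_and_aeval_eq_zero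
    (mem_nonZeroDivisors_of_ne_zero h0)
  set m := q.coeff 0 with hm
  have h1 : Polynomial.aeval (f x) q.divX * f x = -(m : K) := by
    have := congrArg (Polynomial.aeval (f x)) (Polynomial.divX_mul_X_add q)
    rw [hq, map_add, map_mul, Polynomial.aeval_X, Polynomial.aeval_C] at this
    rw [eq_neg_iff_add_eq_zero]
    simpa using this
  have h2 : f (Polynomial.aeval x q.divX) = Polynomial.aeval (f x) q.divX := by
    rw [Polynomial.aeval_def, Polynomial.aeval_def, Polynomial.hom_eval₂]
    congr 1
    exact RingHom.ext_int _ _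
  rw [← Ideal.jacobson_bot, Ideal.mem_jacobson_iff] at hx
  -- With this multiplier, f maps the quasi-regularity relation to f z · (m² + 1) = 1. As f z is
  -- integral, m² + 1 would be a unit of ℤ, which is impossible for m ≠ 0.
  obtain ⟨z, hz⟩ := hx (-(m : R) * Polynomial.aeval x q.divX)
  rw [Ideal.mem_bot] at hz
  have h3 := congrArg f hz
  rw [map_sub, map_add, map_mul, map_mul, map_mul, h2, map_neg, map_intCast, map_one, map_zero,
    mul_assoc, mul_assoc, h1] at h3
  have h4 : f z * ((m * m + 1 : ℤ) : K) = 1 := by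
    push_cast
    linear_combination h3
  have h5 := isUnit_of_isIntegral_of_mul_eq_one (hf z) h4
  rw [Int.isUnit_iff] at h5
  have : 0 < m * m := mul_self_pos.2 hq0
  omega

/-- The eigenvalues of x are roots of unity, and the trace is their sum. -/
theorem Representation.isIntegral_character {k G V : Type*} [Field k] [IsAlgClosed k] [Group G]
    [Finite G] [AddCommGroup V] [Module k V] [Module.Finite k V] (ρ : Representation k G V)
    (x : G) : IsIntegral ℤ (ρ.character x) := by
  rw [Representation.character,
    Module.End.trace_eq_sum_roots_charpoly_of_splits (IsAlgClosed.splits _)]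
  refine IsIntegral.multiset_sum fun l hl => ?_
  have h1 := (Module.End.hasEigenvalue_iff_isRoot_charpoly _ _).2 (Polynomial.isRoot_of_mem_roots hl)
  obtain ⟨v, hv⟩ := h1.exists_hasEigenvector
  have h2 := hv.pow_apply (Nat.card G)
  rw [← map_pow, pow_card_eq_one', map_one, Module.End.one_apply] at h2
  have h3 : l ^ Nat.card G = 1 := by
    have h4 : (1 - l ^ Nat.card G) • v = 0 := by rw [sub_smul, one_smul, ← h2, sub_self]
    exact (sub_eq_zero.1 ((smul_eq_zero.1 h4).resolve_right hv.2)).symm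
  exact IsIntegral.of_pow Nat.card_pos (h3 ▸ isIntegral_one)

namespace GroupDatum

variable {k : Type u} {G : Type v} [Field k] [Group G] {D : GroupDatum k G} [Finite G]

/-! ### The trace of a group element -/

variable (D) in
/-- The trace of a group element, on the Green ring. -/
def traceHom (x : G) : GreenRing k D.H →+ k :=
  GreenRing.liftAdd (Quotient.lift (fun M : FDMod k D.H => (D.res M).character x)
    fun _ _ ⟨e⟩ => congrFun (Representation.char_iso (D.resEquiv e)) x)
    (fun M N => Representation.char_prod (D.res M) (D.res N) x)

theorem traceHom_green (x : G) (M : FDMod k D.H) : D.traceHom x M.green = (D.res M).character x :=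
  GreenRing.liftAdd_green _ _ M

omit [Finite G] in
theorem character_tensor [Finite G] (x : G) (M N : FDMod k D.H) :
    (D.res (M.tensor N)).character x = (D.res M).character x * (D.res N).character x := by
  have e : (D.res (M.tensor N)).Equiv ((D.res M).tprod (D.res N)) :=
    .mk (LinearEquiv.refl k (M ⊗[k] N)) fun y => by
      refine TensorProduct.ext' fun a b => ?_
      exact grp_smul_tmul M N y a b
  have h1 := congrFun (Representation.char_iso e) x
  rw [h1, Representation.char_tensor, Pi.mul_apply]

variable (D) in
/-- The trace of a group element is a ring homomorphism. -/
def traceRingHom (x : G) : GreenRing k D.H →+* k where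
  __ := D.traceHom x
  map_one' := by
    change D.traceHom x 1 = 1
    rw [GreenRing.one_eq, traceHom_green]
    have : D.res (FDMod.trivial k D.H) x = LinearMap.id := by
      refine LinearMap.ext fun c => ?_
      refine (FDMod.trivial_smul (k := k) (A := D.H) (D.grp x) c).trans ?_
      rw [counit_grp]
      exact one_mul (show k from c)
    rw [Representation.character, this, LinearMap.trace_id]
    change ((Module.finrank k k : ℕ) : k) = 1
    rw [Module.finrank_self, Nat.cast_one]
  map_mul' a b := by
    change D.traceHom x (a * b) = D.traceHom x a * D.traceHom x b
    refine GreenRing.mem_of_forall_green (AddMonoidHom.eqLocus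
      ((D.traceHom x).comp (AddMonoidHom.mulRight b))
      ((AddMonoidHom.mulRight (D.traceHom x b)).comp (D.traceHom x))) (fun M => ?_) a
    change D.traceHom x (M.green * b) = D.traceHom x M.green * D.traceHom x b
    refine GreenRing.mem_of_forall_green (AddMonoidHom.eqLocus
      ((D.traceHom x).comp (AddMonoidHom.mulLeft M.green))
      ((AddMonoidHom.mulLeft (D.traceHom x M.green)).comp (D.traceHom x))) (fun N => ?_) b
    change D.traceHom x (M.green * N.green) = D.traceHom x M.green * D.traceHom x N.green
    rw [FDMod.green_mul, traceHom_green, traceHom_green, traceHom_green, character_tensor]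

theorem traceHom_eq_zero_of_mem_jacobson [IsAlgClosed k] [CharZero k] {z : GreenRing k D.H}
    (hz : z ∈ Ring.jacobson (GreenRing k D.H)) (x : G) : D.traceHom x z = 0 := by
  refine map_eq_zero_of_mem_jacobson (D.traceRingHom x) (fun z => ?_) hz
  refine GreenRing.mem_of_forall_green
    ((integralClosure ℤ k).toSubring.toAddSubgroup.comap (D.traceHom x)) (fun M => ?_) z
  change IsIntegral ℤ (D.traceHom x M.green)
  rw [traceHom_green]
  exact Representation.isIntegral_character _ x

/-! ### The functionals `layerHom` -/

variable [IsAlgClosed k] [CharZero k]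

/-- Each 2n-th root of unity ξ with ξ² ≠ 1 gives a multiplicative layer sum with integral values,
which therefore kills z. Together these linear relations form a discrete sine transform of the
values of `layerHom` at z, and the transform is injective. -/
theorem layerHom_eq_zero_of_mem_jacobson (hD : D.IsNonNilpotent) (hn : 2 ≤ D.n)
    {z : GreenRing k D.H} (hz : z ∈ Ring.jacobson (GreenRing k D.H)) (x : G) (s : ℕ) :
    D.layerHom x s z = 0 := by
  -- A square root of χ(x)⁻¹ symmetrises the recurrence: a = ωξ and b = ωξ⁻¹ have product χ(x)⁻¹ for
  -- every ξ.
  obtain ⟨ω, hω⟩ := IsAlgClosed.exists_pow_nat_eq (((D.χ x)⁻¹ : kˣ) : k) two_pos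
  have hc : (D.χ x : k) ≠ 0 := Units.ne_zero _
  have hcn : (((D.χ x)⁻¹ : kˣ) : k) ^ D.n = 1 := by
    rw [← Units.val_pow_eq_pow_val, inv_pow, hD.chi_pow, inv_one, Units.val_one]
  have hω0 : ω ≠ 0 := by
    rintro rfl
    rw [zero_pow two_ne_zero] at hω
    exact Units.ne_zero _ hω.symm
  have hω2 : ω ^ (2 * D.n) = 1 := by rw [pow_mul, hω, hcn]
  have key : ∀ ξ : k, ξ ^ (2 * D.n) = 1 →
      ∑ s ∈ Finset.range D.n, ((ω * ξ) ^ s - (ω * ξ⁻¹) ^ s) * D.layerHom x s z = 0 := by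
    intro ξ hξ
    have hξ0 : ξ ≠ 0 := by
      rintro rfl
      rw [zero_pow (by omega)] at hξ
      exact zero_ne_one hξ
    set a := ω * ξ with ha
    set b := ω * ξ⁻¹ with hb
    by_cases hab : a = b
    · simp [hab]
    have hab' : a - b ≠ 0 := sub_ne_zero.2 hab
    have hprod : a * b = (((D.χ x)⁻¹ : kˣ) : k) := by
      rw [ha, hb, ← hω]
      field_simp
    have hai : IsIntegral ℤ a := by
      refine IsIntegral.of_pow (n := 2 * D.n) (by omega) ?_
      rw [ha, mul_pow, hω2, hξ, one_mul]
      exact isIntegral_one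
    have hbi : IsIntegral ℤ b := by
      refine IsIntegral.of_pow (n := 2 * D.n) (by omega) ?_
      rw [hb, mul_pow, hω2, inv_pow, hξ, inv_one, one_mul]
      exact isIntegral_one
    -- The factor χ(x)⁻¹ makes the layer sum equal to 1 at the unit. The value at n is zero because
    -- ξ^n = ξ^(-n).
    let α : ℕ → k := fun s => (((D.χ x)⁻¹ : kˣ) : k) * ((a ^ s - b ^ s) / (a - b))
    have hα0 : α 0 = 0 := by simp [α]
    have hα1 : α 1 = (((D.χ x)⁻¹ : kˣ) : k) := by simp [α, div_self hab']
    have hαr : ∀ s, α (s + 2) + (((D.χ x)⁻¹ : kˣ) : k) * α s = (a + b) * α (s + 1) := by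
      intro s
      simp only [α]
      rw [← hprod]
      field_simp
      ring
    have hαn : α D.n = 0 := by
      have : a ^ D.n = b ^ D.n := by
        rw [ha, hb, mul_pow, mul_pow, inv_pow]
        congr 1
        rw [two_mul, pow_add] at hξ
        exact eq_inv_of_mul_eq_one_left hξ
      simp [α, this]
    have hmul := layerSum_mul hD x hα0 hα1 hαr hαn hn
    have hone : D.layerSum x α 1 = 1 := by
      rw [← blk_trivRep_one hD (admissible_trivRep one_pos (by omega)) hn, layerSum_blk hD _ _ hn,
        char_trivRep, hα1]
      simp
    let f : GreenRing k D.H →+* k :=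
      { D.layerSum x α with
        map_one' := hone
        map_mul' := hmul }
    have hint : ∀ z, IsIntegral ℤ (f z) := by
      intro z
      refine mem_of_forall_blk hD
        ((integralClosure ℤ k).toSubring.toAddSubgroup.comap (D.layerSum x α))
        (fun U r h hr => ?_) (fun U => ?_) z
      · change IsIntegral ℤ (D.layerSum x α (blk hD U h).green)
        -- χ(x) α(r) is the quotient (a^r - b^r)/(a - b), an integer polynomial in the roots of
        -- unity a and b.
        have h1 : α r * (D.χ x * U.ρ.character x) =
            (∑ i ∈ Finset.range r, a ^ i * b ^ (r - 1 - i)) * U.ρ.character x := by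
          simp only [α]
          rw [← geom_sum₂_mul, mul_div_assoc, div_self hab']
          push_cast
          field_simp
        rw [layerSum_blk hD _ _ hr, h1]
        exact (IsIntegral.sum _ fun i _ => (hai.pow _).mul (hbi.pow _)).mul
          (Representation.isIntegral_character _ x)
      · change IsIntegral ℤ (D.layerSum x α (ind hD U).green)
        rw [layerSum_ind]
        exact isIntegral_zero
    have hz0 : D.layerSum x α z = 0 := map_eq_zero_of_mem_jacobson f hint hz
    rw [layerSum_apply] at hz0
    have h2 : ∑ s ∈ Finset.range D.n, α s * D.layerHom x s z = ((((D.χ x)⁻¹ : kˣ) : k) / (a - b)) *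
        ∑ s ∈ Finset.range D.n, (a ^ s - b ^ s) * D.layerHom x s z := by
      rw [Finset.mul_sum]
      refine Finset.sum_congr rfl fun s _ => ?_
      simp only [α]
      ring
    rw [h2] at hz0
    exact (mul_eq_zero.1 hz0).resolve_left (div_ne_zero (Units.ne_zero _) hab')
  by_cases hs : 0 < s ∧ s < D.n
  swap
  · rw [layerHom, if_neg hs, AddMonoidHom.zero_apply]
  let c : ℕ → k := fun s => ω ^ s * D.layerHom x s z
  -- ξ^n times the sum in `key` is the value of P at ξ. As P has degree below 2n and vanishes at all
  -- 2n-th roots of unity, it is zero. For s > 0 the exponents n + s and n - s are all distinct, so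
  -- each coefficient can be read off.
  let P : Polynomial k := ∑ s ∈ Finset.range D.n, Polynomial.C (c s) *
    (Polynomial.X ^ (D.n + s) - Polynomial.X ^ (D.n - s))
  have : NeZero (2 * D.n) := ⟨by omega⟩
  obtain ⟨ζ, hζ⟩ := HasEnoughRootsOfUnity.exists_primitiveRoot k (2 * D.n)
  have hP : P = 0 := by
    refine Polynomial.eq_zero_of_natDegree_lt_card_of_eval_eq_zero P (ι := Fin (2 * D.n))
      (f := fun i => ζ ^ (i : ℕ)) (fun i j hij => Fin.ext (hζ.pow_inj i.2 j.2 hij)) (fun i => ?_) ?_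
    · set ξ := ζ ^ (i : ℕ) with hξ
      have hξ1 : ξ ^ (2 * D.n) = 1 := by rw [hξ, ← pow_mul, mul_comm, pow_mul, hζ.pow_eq_one, one_pow]
      have hξ0 : ξ ≠ 0 := by
        intro h0
        rw [h0, zero_pow (by omega)] at hξ1
        exact zero_ne_one hξ1
      have h1 := congrArg (ξ ^ D.n * ·) (key ξ hξ1)
      simp only [mul_zero, Finset.mul_sum] at h1
      rw [← h1]
      simp only [P, Polynomial.eval_finsetSum]
      refine Finset.sum_congr rfl fun s hs => ?_
      rw [Finset.mem_range] at hs
      have h2 : ξ ^ (D.n - s) = ξ ^ D.n * ξ⁻¹ ^ s := by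
        rw [inv_pow, eq_mul_inv_iff_mul_eq₀ (pow_ne_zero _ hξ0), ← pow_add,
          Nat.sub_add_cancel hs.le]
      simp only [Polynomial.eval_mul, Polynomial.eval_C, Polynomial.eval_sub, Polynomial.eval_pow,
        Polynomial.eval_X, c, h2, mul_pow]
      ring
    · rw [Fintype.card_fin]
      refine lt_of_le_of_lt (Polynomial.natDegree_sum_le_of_forall_le (n := 2 * D.n - 1) _ _
        fun s hs => ?_) (by omega)
      rw [Finset.mem_range] at hs
      refine (Polynomial.natDegree_C_mul_le _ _).trans ((Polynomial.natDegree_sub_le _ _).trans ?_)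
      rw [Polynomial.natDegree_X_pow, Polynomial.natDegree_X_pow]
      omega
  have h1 := congrArg (Polynomial.coeff · (D.n + s)) hP
  simp only [P, Polynomial.finsetSum_coeff, Polynomial.coeff_C_mul, Polynomial.coeff_sub,
    Polynomial.coeff_X_pow, Polynomial.coeff_zero] at h1
  rw [Finset.sum_eq_single s (fun t ht hts => by
    rw [if_neg (by omega), if_neg (by omega), sub_self, mul_zero])
    (fun h => absurd (Finset.mem_range.2 hs.2) h), if_pos rfl, if_neg (by omega), sub_zero,
    mul_one] at h1
  exact (mul_eq_zero.1 h1).resolve_left (pow_ne_zero _ hω0)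

end GroupDatum

/-! ## The Grothendieck ring -/

section Grothendieck

variable {k : Type u} {A : Type v} [Field k] [Ring A] [HopfAlgebra k A]

theorem FDMod.IsExtension.grothendieck_eq {X Y Z : FDMod k A} (h : FDMod.IsExtension X Y Z) :
    greenToGrothendieck k A Y.green =
      greenToGrothendieck k A X.green + greenToGrothendieck k A Z.green := by
  refine (Ideal.Quotient.eq.2 ?_).trans (map_add (Ideal.Quotient.mk (grothendieckIdeal k A)) _ _)
  exact AddSubgroup.subset_closure ⟨X, Y, Z, h, (sub_sub _ _ _).symm⟩

/-- A map additive on short exact sequences vanishes on the kernel of the map to the Grothendieck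
ring. -/
theorem GreenRing.eq_zero_of_grothendieck_eq_zero {B : Type*} [AddCommGroup B]
    (F : GreenRing k A →+ B)
    (hF : ∀ X Y Z : FDMod k A, FDMod.IsExtension X Y Z → F Y.green = F X.green + F Z.green)
    {z : GreenRing k A} (hz : greenToGrothendieck k A z = 0) : F z = 0 := by
  obtain ⟨z, rfl⟩ := Ideal.Quotient.mk_surjective z
  have hz' : z ∈ AddSubgroup.closure (exactRelations k A) := Ideal.Quotient.eq_zero_iff_mem.1 hz
  have : AddSubgroup.closure (exactRelations k A) ≤
      (F.comp (Ideal.Quotient.mk (greenIdeal k A)).toAddMonoidHom).ker := by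
    rw [AddSubgroup.closure_le]
    rintro _ ⟨X, Y, Z, h, rfl⟩
    change F (Ideal.Quotient.mk (greenIdeal k A) (Y.free - X.free - Z.free)) = 0
    rw [map_sub, map_sub, map_sub, map_sub, sub_sub, sub_eq_zero]
    exact hF X Y Z h
  exact this hz'

theorem FDMod.IsExtension.green_eq_of_projective {X Y Z : FDMod k A} (h : FDMod.IsExtension X Y Z)
    [Module.Projective A Z] : Y.green = X.green + Z.green := by
  obtain ⟨f, g, hf, hfg, hg⟩ := h
  obtain ⟨s, hs⟩ := Module.projective_lifting_property g LinearMap.id hg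
  rw [← FDMod.green_directSum]
  exact FDMod.green_eq (M := Y) (N := X.directSum Z) (hfg.splitSurjectiveEquiv hf ⟨s, hs⟩).1

theorem FDMod.isExtension_ofSub {M : FDMod k A} (p : Submodule A M) :
    FDMod.IsExtension (FDMod.ofSub p) M (FDMod.quot p) :=
  ⟨p.subtype, p.mkQ, p.injective_subtype, LinearMap.exact_subtype_mkQ p, p.mkQ_surjective⟩

/-- The transpose of a homomorphism. -/
def FDMod.dualMap {M N : FDMod k A} (f : M →ₗ[A] N) : N.dual →ₗ[A] M.dual :=
  FDMod.homOfLinear (M := N.dual) (N := M.dual) (f.restrictScalars k).dualMap fun a b => by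
    refine LinearMap.ext fun (x : M) => ?_
    exact congrArg (show Module.Dual k N from b) (map_smul f (HopfAlgebra.antipode k a) x).symm

theorem FDMod.IsExtension.dual {X Y Z : FDMod k A} (h : FDMod.IsExtension X Y Z) :
    FDMod.IsExtension Z.dual Y.dual X.dual := by
  obtain ⟨f, g, hf, hfg, hg⟩ := h
  refine ⟨FDMod.dualMap g, FDMod.dualMap f,
    LinearMap.dualMap_injective_of_surjective (f := g.restrictScalars k) hg, ?_,
    LinearMap.dualMap_surjective_of_injective (f := f.restrictScalars k) hf⟩
  intro b
  constructor
  · intro hb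
    have h1 : LinearMap.ker (g.restrictScalars k) ≤ LinearMap.ker (show Module.Dual k Y from b) := by
      intro y hy
      obtain ⟨x, rfl⟩ := (hfg y).1 hy
      exact LinearMap.congr_fun hb x
    have h2 : (show Module.Dual k Y from b) ∈ LinearMap.range (g.restrictScalars k).dualMap := by
      rw [LinearMap.range_dualMap_eq_dualAnnihilator_ker, Submodule.mem_dualAnnihilator]
      exact fun y hy => h1 hy
    exact h2
  · rintro ⟨c, rfl⟩
    refine LinearMap.ext fun (x : X) => ?_
    change (show Module.Dual k Z from c) (g (f x)) = 0
    rw [hfg.apply_apply_eq_zero, map_zero]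

/-- Homomorphisms from a projective module are exact. -/
theorem FDMod.IsExtension.finrank_hom {X Y Z : FDMod k A} (h : FDMod.IsExtension X Y Z)
    (P : FDMod k A) [Module.Projective A P] : Module.finrank k (P →ₗ[A] Y) =
      Module.finrank k (P →ₗ[A] X) + Module.finrank k (P →ₗ[A] Z) := by
  obtain ⟨f, g, hf, hfg, hg⟩ := h
  have := FDMod.finite_hom P X
  have := FDMod.finite_hom P Y
  have := FDMod.finite_hom P Z
  let F : (P →ₗ[A] X) →ₗ[k] (P →ₗ[A] Y) :=
    { toFun := fun a => f ∘ₗ a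
      map_add' := fun a b => LinearMap.comp_add _ _ _
      map_smul' := fun c a => LinearMap.ext fun x => (f.restrictScalars k).map_smul c (a x) }
  let F' : (P →ₗ[A] Y) →ₗ[k] (P →ₗ[A] Z) :=
    { toFun := fun a => g ∘ₗ a
      map_add' := fun a b => LinearMap.comp_add _ _ _
      map_smul' := fun c a => LinearMap.ext fun x => (g.restrictScalars k).map_smul c (a x) }
  have hF : Function.Injective F := fun a b hab => LinearMap.ext fun x => hf (LinearMap.congr_fun hab x)
  have hF' : Function.Surjective F' := fun a => by
    obtain ⟨b, hb⟩ := Module.projective_lifting_property g a hg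
    exact ⟨b, hb⟩
  have hFF : LinearMap.ker F' = LinearMap.range F := by
    ext a
    constructor
    · intro ha
      have ha' : ∀ x, a x ∈ LinearMap.range f := fun x => (hfg _).1 (LinearMap.congr_fun ha x)
      refine ⟨(LinearEquiv.ofInjective f hf).symm.toLinearMap ∘ₗ a.codRestrict _ ha', ?_⟩
      refine LinearMap.ext fun x => ?_
      exact congrArg Subtype.val ((LinearEquiv.ofInjective f hf).apply_symm_apply ⟨a x, ha' x⟩)
    · rintro ⟨b, rfl⟩
      exact LinearMap.ext fun x => hfg.apply_apply_eq_zero _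
  rw [← F'.finrank_range_add_finrank_ker, hFF, LinearMap.finrank_range_of_inj hF,
    LinearMap.range_eq_top.2 hF', finrank_top, add_comm]

end Grothendieck

namespace GroupDatum

variable {k : Type u} {G : Type v} [Field k] [Group G] {D : GroupDatum k G} [Finite G]

/-! ### The bilinear form -/

theorem hom_dual_smul {M N : FDMod k D.H} (f : M →ₗ[D.H] N.dual) (a : D.H) (m : M) (n : N) :
    (show Module.Dual k N from f (a • m)) n =
      (show Module.Dual k N from f m) (HopfAlgebra.antipode k a • n) := by
  rw [map_smul]
  rfl

/-- The symmetry of the bilinear form, on homomorphisms. -/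
def homDualSwap (M N : FDMod k D.H) : (M →ₗ[D.H] N.dual) →ₗ[k] (N →ₗ[D.H] M.dual) where
  -- The flip of the pairing alone is equivariant only up to S², which is conjugation by g. Acting
  -- first by g⁻¹ corrects this.
  toFun f := D.homOfGen (N := N) (N' := M.dual)
    (show N →ₗ[k] Module.Dual k M from
      ((show M →ₗ[k] Module.Dual k N from f.restrictScalars k) ∘ₗ M.rep (D.grp D.g⁻¹)).flip)
    (fun n => by
      refine LinearMap.ext fun (m : M) => ?_
      change (show Module.Dual k N from f (D.grp D.g⁻¹ • m)) (D.y • n) =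
        (show Module.Dual k N from f (D.grp D.g⁻¹ • (HopfAlgebra.antipode k D.y • m))) n
      rw [← mul_smul, hom_dual_smul, hom_dual_smul, HopfAlgebra.antipode_mul_antidistrib, antipode_y,
        map_neg, HopfAlgebra.antipode_mul_antidistrib, antipode_y, antipode_grp, inv_inv, ← mul_smul,
        mul_neg, neg_neg, mul_assoc, mul_assoc, ← map_mul, inv_mul_cancel, map_one, mul_one])
    (fun x n => by
      refine LinearMap.ext fun (m : M) => ?_
      change (show Module.Dual k N from f (D.grp D.g⁻¹ • m)) (D.grp x • n) =
        (show Module.Dual k N from f (D.grp D.g⁻¹ • (HopfAlgebra.antipode k (D.grp x) • m))) n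
      rw [← mul_smul, hom_dual_smul, hom_dual_smul, antipode_grp, antipode_grp, ← map_mul,
        antipode_grp, mul_inv_rev, inv_inv, inv_inv, ← mul_smul, ← map_mul, g_comm])
  map_add' f f' := by
    refine LinearMap.ext fun n => LinearMap.ext fun (m : M) => ?_
    rfl
  map_smul' c f := by
    refine LinearMap.ext fun n => LinearMap.ext fun (m : M) => ?_
    rfl

theorem homDualSwap_injective (M N : FDMod k D.H) : Function.Injective (homDualSwap M N) := by
  rw [injective_iff_map_eq_zero]
  intro f hf
  refine LinearMap.ext fun m => LinearMap.ext fun (n : N) => ?_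
  have h1 : (show Module.Dual k M from homDualSwap M N f n) (D.grp D.g • m) = 0 := by
    rw [hf]
    rfl
  change (show Module.Dual k N from f (D.grp D.g⁻¹ • D.grp D.g • m)) n = 0 at h1
  rwa [← mul_smul, ← map_mul, inv_mul_cancel, map_one, one_smul] at h1

/-- The swap is injective in both directions. Hence the form is symmetric. -/
theorem finrank_hom_dual_comm (M N : FDMod k D.H) :
    Module.finrank k (M →ₗ[D.H] N.dual) = Module.finrank k (N →ₗ[D.H] M.dual) := by
  have := FDMod.finite_hom M N.dual
  have := FDMod.finite_hom N M.dual
  exact le_antisymm (LinearMap.finrank_le_finrank_of_injective (homDualSwap_injective M N))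
    (LinearMap.finrank_le_finrank_of_injective (homDualSwap_injective N M))

theorem character_dual (M : FDMod k D.H) (x : G) :
    (D.res M.dual).character x = (D.res M).character x⁻¹ := by
  have h : D.res M.dual = (D.res M).dual := by
    refine MonoidHom.ext fun y => LinearMap.ext fun f => LinearMap.ext fun (m : M) => ?_
    refine (FDMod.dual_smul_apply M (D.grp y) f m).trans ?_
    rw [antipode_grp]
    rfl
  rw [h]
  exact Representation.char_dual (D.res M) x

/-- By symmetry, pairing with a projective P is X ↦ dim Hom(P, X*). Duality and Hom(P, -) are both
exact, so the pairing factors through G₀. -/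
theorem greenForm_eq_zero_of_grothendieck_eq_zero {z : GreenRing k D.H}
    (hz : greenToGrothendieck k D.H z = 0) {t : GreenRing k D.H} (ht : t ∈ projectiveSpan k D.H) :
    greenForm k D.H z t = 0 := by
  induction ht using AddSubgroup.closure_induction with
  | zero => simp
  | add x y _ _ hx hy => rw [map_add, hx, hy, add_zero]
  | neg x _ hx => rw [map_neg, hx, neg_zero]
  | mem t ht =>
    obtain ⟨P, -, hP, rfl⟩ := ht
    refine GreenRing.eq_zero_of_grothendieck_eq_zero ((greenForm k D.H).flip P.green)
      (fun X Y Z h => ?_) hz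
    rw [AddMonoidHom.flip_apply, AddMonoidHom.flip_apply, AddMonoidHom.flip_apply,
      greenForm_green, greenForm_green, greenForm_green, finrank_hom_dual_comm Y,
      finrank_hom_dual_comm X, finrank_hom_dual_comm Z, h.dual.finrank_hom P, Nat.cast_add,
      add_comm]

/-- Write z = [M] - [N]. Pairing with the module induced from V computes dim Hom_G(V, M*) - dim
Hom_G(V, N*), so orthogonality makes M* and N* isomorphic over G, and M and N have equal traces. -/
theorem traceHom_eq_zero_of_mem_greenOrthogonal [CharZero k] (hD : D.IsNonNilpotent)
    {z : GreenRing k D.H} (hz : z ∈ greenOrthogonal (projectiveSpan k D.H)) (x : G) :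
    D.traceHom x z = 0 := by
  obtain ⟨M, N, rfl⟩ := GreenRing.exists_sub z
  obtain ⟨e⟩ := Representation.nonempty_equiv_of_finrank_hom (D.res M.dual) (D.res N.dual)
    (fun U _ _ _ τ => by
      let V : FinRep k G := { carrier := U, ρ := τ }
      have h1 := hz _ (FDMod.green_mem_projectiveSpan (ind hD V) (ind_projective hD V))
      rw [map_sub, AddMonoidHom.sub_apply, greenForm_green, greenForm_green, finrank_hom_dual_comm,
        finrank_hom_dual_comm N, finrank_ind_hom, finrank_ind_hom, sub_eq_zero] at h1
      exact_mod_cast h1)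
  have h2 := congrFun (Representation.char_iso e) x⁻¹
  rw [character_dual, character_dual, inv_inv] at h2
  rw [map_sub, traceHom_green, traceHom_green, h2, sub_self]

/-! ### Projective modules -/

/-- P is a direct summand of the module induced from its own restriction, and an induced module
tensored with M is again induced (`ind_tensor`). -/
theorem tensor_projective [CharZero k] (hD : D.IsNonNilpotent) (P M : FDMod k D.H)
    [Module.Projective D.H P] : Module.Projective D.H (P.tensor M) := by
  let π : ind hD (D.resRep P) →ₗ[D.H] P := indLift hD (U := D.resRep P) (.id (D.res P))
  have hπ : Function.Surjective π := fun x => ⟨inc hD (D.resRep P) (D.admissible_n _) x,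
    blkLift_inc (U := D.resRep P) (.id (D.res P)) _ x⟩
  obtain ⟨s, hs⟩ := Module.projective_lifting_property π LinearMap.id hπ
  obtain ⟨e⟩ := ind_tensor hD (D.resRep P) M
  have := ind_projective hD ((D.resRep P).tensor (D.resRep M))
  have : Module.Projective D.H ((ind hD (D.resRep P)).tensor M) := Module.Projective.of_equiv e
  refine Module.Projective.of_split (FDMod.tensorMap s LinearMap.id)
    (FDMod.tensorMap π LinearMap.id) (LinearMap.ext fun t => ?_)
  have h1 : (FDMod.tensorMap π (LinearMap.id (M := M))).restrictScalars k ∘ₗ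
      (FDMod.tensorMap s (LinearMap.id (M := M))).restrictScalars k = LinearMap.id := by
    refine TensorProduct.ext' fun a b => ?_
    change (π (s a) ⊗ₜ[k] b : P ⊗[k] M) = a ⊗ₜ b
    rw [show π (s a) = a from LinearMap.congr_fun hs a]
  exact LinearMap.congr_fun h1 t

/-- For a projective P the module P ⊗ Z is projective, so tensoring with P splits every short exact
sequence X → Y → Z. Multiplication by [P] therefore kills all relations of G₀. -/
theorem projectiveSpan_mul_eq_zero [CharZero k] (hD : D.IsNonNilpotent) {t z : GreenRing k D.H}
    (ht : t ∈ projectiveSpan k D.H) (hz : greenToGrothendieck k D.H z = 0) : t * z = 0 := by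
  induction ht using AddSubgroup.closure_induction with
  | zero => simp
  | add x y _ _ hx hy => rw [add_mul, hx, hy, add_zero]
  | neg x _ hx => rw [neg_mul, hx, neg_zero]
  | mem t ht =>
    obtain ⟨P, -, hP, rfl⟩ := ht
    refine GreenRing.eq_zero_of_grothendieck_eq_zero (AddMonoidHom.mulLeft P.green)
      (fun X Y Z h => ?_) hz
    have := tensor_projective hD P Z
    simp only [AddMonoidHom.coe_mulLeft, FDMod.green_mul]
    exact (h.tensor_left P).green_eq_of_projective

theorem mem_jacobson_of_mem_projectiveSpan [CharZero k] (hD : D.IsNonNilpotent)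
    {z : GreenRing k D.H} (hP : z ∈ projectiveSpan k D.H) (hz : greenToGrothendieck k D.H z = 0) :
    z ∈ Ring.jacobson (GreenRing k D.H) := by
  rw [← Ideal.jacobson_bot, Ideal.mem_jacobson_iff]
  intro r
  have h1 : z * (r * z) = 0 := projectiveSpan_mul_eq_zero hD hP (by rw [map_mul, hz, mul_zero])
  -- The product (1 - rz)(1 + rz) equals 1, since z r z = 0.
  refine ⟨1 - r * z, ?_⟩
  rw [Ideal.mem_bot]
  have h2 : (1 - r * z) * r * z + (1 - r * z) - 1 = -(r * (z * (r * z))) := by noncomm_ring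
  rw [h2, h1, mul_zero, neg_zero]

/-! ### Modules with the same restriction -/

variable [IsAlgClosed k] [CharZero k]

omit [IsAlgClosed k] [Finite G] [CharZero k] in
theorem IsExtension.character_eq {X Y Z : FDMod k D.H} (h : FDMod.IsExtension X Y Z) :
    (D.res Y).character = (D.res X).character + (D.res Z).character := by
  obtain ⟨f, g, hf, hfg, hg⟩ := h
  funext x
  exact LinearMap.trace_eq_add_of_exact (i := f.restrictScalars k) (f := g.restrictScalars k)
    hf hfg hg (fun a => map_smul f (D.grp x) a) (fun a => map_smul g (D.grp x) a)

omit [IsAlgClosed k] [Finite G] in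
theorem finrank_eq_of_character_eq {M N : FDMod k D.H}
    (h : (D.res M).character = (D.res N).character) : Module.finrank k M = Module.finrank k N := by
  have h1 := congrFun h 1
  rw [Representation.char_one, Representation.char_one] at h1
  exact_mod_cast h1

omit [IsAlgClosed k] [CharZero k] in
theorem green_eq_blk_one (hD : D.IsNonNilpotent) (hn : 2 ≤ D.n) (M : FDMod k D.H)
    (hy : ∀ x : M, D.y • x = 0) (h : D.Admissible (D.resRep M).ρ 1) :
    M.green = (blk hD (D.resRep M) h).green := by
  obtain ⟨e⟩ := nonempty_blk_equiv_of_span (hD := hD) (h := h) (M := M) (.id (D.res M))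
    (fun u => by
      rw [h.yPow_eq_zero hn, pow_one]
      exact hy u)
    (fun p hp => eq_top_iff.2 fun x _ => hp x) (one_mul _).symm
  exact (FDMod.green_eq e).symm

/-- The kernel of `y`, as a submodule. -/
def kerYSub (M : FDMod k D.H) : Submodule D.H M where
  __ := kerY M 1
  smul_mem' a x hx := by
    change a • x ∈ kerY M 1
    have hx' : x ∈ kerY M 1 := hx
    clear hx
    induction a using D.induction generalizing x with
    | hs c =>
      rw [algebraMap_smul]
      exact Submodule.smul_mem _ c hx'
    | hy =>
      rw [mem_kerY, pow_one] at hx' ⊢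
      rw [hx', smul_zero]
    | hg h => exact grp_smul_mem_kerY h hx'
    | hadd a b ha hb =>
      rw [add_smul]
      exact Submodule.add_mem _ (ha x hx') (hb x hx')
    | hmul a b ha hb =>
      rw [mul_smul]
      exact ha _ (hb x hx')

-- Here g^n = 1 on M, so y is nilpotent and has nonzero kernel when M ≠ 0. Filtering repeatedly by
-- ker y replaces M in G₀ by modules on which y is zero, and complete reducibility over G assembles
-- these into the restriction of M.
omit [IsAlgClosed k] in
theorem grothendieck_eq_blk_one (hD : D.IsNonNilpotent) (hn : 2 ≤ D.n) (M : FDMod k D.H)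
    (h : D.Admissible (D.resRep M).ρ 1) :
    greenToGrothendieck k D.H M.green =
      greenToGrothendieck k D.H (blk hD (D.resRep M) h).green := by
  induction hd : Module.finrank k M using Nat.strong_induction_on generalizing M with
  | _ d ih =>
    rcases subsingleton_or_nontrivial M with h0 | h0
    · have : Subsingleton (D.resRep M) := h0
      rw [FDMod.green_of_subsingleton, blk_green_of_subsingleton]
    have hM : ∀ x : M, D.grp (D.g ^ D.n) • x = x := LinearMap.congr_fun (h.eq_one hn)
    set p := kerYSub M with hp
    have hext := FDMod.isExtension_ofSub p
    have hX : D.Admissible (D.resRep (FDMod.ofSub p)).ρ 1 :=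
      admissible_one (LinearMap.ext fun x => Subtype.ext (hM x.1)) hn
    have hZ : D.Admissible (D.resRep (FDMod.quot p)).ρ 1 := by
      refine admissible_one (LinearMap.ext fun x => ?_) hn
      obtain ⟨x, rfl⟩ := p.mkQ_surjective x
      exact (map_smul p.mkQ (D.grp (D.g ^ D.n)) x).symm.trans (congrArg p.mkQ (hM x))
    have hch := IsExtension.character_eq hext
    obtain ⟨e⟩ := Representation.nonempty_equiv_of_character_eq (D.resRep M).ρ
      ((D.resRep (FDMod.ofSub p)).prod (D.resRep (FDMod.quot p))).ρ (by
        funext x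
        exact (congrFun hch x).trans (Representation.char_prod _ _ x).symm)
    have hne : 0 < Module.finrank k (FDMod.ofSub p) := by
      rw [Module.finrank_pos_iff]
      by_contra hns
      rw [not_nontrivial_iff_subsingleton] at hns
      have hinj : ∀ x : M, D.y • x = 0 → x = 0 := by
        intro x hx
        have hx' : x ∈ p := by
          change D.y ^ 1 • x = 0
          rw [pow_one, hx]
        exact congrArg Subtype.val (hns.elim ⟨x, hx'⟩ 0)
      have hinj' : ∀ (i : ℕ) (x : M), D.y ^ i • x = 0 → x = 0 := by
        intro i
        induction i with
        | zero => simp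
        | succ i ih =>
          intro x hx
          rw [pow_succ, mul_smul] at hx
          exact hinj _ (ih _ hx)
      obtain ⟨x, hx⟩ := exists_ne (0 : M)
      refine hx (hinj' D.n x ?_)
      rw [y_pow_n_smul]
      simp [yPow, hM, -map_pow]
    have hlt : Module.finrank k (FDMod.quot p) < d := by
      have h1 := congrFun hch 1
      rw [Pi.add_apply, Representation.char_one, Representation.char_one,
        Representation.char_one] at h1
      have h2 : Module.finrank k M = Module.finrank k (FDMod.ofSub p) +
        Module.finrank k (FDMod.quot p) := by exact_mod_cast h1
      omega
    rw [hext.grothendieck_eq, blk_green_congr hD e h (hX.prod hZ), blk_green_prod, map_add,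
      ih _ hlt (FDMod.quot p) hZ rfl, green_eq_blk_one hD hn (FDMod.ofSub p) (fun x => ?_) hX]
    refine Subtype.ext ?_
    have : D.y ^ 1 • x.1 = 0 := x.2
    rwa [pow_one] at this

omit [IsAlgClosed k] [CharZero k] [Finite G] in
/-- Restricting an equivalence to stable subspaces. -/
theorem _root_.Representation.Equiv.nonempty_restrict {V W : Type*} [AddCommGroup V] [Module k V]
    [AddCommGroup W] [Module k W] {ρ : Representation k G V} {σ : Representation k G W}
    (e : ρ.Equiv σ) {p : Submodule k V} {q : Submodule k W} (hp : ∀ x, p ≤ p.comap (ρ x))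
    (hq : ∀ x, q ≤ q.comap (σ x)) (h : ∀ x, x ∈ p ↔ e x ∈ q) :
    Nonempty ((ρ.subrepresentation p hp).Equiv (σ.subrepresentation q hq)) := by
  have hpq : p.map e.toLinearEquiv.toLinearMap = q := by
    ext y
    rw [Submodule.mem_map]
    constructor
    · rintro ⟨x, hx, rfl⟩
      exact (h x).1 hx
    · intro hy
      refine ⟨e.toLinearEquiv.symm y, (h _).2 ?_, e.toLinearEquiv.apply_symm_apply y⟩
      have : e (e.toLinearEquiv.symm y) = y := e.toLinearEquiv.apply_symm_apply y
      rwa [this]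
  exact ⟨.mk ((e.toLinearEquiv.submoduleMap p).trans (LinearEquiv.ofEq _ _ hpq)) fun x => by
    refine LinearMap.ext fun y => Subtype.ext ?_
    exact e.map_rep x y.1⟩

omit [IsAlgClosed k] [CharZero k] in
theorem character_ofSub_eq {M N : FDMod k D.H} (e : (D.res M).Equiv (D.res N))
    {p : Submodule D.H M} {q : Submodule D.H N} (h : ∀ x, x ∈ p ↔ e x ∈ q) :
    (D.res (FDMod.ofSub p)).character = (D.res (FDMod.ofSub q)).character := by
  obtain ⟨e'⟩ := e.nonempty_restrict (p := p.restrictScalars k) (q := q.restrictScalars k)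
    (fun x _ hy => p.smul_mem (D.grp x) hy) (fun x _ hy => q.smul_mem (D.grp x) hy) h
  exact Representation.char_iso e'

/-- If ν = 1, the class in G₀ is that of the restriction with y acting as zero. If ν = l^n ≠ 1, both
modules are induced from their l-eigenspaces of g, and an equivalence over G matches these
eigenspaces. -/
theorem grothendieck_eq_of_scalar (hD : D.IsNonNilpotent) (hn : 2 ≤ D.n) {M N : FDMod k D.H}
    (e : (D.res M).Equiv (D.res N)) (ν : k) (hM : ∀ x : M, D.grp (D.g ^ D.n) • x = ν • x)
    (hN : ∀ x : N, D.grp (D.g ^ D.n) • x = ν • x) :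
    greenToGrothendieck k D.H M.green = greenToGrothendieck k D.H N.green := by
  by_cases h1 : ν = 1
  · subst h1
    have hM' : D.Admissible (D.resRep M).ρ 1 :=
      admissible_one (LinearMap.ext fun x => (hM x).trans (one_smul k x)) hn
    have hN' : D.Admissible (D.resRep N).ρ 1 :=
      admissible_one (LinearMap.ext fun x => (hN x).trans (one_smul k x)) hn
    rw [grothendieck_eq_blk_one hD hn M hM', grothendieck_eq_blk_one hD hn N hN',
      blk_green_congr hD (U := D.resRep M) (V := D.resRep N) e hM' hN']
  · obtain ⟨l, rfl⟩ := IsAlgClosed.exists_pow_nat_eq ν D.n_pos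
    obtain ⟨eM⟩ := nonempty_ind_gEigen_equiv hD M h1 hM
    obtain ⟨eN⟩ := nonempty_ind_gEigen_equiv hD N h1 hN
    obtain ⟨e'⟩ := e.nonempty_restrict (p := (D.resEnd M D.g).eigenspace l)
      (q := (D.resEnd N D.g).eigenspace l) (gEigen_le M l) (gEigen_le N l) (fun x => by
        rw [Module.End.mem_eigenspace_iff, Module.End.mem_eigenspace_iff, ← e.map_rep,
          ← map_smul]
        exact e.toLinearEquiv.injective.eq_iff.symm)
    rw [← FDMod.green_eq eM, ← FDMod.green_eq eN,
      blk_green_congr hD (U := gEigen M l) (V := gEigen N l) e' (D.admissible_n _)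
        (D.admissible_n _)]

/-- The kernel and range of g^n - ν are determined by the action of G, so M and N split compatibly.
The kernels fall under the scalar case, and the ranges are smaller because ν is an eigenvalue on M.
-/
theorem grothendieck_eq_of_character_eq (hD : D.IsNonNilpotent) (hn : 2 ≤ D.n) (M N : FDMod k D.H)
    (h : (D.res M).character = (D.res N).character) :
    greenToGrothendieck k D.H M.green = greenToGrothendieck k D.H N.green := by
  induction hd : Module.finrank k M using Nat.strong_induction_on generalizing M N with
  | _ d ih =>
    have hMN := finrank_eq_of_character_eq h
    rcases subsingleton_or_nontrivial M with h0 | h0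
    · have : Subsingleton N := by
        rw [← Module.finrank_zero_iff (R := k), ← hMN, Module.finrank_zero_iff]
        exact h0
      rw [FDMod.green_of_subsingleton, FDMod.green_of_subsingleton]
    obtain ⟨e⟩ := Representation.nonempty_equiv_of_character_eq _ _ h
    obtain ⟨ν, hν⟩ := Module.End.exists_eigenvalue (D.resEnd M (D.g ^ D.n))
    have he : ∀ x : M, gPowSub hD N ν (e x) = e (gPowSub hD M ν x) := by
      intro x
      rw [gPowSub_apply, gPowSub_apply]
      exact ((map_sub e _ _).trans
        (congrArg₂ (· - ·) (e.map_rep (D.g ^ D.n) x) (map_smul e ν x))).symm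
    have hker := character_ofSub_eq e (p := LinearMap.ker (gPowSub hD M ν))
      (q := LinearMap.ker (gPowSub hD N ν)) (fun x => by
        rw [LinearMap.mem_ker, LinearMap.mem_ker, he]
        exact (e.toLinearEquiv.map_eq_zero_iff).symm)
    have hran := character_ofSub_eq e (p := LinearMap.range (gPowSub hD M ν))
      (q := LinearMap.range (gPowSub hD N ν)) (fun x => by
        constructor
        · rintro ⟨y, rfl⟩
          exact ⟨e y, he y⟩
        · rintro ⟨y, hy⟩
          obtain ⟨y, rfl⟩ := e.toLinearEquiv.surjective y
          exact ⟨y, e.toLinearEquiv.injective ((he y).symm.trans hy)⟩)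
    obtain ⟨e'⟩ := Representation.nonempty_equiv_of_character_eq _ _ hker
    have hlt : Module.finrank k (FDMod.ofSub (LinearMap.range (gPowSub hD M ν))) < d := by
      have h1 := ((gPowSub hD M ν).restrictScalars k).finrank_range_add_finrank_ker
      have h2 : 0 < Module.finrank k (LinearMap.ker ((gPowSub hD M ν).restrictScalars k)) := by
        rw [Module.finrank_pos_iff, Submodule.nontrivial_iff_ne_bot]
        obtain ⟨x, hx⟩ := hν.exists_hasEigenvector
        intro hb
        refine hx.2 ?_
        have hx' : x ∈ LinearMap.ker ((gPowSub hD M ν).restrictScalars k) :=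
          sub_eq_zero.2 (Module.End.mem_eigenspace_iff.1 hx.1)
        rwa [hb] at hx'
      have h3 : Module.finrank k (FDMod.ofSub (LinearMap.range (gPowSub hD M ν))) =
        Module.finrank k (LinearMap.range ((gPowSub hD M ν).restrictScalars k)) := rfl
      omega
    rw [FDMod.green_eq_of_isCompl (isCompl_gPowSub hD M ν),
      FDMod.green_eq_of_isCompl (isCompl_gPowSub hD N ν), map_add, map_add,
      ih _ hlt _ _ hran rfl]
    congr 1
    exact grothendieck_eq_of_scalar hD hn e' ν (fun x => Subtype.ext (sub_eq_zero.1 x.2))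
      (fun x => Subtype.ext (sub_eq_zero.1 x.2))

theorem grothendieck_eq_zero_of_traceHom_eq_zero (hD : D.IsNonNilpotent) (hn : 2 ≤ D.n)
    {z : GreenRing k D.H} (hz : ∀ x, D.traceHom x z = 0) : greenToGrothendieck k D.H z = 0 := by
  obtain ⟨M, N, rfl⟩ := GreenRing.exists_sub z
  rw [map_sub, sub_eq_zero]
  refine grothendieck_eq_of_character_eq hD hn M N (funext fun x => ?_)
  have := hz x
  rwa [map_sub, traceHom_green, traceHom_green, sub_eq_zero] at this

end GroupDatum

end

/-! ### The main theorem -/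

theorem mainTheorem6 {k : Type u} [Field k] [IsAlgClosed k] [CharZero k]
    {G : Type v} [Group G] [Finite G] (D : GroupDatum k G)
    (hD : D.IsNonNilpotent) (hn : 2 ≤ D.n) :
    (Ring.jacobson (GreenRing k D.H)).toAddSubgroup =
        projectiveSpan k D.H ⊓ greenOrthogonal (projectiveSpan k D.H) ∧
      projectiveSpan k D.H ⊓ greenOrthogonal (projectiveSpan k D.H) =
        (cartanMap k D.H).ker.map (projectiveSpan k D.H).subtype := by
  have hker : ∀ z, z ∈ (cartanMap k D.H).ker.map (projectiveSpan k D.H).subtype ↔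
      z ∈ projectiveSpan k D.H ∧ greenToGrothendieck k D.H z = 0 := by
    intro z
    constructor
    · rintro ⟨t, ht, rfl⟩
      exact ⟨t.2, ht⟩
    · rintro ⟨h1, h2⟩
      exact ⟨⟨z, h1⟩, h2, rfl⟩
  have h2 : projectiveSpan k D.H ⊓ greenOrthogonal (projectiveSpan k D.H) =
      (cartanMap k D.H).ker.map (projectiveSpan k D.H).subtype := by
    ext z
    rw [hker, AddSubgroup.mem_inf]
    -- In fact P^⊥ and ker φ coincide in the whole Green ring, the first implication passing through
    -- the vanishing of all traces.
    refine and_congr_right fun hP => ⟨fun hz => ?_, fun hz t ht => ?_⟩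
    · exact GroupDatum.grothendieck_eq_zero_of_traceHom_eq_zero hD hn
        (GroupDatum.traceHom_eq_zero_of_mem_greenOrthogonal hD hz)
    · exact GroupDatum.greenForm_eq_zero_of_grothendieck_eq_zero hz ht
  refine ⟨?_, h2⟩
  rw [h2]
  ext z
  rw [hker, Submodule.mem_toAddSubgroup]
  refine ⟨fun hz => ⟨?_, ?_⟩, fun hz => ?_⟩
  -- Vanishing of the layer functionals on the radical leaves only induced modules, which are
  -- projective.
  · obtain ⟨C, C', rfl⟩ := GroupDatum.exists_eq_ind_sub_ind hD z
      (GroupDatum.layerHom_eq_zero_of_mem_jacobson hD hn hz)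
    exact sub_mem (FDMod.green_mem_projectiveSpan _ (GroupDatum.ind_projective hD C))
      (FDMod.green_mem_projectiveSpan _ (GroupDatum.ind_projective hD C'))
  · exact GroupDatum.grothendieck_eq_zero_of_traceHom_eq_zero hD hn
      (GroupDatum.traceHom_eq_zero_of_mem_jacobson hz)
  · exact GroupDatum.mem_jacobson_of_mem_projectiveSpan hD hz.1 hz.2
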